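/- **Setting.** Let $X$ be a compact Polish space, $Z$ a locally compact Polish space, and $\mathcal F$ a minimal foliated structure on $X$ (a maximal foliated atlas of leaf dimension $n$, transversely modelled on $Z$; minimal means that every leaf is dense). A regular foliated atlas $\{U_i,\phi_i\}$ of $\mathcal F$ is one such that each $\overline{U_i}$ is compact and contained in the domain of a chart of $\mathcal F$ extending $\phi_i$, the cover $\{U_i\}$ is locally finite, and each plaque of $U_i$ meets at most one plaque of $U_j$. It induces a defining cocycle $\{U_i,p_i,h_{ij}\}$: the distinguished submersions $p_i:U_i\to T_i$ and the homeomorphisms $h_{ij}:p_i(U_i\cap U_j)\to p_j(U_i\cap U_j)$ with $h_{ij}p_i=p_j$ on $U_i\cap U_j$. Let $\mathcal H$ be the pseudogroup on $T=\bigsqcup_iT_i$ generated by the maps $h_{ij}$. For a set $S$ of homeomorphisms between open subsets of $T$, let $\overline S$ be the set of homeomorphisms $g$ between open subsets of $T$ that are in the closure of $\{f\in S\mid \operatorname{dom}f=\operatorname{dom}g\}$ in $C(\operatorname{dom}g,T)$ with the compact-open topology, and let $\overline{\mathcal H}$ be the set of homeomorphisms between open subsets of $T$ that locally belong to $\overline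 S$. Call $S\subset\mathcal H$ *admissible* if it is closed under composition, inversion and restriction to open sets, every element of $\mathcal H$ locally belongs to $S$, $\mathcal H$ is equicontinuous with $S$ (there are an open cover $\{T'_k\}$ of $T$ with metrics $d_k$ on $T'_k$ inducing its topology, which are quasi-locally equal (for some function $\delta_0:(0,\infty)\to(0,\infty)$, every $z\in T'_k\cap T'_l$ has a neighborhood in $T'_k\cap T'_l$ on which $d_k(x,y)<\delta_0(\varepsilon)$ implies $d_l(x,y)<\varepsilon$ for all $\varepsilon>0$), and, for each $\varepsilon>0$, some $\delta>0$ such that $d_k(x,y)<\delta$ implies $d_l(h(x),h(y))<\varepsilon$ for all $h\in S$, all $k,l$, and all $x,y\in T'_k\cap h^{-1}(T'_l)$), and both $S$ and $\overline S$ satisfy the strong quasi-analyticity condition: any of their elements that is the identity on some non-empty open subset of its domain is the identity on its domain. **Construction.** Given a regular foliated atlas, an admissible $S$, an index $i_0$ and a base point $x_0\in U_{i_0}$, let $\widehat T_0$ be the set of germs $\operatorname{germ}(g,x)$ with $g\in\overline{\mathcal H}$, $x\in\operatorname{dom}g$ and $g(x)=p_{i_0}(x_0)$. It is a subspace of the space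 of all germs of maps in $\overline{\mathcal H}$, endowed with the quotient topology by the germ map of $\{(g,x)\mid g\in\overline S,\ x\in\operatorname{dom}g\}$, where $\overline S$ has the compact-open topology of partial maps with open domains. Let $\hat\pi_0:\widehat T_0\to T$, $\operatorname{germ}(g,x)\mapsto x$, and $\widehat h(\operatorname{germ}(g,x))=\operatorname{germ}(gh^{-1},h(x))$ for $h\in\mathcal H$ and $x\in\operatorname{dom} h$. Let $\widehat X_0$ be the quotient of $$\widetilde X_0=\{(x,\gamma,i)\mid x\in U_i,\ \gamma\in\widehat T_0,\ p_i(x)=\hat\pi_0(\gamma)\}\subset\bigsqcup_iU_i\times\hat\pi_0^{-1}(T_i)$$ by the relation $(x,\gamma,i)\sim(y,\delta,j)$ if $x=y$ and $\gamma=\widehat{h_{ji}}(\delta)$, let $\hat\pi_0:\widehat X_0\to X$, $[x,\gamma,i]\mapsto x$, and let $\widehat{\mathcal F}_0$ be the foliated structure on $\widehat X_0$ whose distinguished submersions are the maps $[x,\gamma,i]\mapsto\gamma$ (for fixed $i$); thus its plaques are the fibers of these maps. **Proposition.** Let $(\widehat X_0,\widehat{\mathcal F}_0,\hat\pi_0)$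 and $(\widehat X_0',\widehat{\mathcal F}_0',\hat\pi_0')$ be obtained from the same $(X,\mathcal F)$ by using any two regular foliated atlases of $\mathcal F$ (equal or not), any admissible families $S$ and $S'$ for them, and any two base points of $X$ (equal or not). Then there is a foliated homeomorphism $F:(\widehat X_0,\widehat{\mathcal F}_0)\to(\widehat X'_0,\widehat{\mathcal F}'_0)$ (a homeomorphism that maps leaves onto leaves and carries one foliated structure to the other) such that $\hat\pi_0'F=\hat\pi_0$. In particular, up to such homeomorphisms, $(\widehat X_0,\widehat{\mathcal F}_0)$ and $\hat\pi_0$ are independent of the base point and of the regular defining cocycle. -/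

import Mathlib

open Set Filter Topology

universe u v w

noncomputable section

namespace Molino

/-! ### Local transformations, pseudogroups and pseudo-star-groups

A local transformation of `T` is an `OpenPartialHomeomorph T T`. Two of them are the same local
transformation when they have the same graph (`≈`), so the families below are saturated for `≈`. -/

section Pseudogroups

variable {T : Type u} [TopologicalSpace T]

/-- A pseudogroup of local transformations of `T`. -/
structure IsPseudogroup (H : Set (OpenPartialHomeomorph T T)) : Prop where
  refl_mem : OpenPartialHomeomorph.refl T ∈ H
  trans_mem : ∀ e ∈ H, ∀ f ∈ H, e.trans f ∈ H
  symm_mem : ∀ e ∈ H, e.symm ∈ H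
  restr_mem : ∀ e ∈ H, ∀ O : Set T, IsOpen O → e.restr O ∈ H
  union_mem : ∀ e : OpenPartialHomeomorph T T,
    (∀ x ∈ e.source, ∃ O : Set T, IsOpen O ∧ x ∈ O ∧ e.restr O ∈ H) → e ∈ H
  mem_of_eqOnSource : ∀ e ∈ H, ∀ f : OpenPartialHomeomorph T T, f ≈ e → f ∈ H

/-- The pseudogroup generated by a family of local transformations. -/
def generatedPseudogroup (E : Set (OpenPartialHomeomorph T T)) :
    Set (OpenPartialHomeomorph T T) :=
  ⋂₀ {H | IsPseudogroup H ∧ E ⊆ H}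

/-- A local pseudo-star-group: a family of local transformations that is closed under composition,
inversion and restriction to open subsets of the domains. -/
structure IsLocalPseudoStarGroup (S : Set (OpenPartialHomeomorph T T)) : Prop where
  trans_mem : ∀ e ∈ S, ∀ f ∈ S, e.trans f ∈ S
  symm_mem : ∀ e ∈ S, e.symm ∈ S
  restr_mem : ∀ e ∈ S, ∀ O : Set T, IsOpen O → e.restr O ∈ S
  mem_of_eqOnSource : ∀ e ∈ S, ∀ f : OpenPartialHomeomorph T T, f ≈ e → f ∈ S

/-- A map in `S` that is the identity on some non-empty open subset of its domain is the identity
on its whole domain. -/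
def IsQuasiAnalyticFamily (S : Set (OpenPartialHomeomorph T T)) : Prop :=
  ∀ h ∈ S, (∃ O : Set T, IsOpen O ∧ O.Nonempty ∧ O ⊆ h.source ∧ ∀ x ∈ O, h x = x) →
    ∀ x ∈ h.source, h x = x

/-- The compact-open topology on local transformations (as partial maps with open domain), with
subbasic open sets `{h | K ⊆ dom h, h(K) ⊆ O}` for `K` compact and `O` open. -/
instance compactOpenTopology : TopologicalSpace (OpenPartialHomeomorph T T) :=
  TopologicalSpace.generateFrom
    {N | ∃ K O : Set T, IsCompact K ∧ IsOpen O ∧ N = {h : OpenPartialHomeomorph T T | K ⊆ h.source ∧ MapsTo h K O}}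

/-- `S̄`: the local transformations `g` that are in the closure of `S ∩ C(O, T)` for the
compact-open topology, where `O = dom g`. -/
def starClosure (S : Set (OpenPartialHomeomorph T T)) : Set (OpenPartialHomeomorph T T) :=
  {g | g ∈ closure {f | f ∈ S ∧ f.source = g.source}}

/-- The closure `H̄` of the pseudogroup generated by `S`: the local transformations which, around
every point of their domain, restrict to elements of `S̄`. -/
def closurePseudogroup (S : Set (OpenPartialHomeomorph T T)) :
    Set (OpenPartialHomeomorph T T) :=
  {h | ∀ x ∈ h.source, ∃ O : Set T, IsOpen O ∧ x ∈ O ∧ O ⊆ h.source ∧ h.restr O ∈ starClosure S}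

theorem starClosure_subset_closurePseudogroup (S : Set (OpenPartialHomeomorph T T)) :
    starClosure S ⊆ closurePseudogroup S := by
  intro g hg x hx
  refine ⟨g.source, g.open_source, hx, Subset.rfl, ?_⟩
  rw [OpenPartialHomeomorph.restr_eq_of_source_subset Subset.rfl]
  exact hg

variable (T) in
/-- A cover of the space `T` by quasi-locally equal metric spaces that induces the topology of `T`,
i.e. a representative of a quasi-local metric on `T` compatible with the topology. -/
structure QuasiLocalMetric where
  ι : Type u
  dom : ι → Set T
  metric : ∀ i, MetricSpace (dom i)
  isOpen_dom : ∀ i, IsOpen (dom i)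
  cover : ∀ x, ∃ i, x ∈ dom i
  topology_eq : ∀ i, (metric i).toPseudoMetricSpace.toUniformSpace.toTopologicalSpace =
    (instTopologicalSpaceSubtype : TopologicalSpace (dom i))
  quasiLocallyEqual : ∃ δ : ℝ → ℝ, (∀ ε > 0, 0 < δ ε) ∧
    ∀ i j, ∀ z ∈ dom i ∩ dom j, ∃ O : Set T, IsOpen O ∧ z ∈ O ∧ O ⊆ dom i ∩ dom j ∧
      ∀ ε > 0, ∀ (x y : T) (xi : x ∈ dom i) (yi : y ∈ dom i) (xj : x ∈ dom j) (yj : y ∈ dom j),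
        x ∈ O → y ∈ O → (metric i).dist ⟨x, xi⟩ ⟨y, yi⟩ < δ ε →
          (metric j).dist ⟨x, xj⟩ ⟨y, yj⟩ < ε

/-- The equicontinuity condition for a family `S` of local transformations. -/
def QuasiLocalMetric.IsEquicontinuousFamily (Q : QuasiLocalMetric T)
    (S : Set (OpenPartialHomeomorph T T)) : Prop :=
  ∀ ε > 0, ∃ δ > 0, ∀ h ∈ S, ∀ (i j : Q.ι) (x y : T) (xi : x ∈ Q.dom i) (yi : y ∈ Q.dom i)
    (hxj : h x ∈ Q.dom j) (hyj : h y ∈ Q.dom j), x ∈ h.source → y ∈ h.source →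
      (Q.metric i).dist ⟨x, xi⟩ ⟨y, yi⟩ < δ → (Q.metric j).dist ⟨h x, hxj⟩ ⟨h y, hyj⟩ < ε

/-- The conditions on a local sub-pseudo-star-group `S` of the pseudogroup `H` that is used to
construct the Molino space: `S` generates `H` (every map in `H` locally belongs to `S`), `H` is
equicontinuous and strongly quasi-analytic with `S`, and `H̄` is strongly quasi-analytic
with `S̄`. -/
structure IsAdmissible (H S : Set (OpenPartialHomeomorph T T)) : Prop where
  isLocal : IsLocalPseudoStarGroup S
  subset : S ⊆ H
  generates : ∀ h ∈ H, ∀ x ∈ h.source, ∃ O : Set T, IsOpen O ∧ x ∈ O ∧ h.restr O ∈ S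
  equicontinuous : ∃ Q : QuasiLocalMetric T, Q.IsEquicontinuousFamily S
  quasiAnalytic : IsQuasiAnalyticFamily S
  quasiAnalytic_closure : IsQuasiAnalyticFamily (starClosure S)

/-! ### Germs -/

/-- The germ of `g` at `x`. -/
def germ (g : OpenPartialHomeomorph T T) (x : T) : Σ x : T, Germ (𝓝 x) T :=
  ⟨x, (g : T → T)⟩

/-- `T̂`: the set of germs of maps in `H̄`. -/
def That (S : Set (OpenPartialHomeomorph T T)) : Type u :=
  {γ : Σ x : T, Germ (𝓝 x) T //
    ∃ g ∈ closurePseudogroup S, ∃ x ∈ g.source, γ = germ g x}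

/-- `S̄ * T = {(g, x) | g ∈ S̄, x ∈ dom g}`, as a subspace of `S̄ × T`. -/
abbrev StarPairs (S : Set (OpenPartialHomeomorph T T)) : Type u :=
  {q : OpenPartialHomeomorph T T × T // q.1 ∈ starClosure S ∧ q.2 ∈ q.1.source}

/-- The germ map `S̄ * T → T̂`. -/
def germMap (S : Set (OpenPartialHomeomorph T T)) (q : StarPairs S) : That S :=
  ⟨germ q.1.1 q.1.2, q.1.1, starClosure_subset_closurePseudogroup S q.2.1, q.1.2, q.2.2, rfl⟩

/-- `T̂` carries the quotient topology of the germ map. -/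
instance (S : Set (OpenPartialHomeomorph T T)) : TopologicalSpace (That S) :=
  TopologicalSpace.coinduced (germMap S) inferInstance

/-- `T̂₀`: the subspace of `T̂` of the germs with target `x₀`. -/
abbrev That₀ (S : Set (OpenPartialHomeomorph T T)) (x₀ : T) : Type u :=
  {γ : That S // γ.1.2.value = x₀}

/-- `π̂₀ : T̂₀ → T`, the source of a germ. -/
def That₀.source {S : Set (OpenPartialHomeomorph T T)} {x₀ : T} (γ : That₀ S x₀) : T := γ.1.1.1

/-- The graph of `ĥ : germ(g, x) ↦ germ(g h⁻¹, h(x))`. -/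
def hatGraph {S : Set (OpenPartialHomeomorph T T)} {x₀ : T} (h : OpenPartialHomeomorph T T)
    (γ δ : That₀ S x₀) : Prop :=
  ∃ g ∈ closurePseudogroup S, ∃ x, x ∈ g.source ∧ x ∈ h.source ∧
    γ.1.1 = germ g x ∧ δ.1.1 = germ (h.symm.trans g) (h x)

end Pseudogroups

/-! ### Leaves and foliated homeomorphisms -/

section Leaves

variable {X : Type*} [TopologicalSpace X] {Y : Type*} [TopologicalSpace Y]

/-- `A` is a relatively open subset of `P`. -/
def IsOpenIn (A P : Set X) : Prop := ∃ O, IsOpen O ∧ A = P ∩ O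

/-- The leaf topology of a foliated atlas with set of plaques `Ps`, generated by the relatively open
subsets of the plaques. -/
abbrev leafTopology (Ps : Set (Set X)) : TopologicalSpace X :=
  TopologicalSpace.generateFrom {A | ∃ P ∈ Ps, IsOpenIn A P}

/-- The leaf through `x`: its connected component for the leaf topology. -/
def leaf (Ps : Set (Set X)) (x : X) : Set X :=
  @connectedComponent X (leafTopology Ps) x

/-- The homeomorphism `F` between spaces with foliated atlases with sets of plaques `Ps` and `Qs` is
foliated: it maps leaves onto leaves, and it carries the first foliated structure to the second
one (plaques of the first one are mapped to sets coherent with the plaques of the second one). -/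
structure IsFoliatedHomeomorph (Ps : Set (Set X)) (Qs : Set (Set Y)) (F : X ≃ₜ Y) : Prop where
  image_leaf : ∀ x, F '' leaf Ps x = leaf Qs (F x)
  coherent : ∀ P ∈ Ps, ∀ Q ∈ Qs, IsOpenIn (F '' P ∩ Q) (F '' P) ∧ IsOpenIn (F '' P ∩ Q) Q

end Leaves

/-! ### Foliated spaces -/

section Foliated

variable (n : ℕ) (X : Type u) (Z : Type v) [TopologicalSpace X] [TopologicalSpace Z]

/-- A foliated chart of leaf dimension `n` transversely modelled on `Z`: a homeomorphism of an open
subset of `X` to `B × T`, with `B` an open ball of `ℝⁿ` and `T` open in `Z`. -/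
structure FoliatedChart where
  toHomeo : OpenPartialHomeomorph X (EuclideanSpace ℝ (Fin n) × Z)
  center : EuclideanSpace ℝ (Fin n)
  radius : ℝ
  radius_pos : 0 < radius
  base : Set Z
  isOpen_base : IsOpen base
  target_eq : toHomeo.target = Metric.ball center radius ×ˢ base

variable {n X Z}

namespace FoliatedChart

/-- The distinguished open set of the chart. -/
def source (c : FoliatedChart n X Z) : Set X := c.toHomeo.source

/-- The distinguished submersion `p : U → T`. -/
def proj (c : FoliatedChart n X Z) (x : c.source) : c.base :=
  ⟨(c.toHomeo x.1).2, by
    have h := c.toHomeo.map_source x.2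
    rw [c.target_eq] at h
    exact h.2⟩

/-- The plaque over `y`. -/
def plaque (c : FoliatedChart n X Z) (y : c.base) : Set X :=
  Subtype.val '' (c.proj ⁻¹' {y})

/-- Two charts are coherently foliated: intersections of plaques are open in both plaques. -/
def Coherent (c d : FoliatedChart n X Z) : Prop :=
  ∀ y z, IsOpenIn (c.plaque y ∩ d.plaque z) (c.plaque y) ∧
    IsOpenIn (c.plaque y ∩ d.plaque z) (d.plaque z)

end FoliatedChart

variable (n X Z) in
/-- A foliated structure on `X`: a maximal foliated atlas. -/
structure FoliatedStructure where
  charts : Set (FoliatedChart n X Z)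
  cover : ∀ x, ∃ c ∈ charts, x ∈ c.source
  coherent : ∀ c ∈ charts, ∀ d ∈ charts, c.Coherent d
  maximal : ∀ c : FoliatedChart n X Z, (∀ d ∈ charts, c.Coherent d) → c ∈ charts

namespace FoliatedStructure

/-- The plaques of a foliated structure. -/
def plaques (ℱ : FoliatedStructure n X Z) : Set (Set X) :=
  {P | ∃ c ∈ ℱ.charts, ∃ y, P = c.plaque y}

/-- A foliated space is minimal when all of its leaves are dense. -/
def IsMinimal (ℱ : FoliatedStructure n X Z) : Prop := ∀ x, Dense (leaf ℱ.plaques x)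

end FoliatedStructure

/-- A regular foliated atlas of `ℱ`, indexed by `ι`. -/
structure RegularAtlas (ℱ : FoliatedStructure n X Z) (ι : Type w) where
  chart : ι → FoliatedChart n X Z
  chart_mem : ∀ i, chart i ∈ ℱ.charts
  cover : ∀ x, ∃ i, x ∈ (chart i).source
  isCompact_closure : ∀ i, IsCompact (closure (chart i).source)
  extends_chart : ∀ i, ∃ c ∈ ℱ.charts, closure (chart i).source ⊆ c.source ∧
    EqOn (chart i).toHomeo c.toHomeo (chart i).source
  locallyFinite : LocallyFinite fun i => (chart i).source
  plaque_unique : ∀ i j (y : (chart i).base) (z z' : (chart j).base),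
    ((chart i).plaque y ∩ (chart j).plaque z).Nonempty →
    ((chart i).plaque y ∩ (chart j).plaque z').Nonempty → z = z'

namespace RegularAtlas

variable {ℱ : FoliatedStructure n X Z} {ι : Type w} (𝒰 : RegularAtlas ℱ ι)

/-- The distinguished open set `U_i`. -/
abbrev U (i : ι) : Set X := (𝒰.chart i).source

/-- The complete transversal `T = ⨆ T_i` (disjoint union). -/
abbrev Transversal : Type (max v w) := Σ i, (𝒰.chart i).base

/-- `p_i : U_i → T_i ⊆ T`. -/
def p (i : ι) (x : 𝒰.U i) : 𝒰.Transversal := ⟨i, (𝒰.chart i).proj x⟩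

/-- `T_{ij} = p_i(U_i ∩ U_j)`. -/
def overlap (i j : ι) : Set 𝒰.Transversal :=
  {t | ∃ (x : X) (xi : x ∈ 𝒰.U i) (_ : x ∈ 𝒰.U j), 𝒰.p i ⟨x, xi⟩ = t}

open Classical in
/-- The map `h_{ij} : p_i(x) ↦ p_j(x)` on `T_{ij}` (extended by the identity off `T_{ij}`). -/
def holFun (i j : ι) (t : 𝒰.Transversal) : 𝒰.Transversal :=
  if h : t ∈ 𝒰.overlap i j then 𝒰.p j ⟨h.choose, h.choose_spec.choose_spec.choose⟩ else t

theorem holFun_p {i j : ι} {x : X} (xi : x ∈ 𝒰.U i) (xj : x ∈ 𝒰.U j) :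
    𝒰.holFun i j (𝒰.p i ⟨x, xi⟩) = 𝒰.p j ⟨x, xj⟩ := by
  have h : 𝒰.p i ⟨x, xi⟩ ∈ 𝒰.overlap i j := ⟨x, xi, xj, rfl⟩
  rw [holFun, dif_pos h]
  have e := h.choose_spec.choose_spec.choose_spec
  have e' : (𝒰.chart i).proj ⟨h.choose, h.choose_spec.choose⟩ = (𝒰.chart i).proj ⟨x, xi⟩ :=
    eq_of_heq (Sigma.mk.inj e).2
  have key := 𝒰.plaque_unique i j ((𝒰.chart i).proj ⟨x, xi⟩)
    ((𝒰.chart j).proj ⟨h.choose, h.choose_spec.choose_spec.choose⟩) ((𝒰.chart j).proj ⟨x, xj⟩)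
    ⟨h.choose, ⟨⟨h.choose, h.choose_spec.choose⟩, e', rfl⟩,
      ⟨⟨h.choose, h.choose_spec.choose_spec.choose⟩, rfl, rfl⟩⟩
    ⟨x, ⟨⟨x, xi⟩, rfl, rfl⟩, ⟨⟨x, xj⟩, rfl, rfl⟩⟩
  exact congrArg (Sigma.mk j) key

theorem continuous_p (i : ι) : Continuous (𝒰.p i) := by
  refine continuous_sigmaMk.comp (Continuous.subtype_mk ?_ _)
  exact continuous_snd.comp (continuousOn_iff_continuous_domRestrict.1
    (𝒰.chart i).toHomeo.continuousOn)

/-- Local sections of `p_i` through each point of `U_i`. -/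
theorem exists_section (i : ι) (x : 𝒰.U i) :
    ∃ s : (𝒰.chart i).base → 𝒰.U i, Continuous s ∧ (∀ t, 𝒰.p i (s t) = ⟨i, t⟩) ∧
      s ((𝒰.chart i).proj x) = x := by
  set c := 𝒰.chart i with hc
  have hx : c.toHomeo x.1 ∈ c.toHomeo.target := c.toHomeo.map_source x.2
  have ht : ∀ t : c.base, ((c.toHomeo x.1).1, (t : Z)) ∈ c.toHomeo.target := by
    intro t
    rw [c.target_eq] at hx ⊢
    exact ⟨hx.1, t.2⟩
  refine ⟨fun t => ⟨c.toHomeo.symm ((c.toHomeo x.1).1, (t : Z)), c.toHomeo.map_target (ht t)⟩,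
    ?_, ?_, ?_⟩
  · refine Continuous.subtype_mk ?_ _
    exact c.toHomeo.symm.continuousOn.comp_continuous (by fun_prop) ht
  · intro t
    refine congrArg (Sigma.mk i) (Subtype.ext ?_)
    change (c.toHomeo (c.toHomeo.symm _)).2 = _
    rw [c.toHomeo.right_inv (ht t)]
  · exact Subtype.ext (c.toHomeo.left_inv x.2)

theorem isOpen_overlap (i j : ι) : IsOpen (𝒰.overlap i j) := by
  rw [isOpen_iff_mem_nhds]
  rintro _ ⟨x, xi, xj, rfl⟩
  obtain ⟨s, hs, hps, hsx⟩ := 𝒰.exists_section i ⟨x, xi⟩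
  have hopen : IsOpen {t | ((s t : 𝒰.U i) : X) ∈ 𝒰.U j} :=
    (𝒰.chart j).toHomeo.open_source.preimage (continuous_subtype_val.comp hs)
  refine mem_of_superset ((isOpenMap_sigmaMk (σ := fun k => (𝒰.chart k).base) _ hopen).mem_nhds
    ⟨(𝒰.chart i).proj ⟨x, xi⟩, ?_, rfl⟩) ?_
  · change ((s _ : 𝒰.U i) : X) ∈ 𝒰.U j
    rw [hsx]
    exact xj
  · rintro _ ⟨t, ht, rfl⟩
    exact ⟨s t, (s t).2, ht, hps t⟩

theorem continuousOn_holFun (i j : ι) : ContinuousOn (𝒰.holFun i j) (𝒰.overlap i j) := by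
  rintro _ ⟨x, xi, xj, rfl⟩
  apply ContinuousAt.continuousWithinAt
  obtain ⟨s, hs, hps, hsx⟩ := 𝒰.exists_section i ⟨x, xi⟩
  have hopen : IsOpen {t | ((s t : 𝒰.U i) : X) ∈ 𝒰.U j} :=
    (𝒰.chart j).toHomeo.open_source.preimage (continuous_subtype_val.comp hs)
  have hmem : (𝒰.chart i).proj ⟨x, xi⟩ ∈ {t | ((s t : 𝒰.U i) : X) ∈ 𝒰.U j} := by
    change ((s _ : 𝒰.U i) : X) ∈ 𝒰.U j
    rw [hsx]
    exact xj
  refine ((IsOpenEmbedding.sigmaMk (σ := fun k => (𝒰.chart k).base) (i := i)).continuousAt_iff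
    (x := (𝒰.chart i).proj ⟨x, xi⟩)).1 ?_
  refine ContinuousOn.continuousAt ?_ (hopen.mem_nhds hmem)
  rw [continuousOn_iff_continuous_domRestrict]
  have e : ({t | ((s t : 𝒰.U i) : X) ∈ 𝒰.U j}).domRestrict
      (fun t => 𝒰.holFun i j ⟨i, t⟩) =
      fun t => 𝒰.p j ⟨s t.1, t.2⟩ := by
    funext t
    have := 𝒰.holFun_p (s t.1).2 t.2
    rw [← this, Subtype.coe_eta, hps]
    rfl
  refine Eq.mpr (congrArg Continuous e) ?_
  exact (𝒰.continuous_p j).comp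
    (Continuous.subtype_mk (continuous_subtype_val.comp (hs.comp continuous_subtype_val)) _)

/-- The elementary holonomy transformation `h_{ij} : T_{ij} → T_{ji}`, with `h_{ij} p_i = p_j` on
`U_i ∩ U_j`. -/
def hol (i j : ι) : OpenPartialHomeomorph 𝒰.Transversal 𝒰.Transversal where
  toFun := 𝒰.holFun i j
  invFun := 𝒰.holFun j i
  source := 𝒰.overlap i j
  target := 𝒰.overlap j i
  map_source' := by
    rintro _ ⟨x, xi, xj, rfl⟩
    exact ⟨x, xj, xi, (𝒰.holFun_p xi xj).symm⟩
  map_target' := by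
    rintro _ ⟨x, xj, xi, rfl⟩
    exact ⟨x, xi, xj, (𝒰.holFun_p xj xi).symm⟩
  left_inv' := by
    rintro _ ⟨x, xi, xj, rfl⟩
    rw [𝒰.holFun_p xi xj, 𝒰.holFun_p xj xi]
  right_inv' := by
    rintro _ ⟨x, xj, xi, rfl⟩
    rw [𝒰.holFun_p xj xi, 𝒰.holFun_p xi xj]
  open_source := 𝒰.isOpen_overlap i j
  open_target := 𝒰.isOpen_overlap j i
  continuousOn_toFun := 𝒰.continuousOn_holFun i j
  continuousOn_invFun := 𝒰.continuousOn_holFun j i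

/-- The representative `H` on `T` of the holonomy pseudogroup induced by the defining cocycle
`{U_i, p_i, h_{ij}}`. -/
def holonomyPseudogroup : Set (OpenPartialHomeomorph 𝒰.Transversal 𝒰.Transversal) :=
  generatedPseudogroup {h | ∃ i j, h = 𝒰.hol i j}

/-! ### The Molino space -/

variable (S : Set (OpenPartialHomeomorph 𝒰.Transversal 𝒰.Transversal)) (t₀ : 𝒰.Transversal)

/-- `X̃₀`: the subspace of `⨆ U_i × T̂_{i,0}` (disjoint union) of the triples `(x, γ, i)` with
`p_i(x) = π̂₀(γ)`. This equation forces `γ` to belong to `T̂_{i,0} = π̂₀⁻¹(T_i)`. -/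
abbrev XTilde : Type (max u v w) :=
  {q : Σ i, 𝒰.U i × That₀ S t₀ // 𝒰.p q.1 q.2.1 = q.2.2.source}

/-- `(x, γ, i) ∼ (y, δ, j)` when `x = y` and `γ = ĥ_{ji}(δ)`. -/
def glue (q r : 𝒰.XTilde S t₀) : Prop :=
  (q.1.2.1 : X) = r.1.2.1 ∧ hatGraph (𝒰.hol r.1.1 q.1.1) r.1.2.2 q.1.2.2

/-- `X̂₀`: the quotient space of `X̃₀`. -/
def XHat : Type (max u v w) := Quot (𝒰.glue S t₀)

instance : TopologicalSpace (𝒰.XHat S t₀) := inferInstanceAs (TopologicalSpace (Quot _))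

/-- `π̂₀ : X̂₀ → X`, `[x, γ, i] ↦ x`. -/
def piHat : 𝒰.XHat S t₀ → X := Quot.lift (fun q => (q.1.2.1 : X)) fun _ _ h => h.1

/-- The plaques of `X̂₀`: the fibres `{[x, γ, i] | x ∈ U_i, p_i(x) = π̂₀(γ)}` of the distinguished
submersions `p̂_{i,0} : Û_{i,0} → T̂_{i,0}`, `[x, γ, i] ↦ γ`, of the foliated structure `F̂₀`. -/
def hatPlaques : Set (Set (𝒰.XHat S t₀)) :=
  {P | ∃ (i : ι) (γ : That₀ S t₀), γ.source.1 = i ∧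
    P = {z | ∃ q : 𝒰.XTilde S t₀, q.1.1 = i ∧ q.1.2.2 = γ ∧ z = Quot.mk _ q}}

end RegularAtlas
end Foliated
end Molino
end

/-! A class `[x, γ, i]`, with `γ` the germ of `g` at `p_i(x)`, yields the germ at `x` of `g ∘ p_i`,
a map from `X` to the transversal `T` with value `t₀` at `x`. Since `h_{ij} p_i = p_j` and the `p_i`
are open, the gluing relation is exactly equality of these germs (`glue_iff`). Both Molino spaces
thus become sets of germs on the same space `X`, and the isomorphism is sought in the form `ψ ↦ l ∘
ψ`, for a local homeomorphism `l` from `T` to `T'` with `l(t₀) = t₁`. In charts this reads `γ ↦ l γ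
c⁻¹`, where `c` is a holonomy map from one transversal to the other (`exists_isBox`).

The heart is to compare the families `S` and `S'`, which are unrelated a priori. By compactness of
`X`, every holonomy germ is a chain of finitely many generators, each used only at points of a
compact set (`isChainGerm_of_mem`). Equicontinuity then makes chains of any length, starting in a
fixed small open set `V`, extend to all of `V` by elements of `S` whose conjugates are in `S'`
(`exists_uniform_extension`, `exists_holonomy_extension`). By quasi-analyticity an element of `S`
agrees with the map obtained by such an extension, so its conjugate is in `S'`. Passing to closures,
`f ↦ d f c⁻¹` carries `S̄` locally to `S̄'`, for holonomy maps `c` and `d` (`transports_of_isBox`),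
on domains that do not depend on `f` near a given map. This uniformity makes the induced map of
germs continuous for the quotient topologies.

To reach the prescribed base point, `l` is a holonomy map followed by some `a ∈ S̄'`. Such an `a`
exists because leaves are dense: holonomy maps bring one point arbitrarily close to the other, they
and their inverses extend uniformly, and an ultrafilter limit is a homeomorphism in `S̄'`
(`exists_mem_starClosure_apply_eq`).

The map induced by `l⁻¹` is the inverse, and `π̂₀` is preserved because base points of germs are.
Locally, the map sends `[x, γ, i]` to `[x, γ', j]` with `γ'` constant as `x` moves in a plaque, so
plaques correspond and leaves go onto leaves (`coherent_hatPlaques`). -/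

namespace Molino

/-! ### The compact-open topology and the closure of a family -/

section CompactOpen

variable {T T' : Type*} [TopologicalSpace T] [TopologicalSpace T']

theorem isOpen_setOf_mapsTo {K O : Set T} (hK : IsCompact K) (hO : IsOpen O) :
    IsOpen {h : OpenPartialHomeomorph T T | K ⊆ h.source ∧ MapsTo h K O} :=
  TopologicalSpace.isOpen_generateFrom_of_mem ⟨K, O, hK, hO, rfl⟩

theorem continuous_trans_trans (k : OpenPartialHomeomorph T' T) (l : OpenPartialHomeomorph T T') :
    Continuous fun f : OpenPartialHomeomorph T T => (k.trans f).trans l := by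
  refine continuous_generateFrom_iff.2 ?_
  rintro _ ⟨K, O, hK, hO, rfl⟩
  by_cases hk : K ⊆ k.source
  · have hc : IsCompact (k '' K) := hK.image_of_continuousOn (k.continuousOn.mono hk)
    convert isOpen_setOf_mapsTo hc (l.isOpen_inter_preimage hO) using 1
    ext f
    constructor
    · rintro ⟨h1, h2⟩
      refine ⟨?_, ?_⟩
      · rintro _ ⟨x, hx, rfl⟩
        exact (h1 hx).1.2
      · rintro _ ⟨x, hx, rfl⟩
        exact ⟨(h1 hx).2, h2 hx⟩
    · rintro ⟨h1, h2⟩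
      exact ⟨fun x hx => ⟨⟨hk hx, h1 ⟨x, hx, rfl⟩⟩, (h2 ⟨x, hx, rfl⟩).1⟩,
        fun x hx => (h2 ⟨x, hx, rfl⟩).2⟩
  · convert isOpen_empty using 1
    refine eq_empty_of_forall_notMem ?_
    rintro f ⟨h1, -⟩
    exact hk fun x hx => (h1 hx).1.1

/-- Local compactness provides a compact `L` between `f(K)` and `g⁻¹(O)`. The conditions that the
first map send `K` into the interior of `L` and the second send `L` into `O` are independent of each
other. -/
theorem continuous_trans_pair [LocallyCompactSpace T] :
    Continuous fun q : OpenPartialHomeomorph T T × OpenPartialHomeomorph T T =>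
      q.1.trans q.2 := by
  refine continuous_generateFrom_iff.2 ?_
  rintro _ ⟨K, O, hK, hO, rfl⟩
  rw [isOpen_iff_mem_nhds]
  rintro ⟨f, g⟩ ⟨h1, h2⟩
  have hf : K ⊆ f.source := fun x hx => (h1 hx).1
  have hc : IsCompact (f '' K) := hK.image_of_continuousOn (f.continuousOn.mono hf)
  have hsub : f '' K ⊆ g.source ∩ g ⁻¹' O := by
    rintro _ ⟨x, hx, rfl⟩
    exact ⟨(h1 hx).2, h2 hx⟩
  obtain ⟨L, hL, hKL, hLO⟩ := exists_compact_between hc (g.isOpen_inter_preimage hO) hsub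
  have n1 := (isOpen_setOf_mapsTo hK (isOpen_interior (s := L))).mem_nhds
    (x := f) ⟨hf, fun x hx => hKL ⟨x, hx, rfl⟩⟩
  have n2 := (isOpen_setOf_mapsTo hL hO).mem_nhds
    (x := g) ⟨fun x hx => (hLO hx).1, fun x hx => (hLO hx).2⟩
  refine mem_of_superset (prod_mem_nhds n1 n2) ?_
  rintro ⟨f', g'⟩ ⟨⟨a1, a2⟩, ⟨b1, b2⟩⟩
  exact ⟨fun x hx => ⟨a1 hx, b1 (interior_subset (a2 hx))⟩,
    fun x hx => b2 (interior_subset (a2 hx))⟩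

theorem continuous_restr (V : Set T) :
    Continuous fun f : OpenPartialHomeomorph T T => f.restr V := by
  refine continuous_generateFrom_iff.2 ?_
  rintro _ ⟨K, O, hK, hO, rfl⟩
  by_cases hV : K ⊆ interior V
  · convert isOpen_setOf_mapsTo hK hO using 1
    ext f
    exact ⟨fun h => ⟨fun x hx => (h.1 hx).1, h.2⟩, fun h => ⟨fun x hx => ⟨h.1 hx, hV hx⟩, h.2⟩⟩
  · convert isOpen_empty using 1
    refine eq_empty_of_forall_notMem ?_
    rintro f ⟨h1, -⟩
    exact hV fun x hx => (h1 hx).2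

/-- Continuous images of elements of `S̄` belong to `S̄'` if the approximating elements of `S` are
mapped to elements of `S'` with a fixed domain. -/
theorem map_mem_starClosure {S : Set (OpenPartialHomeomorph T T)}
    {S' : Set (OpenPartialHomeomorph T' T')}
    {Φ : OpenPartialHomeomorph T T → OpenPartialHomeomorph T' T'} (hΦ : Continuous Φ)
    {N : Set (OpenPartialHomeomorph T T)} (hN : IsOpen N) {f : OpenPartialHomeomorph T T}
    (hf : f ∈ starClosure S) (hfN : f ∈ N)
    (h : ∀ φ ∈ S, φ.source = f.source → φ ∈ N → Φ φ ∈ S' ∧ (Φ φ).source = (Φ f).source) :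
    Φ f ∈ starClosure S' := by
  have h1 : f ∈ closure (N ∩ {φ | φ ∈ S ∧ φ.source = f.source}) :=
    hN.inter_closure ⟨hfN, hf⟩
  exact map_mem_closure hΦ h1 fun φ hφ => h φ hφ.2.1 hφ.2.2 hφ.1

theorem restr_mem_starClosure {S : Set (OpenPartialHomeomorph T T)}
    (hS : IsLocalPseudoStarGroup S) {f : OpenPartialHomeomorph T T} (hf : f ∈ starClosure S)
    {V : Set T} (hV : IsOpen V) : f.restr V ∈ starClosure S :=
  map_mem_starClosure (continuous_restr V) isOpen_univ hf (mem_univ _) fun φ hφ hs _ =>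
    ⟨hS.restr_mem φ hφ V hV, by rw [φ.restr_source, f.restr_source, hs]⟩

/-- Local composition in `S̄`. -/
theorem exists_trans_restr_mem_starClosure [LocallyCompactSpace T]
    {S : Set (OpenPartialHomeomorph T T)} (hS : IsLocalPseudoStarGroup S)
    {f a : OpenPartialHomeomorph T T} (ha : a ∈ starClosure S)
    {x : T} (hx : x ∈ f.source) (hfx : f x ∈ a.source) :
    ∃ V : Set T, IsOpen V ∧ x ∈ V ∧ ∃ N ∈ 𝓝 f, ∀ φ ∈ starClosure S, φ ∈ N →
      V ⊆ (φ.trans a).source ∧ (φ.trans a).restr V ∈ starClosure S := by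
  obtain ⟨K, hK, hxK, hKf⟩ := exists_compact_subset (f.isOpen_inter_preimage a.open_source)
    (x := x) ⟨hx, hfx⟩
  have hN := isOpen_setOf_mapsTo hK a.open_source
  refine ⟨interior K, isOpen_interior, hxK, _,
    hN.mem_nhds ⟨fun y hy => (hKf hy).1, fun y hy => (hKf hy).2⟩, ?_⟩
  intro φ hφ hφN
  -- Elements of `starClosure` are approximated by maps with exactly the same domain. Once `K` is
  -- sent into the domain of `a`, all the composites restrict to maps with domain `interior K`.
  have hsub : ∀ φ ∈ {h : OpenPartialHomeomorph T T | K ⊆ h.source ∧ MapsTo h K a.source},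
      ∀ ψ : OpenPartialHomeomorph T T, ψ.source = a.source →
        ((φ.trans ψ).restr (interior K)).source = interior K := by
    rintro φ ⟨h1, h2⟩ ψ hψ
    rw [(φ.trans ψ).restr_source' _ isOpen_interior]
    refine inter_eq_right.2 fun y hy => ⟨h1 (interior_subset hy), ?_⟩
    change φ y ∈ ψ.source
    rw [hψ]
    exact h2 (interior_subset hy)
  refine ⟨fun y hy => ⟨hφN.1 (interior_subset hy), hφN.2 (interior_subset hy)⟩, ?_⟩
  have h1 : φ ∈ closure ({h : OpenPartialHomeomorph T T | K ⊆ h.source ∧ MapsTo h K a.source} ∩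
      {φ' | φ' ∈ S ∧ φ'.source = φ.source}) := hN.inter_closure ⟨hφN, hφ⟩
  have h2 : (φ, a) ∈ closure (({h : OpenPartialHomeomorph T T | K ⊆ h.source ∧ MapsTo h K a.source}
      ∩ {φ' | φ' ∈ S ∧ φ'.source = φ.source}) ×ˢ {ψ | ψ ∈ S ∧ ψ.source = a.source}) := by
    rw [closure_prod_eq]
    exact ⟨h1, ha⟩
  have hc : Continuous fun q : OpenPartialHomeomorph T T × OpenPartialHomeomorph T T =>
      (q.1.trans q.2).restr (interior K) := (continuous_restr (interior K)).comp continuous_trans_pair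
  have hm : MapsTo (fun q : OpenPartialHomeomorph T T × OpenPartialHomeomorph T T =>
      (q.1.trans q.2).restr (interior K))
      (({h : OpenPartialHomeomorph T T | K ⊆ h.source ∧ MapsTo h K a.source}
      ∩ {φ' | φ' ∈ S ∧ φ'.source = φ.source}) ×ˢ {ψ | ψ ∈ S ∧ ψ.source = a.source})
      {ψ | ψ ∈ S ∧ ψ.source = ((φ.trans a).restr (interior K)).source} := by
    intro q hq
    have e : ((q.1.trans q.2).restr (interior K)).source =
        ((φ.trans a).restr (interior K)).source := by
      rw [hsub q.1 hq.1.1 q.2 hq.2.2, hsub φ hφN a rfl]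
    exact ⟨hS.restr_mem _ (hS.trans_mem _ hq.1.2.1 _ hq.2.1) _ isOpen_interior, e⟩
  have := map_mem_closure hc h2 hm
  exact this

end CompactOpen

/-! ### Metric estimates in a quasi-local metric -/

section QuasiLocal

variable {T : Type u} [TopologicalSpace T] (Q : QuasiLocalMetric T)

theorem QuasiLocalMetric.exists_nhds_dist_lt (i : Q.ι) {x : T} (hx : x ∈ Q.dom i) {δ : ℝ}
    (hδ : 0 < δ) : ∃ V : Set T, IsOpen V ∧ x ∈ V ∧ ∃ h : V ⊆ Q.dom i, ∀ y (hy : y ∈ V) z (hz : z ∈ V),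
      (Q.metric i).dist ⟨y, h hy⟩ ⟨z, h hz⟩ < δ := by
  let m : MetricSpace (Q.dom i) := (Q.metric i).replaceTopology (Q.topology_eq i).symm
  have h1 : IsOpen (Metric.ball (⟨x, hx⟩ : Q.dom i) (δ / 2)) := Metric.isOpen_ball
  refine ⟨Subtype.val '' Metric.ball (⟨x, hx⟩ : Q.dom i) (δ / 2),
    (Q.isOpen_dom i).isOpenMap_subtype_val _ h1,
    ⟨⟨x, hx⟩, Metric.mem_ball_self (half_pos hδ), rfl⟩, ?_, ?_⟩
  · rintro _ ⟨y, -, rfl⟩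
    exact y.2
  · rintro _ ⟨y, hy, rfl⟩ _ ⟨z, hz, rfl⟩
    change dist y z < δ
    have := dist_triangle_right y z ⟨x, hx⟩
    rw [Metric.mem_ball] at hy hz
    linarith

/-- A compact subset of an open set has a thickening inside it. The metric on `dom i` is first given
the subspace topology definitionally. -/
theorem QuasiLocalMetric.exists_dist_lt_mem (i : Q.ι) {K W : Set T} (hK : IsCompact K)
    (hW : IsOpen W) (hKi : K ⊆ Q.dom i) (hKW : K ⊆ W) : ∃ ε > 0, ∀ x (hx : x ∈ K) y
      (hy : y ∈ Q.dom i), (Q.metric i).dist ⟨x, hKi hx⟩ ⟨y, hy⟩ < ε → y ∈ W := by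
  let m : MetricSpace (Q.dom i) := (Q.metric i).replaceTopology (Q.topology_eq i).symm
  have h1 : IsCompact ((Subtype.val : Q.dom i → T) ⁻¹' K) :=
    Topology.IsInducing.subtypeVal.isCompact_preimage' hK (by simpa using hKi)
  obtain ⟨ε, hε, h2⟩ := h1.exists_thickening_subset_open (hW.preimage continuous_subtype_val)
    (fun x hx => hKW hx)
  refine ⟨ε, hε, fun x hx y hy hxy => h2 (a := ⟨y, hy⟩) ?_⟩
  refine Metric.mem_thickening_iff.2 ⟨⟨x, hKi hx⟩, hx, ?_⟩
  rw [dist_comm]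
  exact hxy

end QuasiLocal

/-! ### Uniform extension of chains of generators -/

section UniformExtension

variable {T : Type u} [TopologicalSpace T]

/-- Chains of the local transformations `h a b`, composable at the point `s`, where `h b c` may
only be applied at points of `M b c`. -/
inductive HolChain {A : Type*} (h : A → A → OpenPartialHomeomorph T T) (M : A → A → Set T)
    (a : A) (s : T) : A → OpenPartialHomeomorph T T → Prop
  | nil : HolChain h M a s a (OpenPartialHomeomorph.refl T)
  | snoc {b c : A} {φ : OpenPartialHomeomorph T T} (hφ : HolChain h M a s b φ) (hs : φ s ∈ M b c) :
      HolChain h M a s c (φ.trans (h b c))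

namespace HolChain

variable {A : Type*} {h : A → A → OpenPartialHomeomorph T T} {M : A → A → Set T}

theorem mem_source (hM : ∀ a b, M a b ⊆ (h a b).source) {a b : A} {s : T}
    {φ : OpenPartialHomeomorph T T} (hφ : HolChain h M a s b φ) : s ∈ φ.source := by
  induction hφ with
  | nil => exact mem_univ _
  | snoc _ hs ih => exact ⟨ih, hM _ _ hs⟩

theorem append {a b c : A} {s : T} {φ ψ : OpenPartialHomeomorph T T}
    (hφ : HolChain h M a s b φ) (hψ : HolChain h M b (φ s) c ψ) :
    HolChain h M a s c (φ.trans ψ) := by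
  induction hψ with
  | nil => rwa [OpenPartialHomeomorph.trans_refl]
  | snoc _ hs ih =>
    rw [← OpenPartialHomeomorph.trans_assoc]
    exact ih.snoc hs

theorem single {a b : A} {s : T} (hs : s ∈ M a b) : HolChain h M a s b (h a b) := by
  have := (HolChain.nil (h := h) (M := M) (a := a) (s := s)).snoc (c := b) hs
  rwa [OpenPartialHomeomorph.refl_trans] at this

theorem symm (hM : ∀ a b, M a b ⊆ (h a b).source) (hsymm : ∀ a b, (h a b).symm = h b a)
    (hmaps : ∀ a b, MapsTo (h a b) (M a b) (M b a)) {a b : A} {s : T}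
    {φ : OpenPartialHomeomorph T T} (hφ : HolChain h M a s b φ) :
    HolChain h M b (φ s) a φ.symm := by
  induction hφ with
  | nil => exact nil
  | @snoc b c φ hφ hs ih =>
    have h1 : HolChain h M c ((φ.trans (h b c)) s) b (h c b) := single (hmaps _ _ hs)
    have h2 : h c b ((φ.trans (h b c)) s) = φ s := by
      rw [← hsymm]
      exact (h b c).left_inv (hM _ _ hs)
    rw [← h2] at ih
    have h3 := h1.append ih
    rwa [← hsymm b c] at h3

end HolChain

/-- A finitely and compactly generated equicontinuous family has uniform extensions: around every
point there is a neighbourhood `V` such that all chains starting in `V` extend to `V`. -/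
theorem exists_uniform_extension [LocallyCompactSpace T] [T2Space T]
    {S : Set (OpenPartialHomeomorph T T)} {Q : QuasiLocalMetric T} (hQ : Q.IsEquicontinuousFamily S)
    {A : Type*} [Finite A] {h : A → A → OpenPartialHomeomorph T T} {M : A → A → Set T}
    (hMc : ∀ a b, IsCompact (M a b)) (hM : ∀ a b, M a b ⊆ (h a b).source)
    {G : A → A → Set (OpenPartialHomeomorph T T)} (hGS : ∀ a b, G a b ⊆ S)
    (hGtrans : ∀ a b c, ∀ f ∈ G a b, ∀ g ∈ G b c, f.trans g ∈ G a c)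
    (hGrestr : ∀ a b, ∀ f ∈ G a b, ∀ O, IsOpen O → f.restr O ∈ G a b)
    (hloc : ∀ a b, ∀ t ∈ M a b, ∃ O, IsOpen O ∧ t ∈ O ∧ (h a b).restr O ∈ G a b)
    (a : A) {t : T} {O : Set T} (hO : IsOpen O) (htO : t ∈ O)
    (hrefl : (OpenPartialHomeomorph.refl T).restr O ∈ G a a) :
    ∃ V, IsOpen V ∧ t ∈ V ∧ V ⊆ O ∧ ∀ s ∈ V, ∀ b φ, HolChain h M a s b φ →
      ∃ f ∈ G a b, V ⊆ f.source ∧ f =ᶠ[𝓝 s] φ := by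
  -- Each point of `M a b` has a compact neighbourhood `C` in an open set on which the generator
  -- belongs to `G a b` and takes values in a single metric domain. Finitely many of the sets `C`
  -- will cover `M a b`.
  have key : ∀ a b (t : T), t ∈ M a b → ∃ (j : Q.ι) (O C : Set T), IsOpen O ∧ IsCompact C ∧
      C ∈ 𝓝 t ∧ C ⊆ O ∧ O ⊆ (h a b).source ∧ MapsTo (h a b) O (Q.dom j) ∧
      (h a b).restr O ∈ G a b := by
    intro a b t ht
    obtain ⟨O, hO, htO, hOG⟩ := hloc a b t ht
    obtain ⟨j, hj⟩ := Q.cover (h a b t)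
    have hO' : IsOpen (O ∩ ((h a b).source ∩ h a b ⁻¹' Q.dom j)) :=
      hO.inter ((h a b).isOpen_inter_preimage (Q.isOpen_dom j))
    obtain ⟨C, hC, htC, hCO⟩ := exists_compact_subset hO' (x := t) ⟨htO, hM a b ht, hj⟩
    refine ⟨j, _, C, hO', hC, mem_interior_iff_mem_nhds.1 htC, hCO, fun x hx => hx.2.1,
      fun x hx => hx.2.2, ?_⟩
    have h1 := hGrestr _ _ _ hOG _ hO'
    have h2 : ((h a b).restr O).restr (O ∩ ((h a b).source ∩ h a b ⁻¹' Q.dom j)) =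
        (h a b).restr (O ∩ ((h a b).source ∩ h a b ⁻¹' Q.dom j)) := by
      ext x
      · rfl
      · rfl
      · rw [OpenPartialHomeomorph.restr_source' _ _ hO', OpenPartialHomeomorph.restr_source' _ _ hO,
          OpenPartialHomeomorph.restr_source' _ _ hO']
        exact ⟨fun h => ⟨h.1.1, h.2⟩, fun h => ⟨⟨h.1, h.2.1⟩, h.2⟩⟩
    rwa [h2] at h1
  have : Nonempty Q.ι := ⟨(Q.cover t).choose⟩
  choose! j W C hW hC hCt hCW hWs hWj hWG using key
  have hfin : ∀ a b, ∃ τ : Finset T, (∀ x ∈ τ, x ∈ M a b) ∧ M a b ⊆ ⋃ x ∈ τ, C a b x :=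
    fun a b => (hMc a b).elim_nhds_subcover (C a b) (hCt a b)
  choose τ hτM hτ using hfin
  -- A Lebesgue number: the `ε`-thickening of each of the finitely many compact sets `h(C) ∩ C'`
  -- lies in the open set `W'` around `C'`.
  have hε : ∃ ε > (0 : ℝ), ∀ a b c, ∀ x ∈ τ a b, ∀ y ∈ τ b c,
      ∀ u (_ : u ∈ h a b '' C a b x ∩ C b c y) v (hu : u ∈ Q.dom (j a b x))
        (hv : v ∈ Q.dom (j a b x)), (Q.metric (j a b x)).dist ⟨u, hu⟩ ⟨v, hv⟩ < ε → v ∈ W b c y := by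
    have : ∀ᶠ ε in 𝓝[>] (0 : ℝ), ∀ a b c, ∀ x ∈ τ a b, ∀ y ∈ τ b c,
      ∀ u (_ : u ∈ h a b '' C a b x ∩ C b c y) v (hu : u ∈ Q.dom (j a b x))
        (hv : v ∈ Q.dom (j a b x)),
          (Q.metric (j a b x)).dist ⟨u, hu⟩ ⟨v, hv⟩ < ε → v ∈ W b c y := by
      simp only [eventually_all, eventually_all_finset]
      intro a b c x hx y hy
      have hx' := hτM _ _ _ hx
      have hy' := hτM _ _ _ hy
      have hsub : h a b '' C a b x ∩ C b c y ⊆ Q.dom (j a b x) := by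
        rintro _ ⟨⟨z, hz, rfl⟩, -⟩
        exact hWj a b x hx' (hCW a b x hx' hz)
      have hcomp : IsCompact (h a b '' C a b x ∩ C b c y) :=
        ((hC a b x hx').image_of_continuousOn ((h a b).continuousOn.mono
          ((hCW a b x hx').trans (hWs a b x hx')))).inter (hC b c y hy')
      obtain ⟨ε, hε, H⟩ := Q.exists_dist_lt_mem (j a b x) hcomp (hW b c y hy') hsub
        (inter_subset_right.trans (hCW b c y hy'))
      filter_upwards [Ioo_mem_nhdsGT hε] with ε' hε' u hu v hu' hv huv
      exact H u hu v hv (huv.trans hε'.2)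
    obtain ⟨ε, h1, h2⟩ := (this.and self_mem_nhdsWithin).exists
    exact ⟨ε, h2, h1⟩
  obtain ⟨ε, hε0, hε⟩ := hε
  obtain ⟨δ, hδ, hequi⟩ := hQ ε hε0
  obtain ⟨i, hi⟩ := Q.cover t
  obtain ⟨V₀, hV₀, htV₀, hV₀i, hV₀δ⟩ := Q.exists_nhds_dist_lt i hi hδ
  -- This serves the empty chain: a small `V` either lies in `W`, when `t ∈ C`, or misses the closed
  -- set `C`.
  have hV₁ : ∀ᶠ V in (𝓝 t).smallSets, ∀ b, ∀ x ∈ τ a b, (V ∩ C a b x).Nonempty → V ⊆ W a b x := by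
    simp only [eventually_all, eventually_all_finset]
    intro b x hx
    have hx' := hτM _ _ _ hx
    by_cases htC : t ∈ C a b x
    · filter_upwards [eventually_smallSets_subset.2
        ((hW a b x hx').mem_nhds (hCW a b x hx' htC))] with V hV _
      exact hV
    · filter_upwards [eventually_smallSets_subset.2
        ((hC a b x hx').isClosed.isOpen_compl.mem_nhds htC)] with V hV hne
      obtain ⟨y, hy, hy'⟩ := hne
      exact absurd hy' (hV hy)
  obtain ⟨V₁, hV₁t, hV₁⟩ := eventually_smallSets.1 hV₁
  obtain ⟨V₂, hV₂, hV₂o, hV₂t⟩ := mem_nhds_iff.1 hV₁t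
  refine ⟨V₂ ∩ V₀ ∩ O, (hV₂o.inter hV₀).inter hO, ⟨⟨hV₂t, htV₀⟩, htO⟩, inter_subset_right, ?_⟩
  intro s hs b φ hφ
  -- The induction also carries what the next link needs: if `f s` is in one of the compact sets
  -- `C`, the whole image of `V` is in the corresponding `W`.
  suffices hsuff : ∃ f ∈ G a b, V₂ ∩ V₀ ∩ O ⊆ f.source ∧ f =ᶠ[𝓝 s] φ ∧
      ∀ c, ∀ x ∈ τ b c, f s ∈ C b c x → MapsTo f (V₂ ∩ V₀ ∩ O) (W b c x) by
    obtain ⟨f, h1, h2, h3, -⟩ := hsuff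
    exact ⟨f, h1, h2, h3⟩
  induction hφ with
  | nil =>
    refine ⟨_, hrefl, ?_, EventuallyEq.rfl, ?_⟩
    · rw [OpenPartialHomeomorph.restr_source' _ _ hO]
      exact fun x hx => ⟨mem_univ _, hx.2⟩
    · intro c x hx hsx y hy
      exact hV₁ _ ((inter_subset_left.trans inter_subset_left).trans hV₂) c x hx ⟨s, hs, hsx⟩ hy
  | @snoc b c φ hφ hsM ih =>
    obtain ⟨f, hf, hVf, hfφ, hfm⟩ := ih
    have hfs : f s = φ s := hfφ.self_of_nhds
    obtain ⟨x, hx, hsx⟩ := mem_iUnion₂.1 (hτ b c hsM)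
    have hx' := hτM _ _ _ hx
    have hmaps := hfm c x hx (hfs ▸ hsx)
    have hfG := hGtrans _ _ _ f hf _ (hWG b c x hx')
    have hVs : V₂ ∩ V₀ ∩ O ⊆ (f.trans ((h b c).restr (W b c x))).source := by
      intro y hy
      refine ⟨hVf hy, ?_⟩
      change f y ∈ ((h b c).restr (W b c x)).source
      rw [OpenPartialHomeomorph.restr_source' _ _ (hW b c x hx')]
      exact ⟨hWs b c x hx' (hmaps hy), hmaps hy⟩
    refine ⟨_, hfG, hVs, ?_, ?_⟩
    · filter_upwards [hfφ] with y hy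
      change h b c (f y) = h b c (φ y)
      rw [hy]
    · intro d y hy hsy z hz
      have hd : ∀ z ∈ V₂ ∩ V₀ ∩ O, (f.trans ((h b c).restr (W b c x))) z ∈ Q.dom (j b c x) :=
        fun z hz => hWj b c x hx' (hmaps hz)
      -- The composite itself belongs to `S`, so a single `δ` bounds the image of `V` by `ε`,
      -- however long the chain is.
      refine hε b c d x hx y hy _ ⟨⟨f s, hfs ▸ hsx, rfl⟩, hsy⟩ _ (hd s hs) (hd z hz) ?_
      exact hequi _ (hGS _ _ hfG) i (j b c x) s z (hV₀i hs.1.2) (hV₀i hz.1.2) (hd s hs) (hd z hz)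
        (hVs hs) (hVs hz) (hV₀δ s hs.1.2 z hz.1.2)

end UniformExtension

/-! ### Comparing two open maps with the same fibres -/

section LocalQuotient

variable {X T T' : Type*} [TopologicalSpace X] [TopologicalSpace T] [TopologicalSpace T']

/-- Two open continuous maps with the same fibres on an open set `B` differ by a homeomorphism
between their images. -/
theorem exists_openPartialHomeomorph_of_fibers {B : Set X} (hB : IsOpen B) {p : X → T} {q : X → T'}
    (hp : ContinuousOn p B) (hq : ContinuousOn q B)
    (hpo : ∀ O ⊆ B, IsOpen O → IsOpen (p '' O)) (hqo : ∀ O ⊆ B, IsOpen O → IsOpen (q '' O))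
    (hpq : ∀ x ∈ B, ∀ y ∈ B, p x = p y ↔ q x = q y) (hne : B.Nonempty) :
    ∃ c : OpenPartialHomeomorph T T', c.source = p '' B ∧ c.target = q '' B ∧
      ∀ x ∈ B, c (p x) = q x := by
  classical
  have : Nonempty X := ⟨hne.some⟩
  have hsec : ∀ t, ∃ x : X, t ∈ p '' B → x ∈ B ∧ p x = t := fun t => by
    by_cases h : t ∈ p '' B
    · obtain ⟨x, hx, rfl⟩ := h
      exact ⟨x, fun _ => ⟨hx, rfl⟩⟩
    · exact ⟨hne.some, fun h' => absurd h' h⟩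
  have hsec' : ∀ t, ∃ x : X, t ∈ q '' B → x ∈ B ∧ q x = t := fun t => by
    by_cases h : t ∈ q '' B
    · obtain ⟨x, hx, rfl⟩ := h
      exact ⟨x, fun _ => ⟨hx, rfl⟩⟩
    · exact ⟨hne.some, fun h' => absurd h' h⟩
  choose s hs using hsec
  choose s' hs' using hsec'
  have h1 : ∀ x ∈ B, q (s (p x)) = q x := fun x hx =>
    (hpq _ (hs _ ⟨x, hx, rfl⟩).1 _ hx).1 (hs _ ⟨x, hx, rfl⟩).2
  have h2 : ∀ x ∈ B, p (s' (q x)) = p x := fun x hx =>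
    (hpq _ (hs' _ ⟨x, hx, rfl⟩).1 _ hx).2 (hs' _ ⟨x, hx, rfl⟩).2
  refine ⟨{ toFun := fun t => q (s t)
            invFun := fun t => p (s' t)
            source := p '' B
            target := q '' B
            map_source' := ?_
            map_target' := ?_
            left_inv' := ?_
            right_inv' := ?_
            open_source := hpo B Subset.rfl hB
            open_target := hqo B Subset.rfl hB
            continuousOn_toFun := ?_
            continuousOn_invFun := ?_ }, rfl, rfl, h1⟩
  · rintro _ ⟨x, hx, rfl⟩
    exact ⟨x, hx, (h1 x hx).symm⟩
  · rintro _ ⟨x, hx, rfl⟩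
    exact ⟨x, hx, (h2 x hx).symm⟩
  · rintro _ ⟨x, hx, rfl⟩
    rw [h1 x hx, h2 x hx]
  · rintro _ ⟨x, hx, rfl⟩
    rw [h2 x hx, h1 x hx]
  -- The chosen section `s` need not be continuous: the preimage of `O` is `p '' (B ∩ q ⁻¹' O)`,
  -- which is open because `q` is continuous and `p` is open.
  · rw [continuousOn_open_iff (hpo B Subset.rfl hB)]
    intro O hO
    convert hpo (B ∩ q ⁻¹' O) inter_subset_left (hq.isOpen_inter_preimage hB hO) using 1
    ext t
    constructor
    · rintro ⟨⟨x, hx, rfl⟩, ht⟩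
      refine ⟨x, ⟨hx, ?_⟩, rfl⟩
      rw [mem_preimage, ← h1 x hx]
      exact ht
    · rintro ⟨x, ⟨hx, hxO⟩, rfl⟩
      refine ⟨⟨x, hx, rfl⟩, ?_⟩
      rw [mem_preimage, h1 x hx]
      exact hxO
  · rw [continuousOn_open_iff (hqo B Subset.rfl hB)]
    intro O hO
    convert hqo (B ∩ p ⁻¹' O) inter_subset_left (hp.isOpen_inter_preimage hB hO) using 1
    ext t
    constructor
    · rintro ⟨⟨x, hx, rfl⟩, ht⟩
      refine ⟨x, ⟨hx, ?_⟩, rfl⟩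
      rw [mem_preimage, ← h2 x hx]
      exact ht
    · rintro ⟨x, ⟨hx, hxO⟩, rfl⟩
      refine ⟨⟨x, hx, rfl⟩, ?_⟩
      rw [mem_preimage, h2 x hx]
      exact hxO

end LocalQuotient

/-! ### Plaques and transverse coordinates of coherent charts -/

namespace FoliatedChart

variable {n : ℕ} {X : Type u} {Z : Type v} [TopologicalSpace X] [TopologicalSpace Z]

theorem isOpen_source (c : FoliatedChart n X Z) : IsOpen c.source := c.toHomeo.open_source

theorem mem_plaque_iff {c : FoliatedChart n X Z} {y : c.base} {x : X} :
    x ∈ c.plaque y ↔ x ∈ c.source ∧ (c.toHomeo x).2 = y := by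
  constructor
  · rintro ⟨z, hz, rfl⟩
    exact ⟨z.2, congrArg Subtype.val hz⟩
  · rintro ⟨h1, h2⟩
    exact ⟨⟨x, h1⟩, Subtype.ext h2, rfl⟩

/-- A product neighbourhood in a chart, with connected slices. -/
theorem isPreconnected_slice (c : FoliatedChart n X Z) {v : EuclideanSpace ℝ (Fin n)} {r : ℝ}
    (hv : Metric.ball v r ⊆ Metric.ball c.center c.radius) {z : Z} (hz : z ∈ c.base) :
    IsPreconnected (c.toHomeo.symm '' (Metric.ball v r ×ˢ {z})) := by
  refine IsPreconnected.image ?_ _ (c.toHomeo.symm.continuousOn.mono ?_)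
  · exact (convex_ball v r).isPreconnected.prod isPreconnected_singleton
  · change _ ⊆ c.toHomeo.target
    rw [c.target_eq]
    exact prod_mono hv (singleton_subset_iff.2 hz)

theorem isPreconnected_plaque (c : FoliatedChart n X Z) (y : c.base) :
    IsPreconnected (c.plaque y) := by
  convert c.isPreconnected_slice (v := c.center) (r := c.radius) Subset.rfl y.2 using 1
  ext x
  rw [mem_plaque_iff]
  constructor
  · rintro ⟨h1, h2⟩
    have h3 := c.toHomeo.map_source h1
    rw [c.target_eq] at h3
    exact ⟨c.toHomeo x, ⟨h3.1, h2⟩, c.toHomeo.left_inv h1⟩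
  · rintro ⟨w, ⟨hw1, hw2⟩, rfl⟩
    have hw : w ∈ c.toHomeo.target := by
      rw [c.target_eq]
      refine ⟨hw1, ?_⟩
      rw [mem_singleton_iff.1 hw2]
      exact y.2
    refine ⟨c.toHomeo.map_target hw, ?_⟩
    rw [c.toHomeo.right_inv hw]
    exact hw2

/-- Near a point, the transverse coordinate of a coherent chart is a function of the transverse
coordinate of the given chart. -/
theorem Coherent.exists_nhds {c d : FoliatedChart n X Z} (hcd : c.Coherent d) {x : X}
    (hc : x ∈ c.source) {O : Set X} (hO : O ∈ 𝓝 x) (hd : O ⊆ d.source) :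
    ∃ B ⊆ O, IsOpen B ∧ x ∈ B ∧ B ⊆ c.source ∧ ∀ y ∈ B, ∀ z ∈ B,
      (c.toHomeo y).2 = (c.toHomeo z).2 → (d.toHomeo y).2 = (d.toHomeo z).2 := by
  have hct : c.toHomeo x ∈ c.toHomeo.target := c.toHomeo.map_source hc
  have h1 : c.toHomeo.symm ⁻¹' O ∩ c.toHomeo.target ∈ 𝓝 (c.toHomeo x) := by
    refine inter_mem ?_ (c.toHomeo.open_target.mem_nhds hct)
    refine (c.toHomeo.symm.continuousAt hct).preimage_mem_nhds ?_
    rwa [c.toHomeo.left_inv hc]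
  obtain ⟨V, hV, D, hD, hVD⟩ := mem_nhds_prod_iff.1 h1
  obtain ⟨r, hr, hrV⟩ := Metric.mem_nhds_iff.1 hV
  obtain ⟨D', hD'D, hD'o, hxD'⟩ := mem_nhds_iff.1 hD
  have hsub : Metric.ball (c.toHomeo x).1 r ×ˢ D' ⊆ c.toHomeo.symm ⁻¹' O ∩ c.toHomeo.target :=
    (prod_mono hrV hD'D).trans hVD
  refine ⟨c.toHomeo.source ∩ c.toHomeo ⁻¹' (Metric.ball (c.toHomeo x).1 r ×ˢ D'), ?_,
    c.toHomeo.isOpen_inter_preimage (Metric.isOpen_ball.prod hD'o),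
    ⟨hc, Metric.mem_ball_self hr, hxD'⟩, inter_subset_left, ?_⟩
  · rintro y ⟨hy, hy'⟩
    have := (hsub hy').1
    rwa [mem_preimage, c.toHomeo.left_inv hy] at this
  · rintro y ⟨hy, hy'⟩ z ⟨hz, hz'⟩ hyz
    set b := (c.toHomeo y).2 with hb
    have htgt : ∀ w ∈ Metric.ball (c.toHomeo x).1 r, (w, b) ∈ c.toHomeo.target :=
      fun w hw => (hsub (mk_mem_prod hw hy'.2)).2
    have hbb : b ∈ c.base := by
      have := htgt _ hy'.1
      rw [c.target_eq] at this
      exact this.2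
    have hball : Metric.ball (c.toHomeo x).1 r ⊆ Metric.ball c.center c.radius := by
      intro w hw
      have := htgt w hw
      rw [c.target_eq] at this
      exact this.1
    have hconn := c.isPreconnected_slice hball hbb
    have hmem : ∀ w ∈ c.source, (c.toHomeo w).1 ∈ Metric.ball (c.toHomeo x).1 r →
        (c.toHomeo w).2 = b → w ∈ c.toHomeo.symm '' (Metric.ball (c.toHomeo x).1 r ×ˢ {b}) :=
      fun w hw h1 h2 => ⟨c.toHomeo w, ⟨h1, h2⟩, c.toHomeo.left_inv hw⟩
    have hslice : ∀ w ∈ c.toHomeo.symm '' (Metric.ball (c.toHomeo x).1 r ×ˢ {b}),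
        w ∈ O ∧ w ∈ c.plaque ⟨b, hbb⟩ := by
      rintro _ ⟨⟨w, b'⟩, ⟨hw, hb'⟩, rfl⟩
      have hb'' : b' = b := hb'
      subst hb''
      refine ⟨(hsub (mk_mem_prod hw hy'.2)).1, mem_plaque_iff.2
        ⟨c.toHomeo.map_target (htgt w hw), ?_⟩⟩
      rw [c.toHomeo.right_inv (htgt w hw)]
    -- The slice through `y` and `z` is connected and lies in one plaque of `c`. Plaques of `d` meet
    -- that plaque in relatively open sets, so the transverse coordinate of `d` is locally constant
    -- on the slice.
    refine hconn.induction₂ (fun y z => (d.toHomeo y).2 = (d.toHomeo z).2) ?_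
      (fun _ _ _ _ _ _ h h' => h.trans h') (fun _ _ _ _ h => h.symm)
      (hmem y hy hy'.1 rfl) (hmem z hz hz'.1 hyz.symm)
    intro w hw
    obtain ⟨hwO, hwP⟩ := hslice w hw
    have hwd := d.toHomeo.map_source (hd hwO)
    rw [d.target_eq] at hwd
    obtain ⟨W, hW, hWe⟩ := (hcd ⟨b, hbb⟩ ⟨(d.toHomeo w).2, hwd.2⟩).1
    have hwW : w ∈ W := by
      have : w ∈ c.plaque ⟨b, hbb⟩ ∩ d.plaque ⟨(d.toHomeo w).2, hwd.2⟩ :=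
        ⟨hwP, mem_plaque_iff.2 ⟨hd hwO, rfl⟩⟩
      rw [hWe] at this
      exact this.2
    filter_upwards [mem_nhdsWithin_of_mem_nhds (hW.mem_nhds hwW), self_mem_nhdsWithin]
      with w' hw' hw'c
    have : w' ∈ c.plaque ⟨b, hbb⟩ ∩ d.plaque ⟨(d.toHomeo w).2, hwd.2⟩ := by
      rw [hWe]
      exact ⟨(hslice w' hw'c).2, hw'⟩
    exact (mem_plaque_iff.1 this.2).2.symm

end FoliatedChart

/-! ### Distinguished submersions and holonomy between two atlases -/

namespace RegularAtlas

theorem isOpen_U {n : ℕ} {X : Type u} {Z : Type v} [TopologicalSpace X] [TopologicalSpace Z]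
    {ℱ : FoliatedStructure n X Z} {ι : Type w} {𝒰 : RegularAtlas ℱ ι} (i : ι) : IsOpen (𝒰.U i) :=
  (𝒰.chart i).isOpen_source

variable {n : ℕ} {X : Type u} {Z : Type v} [TopologicalSpace X] [TopologicalSpace Z]
  {ℱ : FoliatedStructure n X Z} {ι : Type w} (𝒰 : RegularAtlas ℱ ι) [Nonempty 𝒰.Transversal]

open Classical in
/-- The distinguished submersion `p_i`, extended to `X` by an arbitrary constant. -/
noncomputable def pr (i : ι) (x : X) : 𝒰.Transversal :=
  if h : x ∈ 𝒰.U i then 𝒰.p i ⟨x, h⟩ else Classical.arbitrary _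

variable {𝒰}

theorem pr_of_mem {i : ι} {x : X} (h : x ∈ 𝒰.U i) : 𝒰.pr i x = 𝒰.p i ⟨x, h⟩ := dif_pos h

theorem pr_coe (i : ι) (x : 𝒰.U i) : 𝒰.pr i x = 𝒰.p i x := pr_of_mem x.2

theorem pr_fst {i : ι} {x : X} (h : x ∈ 𝒰.U i) : (𝒰.pr i x).1 = i := by
  rw [pr_of_mem h]
  rfl

theorem pr_eq_iff {i : ι} {x y : X} (hx : x ∈ 𝒰.U i) (hy : y ∈ 𝒰.U i) :
    𝒰.pr i x = 𝒰.pr i y ↔ ((𝒰.chart i).toHomeo x).2 = ((𝒰.chart i).toHomeo y).2 := by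
  rw [pr_of_mem hx, pr_of_mem hy]
  constructor
  · intro h
    exact congrArg Subtype.val (eq_of_heq (Sigma.mk.inj h).2)
  · intro h
    exact congrArg (Sigma.mk i) (Subtype.ext h)

theorem exists_pr_eq (t : 𝒰.Transversal) : ∃ x ∈ 𝒰.U t.1, 𝒰.pr t.1 x = t := by
  obtain ⟨i, b⟩ := t
  have ht : ((𝒰.chart i).center, (b : Z)) ∈ (𝒰.chart i).toHomeo.target := by
    rw [(𝒰.chart i).target_eq]
    exact ⟨Metric.mem_ball_self (𝒰.chart i).radius_pos, b.2⟩
  have hs := (𝒰.chart i).toHomeo.map_target ht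
  refine ⟨_, hs, (pr_of_mem hs).trans (congrArg (Sigma.mk i) (Subtype.ext ?_))⟩
  change ((𝒰.chart i).toHomeo ((𝒰.chart i).toHomeo.symm _)).2 = b
  rw [(𝒰.chart i).toHomeo.right_inv ht]

theorem continuousOn_pr (i : ι) : ContinuousOn (𝒰.pr i) (𝒰.U i) := by
  rw [continuousOn_iff_continuous_domRestrict]
  convert 𝒰.continuous_p i using 1
  funext x
  exact pr_coe i x

/-- A continuous section of `p_i` through `x` shows that `p_i` is open there. -/
theorem pr_mem_nhds {i : ι} {x : X} (hx : x ∈ 𝒰.U i) {O : Set X} (hO : O ∈ 𝓝 x) :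
    𝒰.pr i '' O ∈ 𝓝 (𝒰.pr i x) := by
  obtain ⟨s, hs, hps, hsx⟩ := 𝒰.exists_section i ⟨x, hx⟩
  rw [pr_of_mem hx]
  have h1 : {t | ((s t : 𝒰.U i) : X) ∈ O} ∈ 𝓝 ((𝒰.chart i).proj ⟨x, hx⟩) := by
    refine (continuous_subtype_val.comp hs).continuousAt.preimage_mem_nhds ?_
    rw [Function.comp, hsx]
    exact hO
  refine mem_of_superset ((isOpenMap_sigmaMk (σ := fun k => (𝒰.chart k).base)).image_mem_nhds h1) ?_
  rintro _ ⟨t, ht, rfl⟩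
  exact ⟨s t, ht, (pr_coe i (s t)).trans (hps t)⟩

theorem isOpen_image_pr {i : ι} {O : Set X} (hO : IsOpen O) (hOi : O ⊆ 𝒰.U i) :
    IsOpen (𝒰.pr i '' O) := by
  rw [isOpen_iff_mem_nhds]
  rintro _ ⟨x, hx, rfl⟩
  exact pr_mem_nhds (hOi hx) (hO.mem_nhds hx)

theorem continuousAt_pr {i : ι} {x : X} (hx : x ∈ 𝒰.U i) : ContinuousAt (𝒰.pr i) x :=
  (continuousOn_pr i).continuousAt ((isOpen_U i).mem_nhds hx)

theorem map_nhds_pr {i : ι} {x : X} (hx : x ∈ 𝒰.U i) : map (𝒰.pr i) (𝓝 x) = 𝓝 (𝒰.pr i x) := by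
  refine le_antisymm (continuousAt_pr hx) fun s hs => ?_
  exact mem_of_superset (pr_mem_nhds hx hs) (image_preimage_subset _ _)

/-- This moves identities of germs on the transversal to points of `X`, where the cocycle relation
`h_{ij} p_i = p_j` computes everything. -/
theorem eventually_nhds_pr {i : ι} {x : X} (hx : x ∈ 𝒰.U i) {P : 𝒰.Transversal → Prop} :
    (∀ᶠ t in 𝓝 (𝒰.pr i x), P t) ↔ ∀ᶠ y in 𝓝 x, P (𝒰.pr i y) := by
  rw [← map_nhds_pr hx, eventually_map]

theorem hol_pr {i j : ι} {x : X} (hi : x ∈ 𝒰.U i) (hj : x ∈ 𝒰.U j) :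
    𝒰.hol i j (𝒰.pr i x) = 𝒰.pr j x := by
  rw [pr_of_mem hi, pr_of_mem hj]
  exact 𝒰.holFun_p hi hj

theorem pr_mem_hol_source {i j : ι} {x : X} (hi : x ∈ 𝒰.U i) (hj : x ∈ 𝒰.U j) :
    𝒰.pr i x ∈ (𝒰.hol i j).source := by
  rw [pr_of_mem hi]
  exact ⟨x, hi, hj, rfl⟩

theorem pr_eq_pr {i j : ι} {x y : X} (hxi : x ∈ 𝒰.U i) (hyi : y ∈ 𝒰.U i) (hxj : x ∈ 𝒰.U j)
    (hyj : y ∈ 𝒰.U j) (h : 𝒰.pr i x = 𝒰.pr i y) : 𝒰.pr j x = 𝒰.pr j y := by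
  rw [← hol_pr hxi hxj, h, hol_pr hyi hyj]

theorem hol_comp_hol {i j k : ι} {x : X} (hi : x ∈ 𝒰.U i) (hj : x ∈ 𝒰.U j) (hk : x ∈ 𝒰.U k) :
    ∀ᶠ t in 𝓝 (𝒰.pr i x), 𝒰.hol j k (𝒰.hol i j t) = 𝒰.hol i k t := by
  rw [eventually_nhds_pr hi]
  filter_upwards [(isOpen_U i).mem_nhds hi, (isOpen_U j).mem_nhds hj, (isOpen_U k).mem_nhds hk]
    with y h1 h2 h3
  rw [hol_pr h1 h2, hol_pr h2 h3, hol_pr h1 h3]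

theorem hol_self {i : ι} {x : X} (hi : x ∈ 𝒰.U i) :
    ∀ᶠ t in 𝓝 (𝒰.pr i x), 𝒰.hol i i t = t := by
  rw [eventually_nhds_pr hi]
  filter_upwards [(isOpen_U i).mem_nhds hi] with y h1
  rw [hol_pr h1 h1]

variable {ι' : Type*} {𝒰' : RegularAtlas ℱ ι'} [Nonempty 𝒰'.Transversal]

variable (𝒰 𝒰') in
/-- `c` is the holonomy transformation of the small open set `B` from the chart `U_i` of `𝒰` to the
chart `U'_j` of `𝒰'`. -/
structure IsBox (i : ι) (j : ι') (c : OpenPartialHomeomorph 𝒰.Transversal 𝒰'.Transversal)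
    (B : Set X) : Prop where
  isOpen : IsOpen B
  left : B ⊆ 𝒰.U i
  right : B ⊆ 𝒰'.U j
  source_eq : c.source = 𝒰.pr i '' B
  target_eq : c.target = 𝒰'.pr j '' B
  map_pr : ∀ x ∈ B, c (𝒰.pr i x) = 𝒰'.pr j x

namespace IsBox

variable {i : ι} {j : ι'} {c : OpenPartialHomeomorph 𝒰.Transversal 𝒰'.Transversal} {B : Set X}

theorem pr_mem_source (h : IsBox 𝒰 𝒰' i j c B) {x : X} (hx : x ∈ B) : 𝒰.pr i x ∈ c.source :=
  h.source_eq ▸ ⟨x, hx, rfl⟩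

theorem symm (h : IsBox 𝒰 𝒰' i j c B) : IsBox 𝒰' 𝒰 j i c.symm B where
  isOpen := h.isOpen
  left := h.right
  right := h.left
  source_eq := h.target_eq
  target_eq := h.source_eq
  map_pr x hx := by rw [← h.map_pr x hx, c.left_inv (h.pr_mem_source hx)]

end IsBox

-- Coherence is used twice. On `B₁` points with equal `p_i` have equal `p'_j`; shrinking to `B₂ ⊆
-- B₁` gives the converse. Two open maps with the same fibres then differ by a homeomorphism of
-- their images.
variable (𝒰 𝒰') in
theorem exists_isBox {i : ι} {j : ι'} {x : X} (hi : x ∈ 𝒰.U i) (hj : x ∈ 𝒰'.U j) {O : Set X}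
    (hO : O ∈ 𝓝 x) : ∃ c B, IsBox 𝒰 𝒰' i j c B ∧ x ∈ B ∧ B ⊆ O := by
  obtain ⟨B₁, hB₁O, hB₁, hxB₁, hB₁i, h₁⟩ :=
    (ℱ.coherent _ (𝒰.chart_mem i) _ (𝒰'.chart_mem j)).exists_nhds hi
      (O := O ∩ 𝒰'.U j) (inter_mem hO ((isOpen_U j).mem_nhds hj)) inter_subset_right
  obtain ⟨B₂, hB₂B₁, hB₂, hxB₂, hB₂j, h₂⟩ :=
    (ℱ.coherent _ (𝒰'.chart_mem j) _ (𝒰.chart_mem i)).exists_nhds hj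
      (hB₁.mem_nhds hxB₁) hB₁i
  have hBi : B₂ ⊆ 𝒰.U i := hB₂B₁.trans hB₁i
  obtain ⟨c, hc1, hc2, hc3⟩ := exists_openPartialHomeomorph_of_fibers hB₂
    ((continuousOn_pr i).mono hBi) ((continuousOn_pr j).mono hB₂j)
    (fun O hO hO' => isOpen_image_pr hO' (hO.trans hBi))
    (fun O hO hO' => isOpen_image_pr hO' (hO.trans hB₂j)) (fun y hy z hz => by
      rw [pr_eq_iff (hBi hy) (hBi hz), pr_eq_iff (hB₂j hy) (hB₂j hz)]
      exact ⟨h₁ y (hB₂B₁ hy) z (hB₂B₁ hz), h₂ y hy z hz⟩) ⟨x, hxB₂⟩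
  exact ⟨c, B₂, ⟨hB₂, hBi, hB₂j, hc1, hc2, hc3⟩, hxB₂, fun y hy => (hB₁O (hB₂B₁ hy)).1⟩

end RegularAtlas

/-! ### Holonomy germs as chains through cores -/

namespace RegularAtlas

variable {n : ℕ} {X : Type u} {Z : Type v} [TopologicalSpace X] [TopologicalSpace Z]
  {ℱ : FoliatedStructure n X Z} {ι : Type w} (𝒰 : RegularAtlas ℱ ι) [Nonempty 𝒰.Transversal]

section Chains

variable {A : Type*} (idx : A → ι) (K : A → Set X)

/-- Chains of holonomy transformations that only use the points of the sets `K a ∩ K b`. -/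
abbrev CoreChain (a : A) (s : 𝒰.Transversal) (b : A)
    (φ : OpenPartialHomeomorph 𝒰.Transversal 𝒰.Transversal) : Prop :=
  HolChain (fun a b => 𝒰.hol (idx a) (idx b)) (fun a b => 𝒰.pr (idx a) '' (K a ∩ K b)) a s b φ

/-- The germ of `f` at `s`, read in the charts with indices `idx a`, is a chain. -/
def IsChainGerm (f : 𝒰.Transversal → 𝒰.Transversal) (s : 𝒰.Transversal) : Prop :=
  ∀ i x, x ∈ 𝒰.U i → 𝒰.pr i x = s → ∀ j y, y ∈ 𝒰.U j → 𝒰.pr j y = f s →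
    ∀ a, x ∈ K a → ∀ b, y ∈ K b → ∃ φ, 𝒰.CoreChain idx K a (𝒰.pr (idx a) x) b φ ∧
      ∀ᶠ t in 𝓝 (𝒰.pr (idx a) x), φ t = 𝒰.hol j (idx b) (f (𝒰.hol (idx a) i t))

variable {𝒰 idx K}

theorem core_subset_source (hK : ∀ a, K a ⊆ 𝒰.U (idx a)) (a b : A) :
    𝒰.pr (idx a) '' (K a ∩ K b) ⊆ (𝒰.hol (idx a) (idx b)).source := by
  rintro _ ⟨x, ⟨hx, hx'⟩, rfl⟩
  exact pr_mem_hol_source (hK a hx) (hK b hx')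

theorem mapsTo_core (hK : ∀ a, K a ⊆ 𝒰.U (idx a)) (a b : A) :
    MapsTo (𝒰.hol (idx a) (idx b)) (𝒰.pr (idx a) '' (K a ∩ K b))
      (𝒰.pr (idx b) '' (K b ∩ K a)) := by
  rintro _ ⟨x, ⟨hx, hx'⟩, rfl⟩
  exact ⟨x, ⟨hx', hx⟩, (hol_pr (hK a hx) (hK b hx')).symm⟩

theorem CoreChain.mem_source (hK : ∀ a, K a ⊆ 𝒰.U (idx a)) {a b : A} {s : 𝒰.Transversal}
    {φ : OpenPartialHomeomorph 𝒰.Transversal 𝒰.Transversal} (h : 𝒰.CoreChain idx K a s b φ) :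
    s ∈ φ.source :=
  HolChain.mem_source (core_subset_source hK) h

theorem tendsto_hol {i j : ι} {x : X} (hi : x ∈ 𝒰.U i) (hj : x ∈ 𝒰.U j) :
    Tendsto (𝒰.hol i j) (𝓝 (𝒰.pr i x)) (𝓝 (𝒰.pr j x)) := by
  have := (𝒰.hol i j).continuousAt (pr_mem_hol_source hi hj)
  rwa [ContinuousAt, hol_pr hi hj] at this

theorem IsChainGerm.congr {f g : 𝒰.Transversal → 𝒰.Transversal} {s : 𝒰.Transversal}
    (hK : ∀ a, K a ⊆ 𝒰.U (idx a)) (h : 𝒰.IsChainGerm idx K f s) (hfg : f =ᶠ[𝓝 s] g) :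
    𝒰.IsChainGerm idx K g s := by
  intro i x hx hxs j y hy hys a ha b hb
  obtain ⟨φ, h1, h2⟩ := h i x hx hxs j y hy (hys.trans hfg.self_of_nhds.symm) a ha b hb
  refine ⟨φ, h1, ?_⟩
  have h3 := tendsto_hol (hK a ha) hx
  rw [hxs] at h3
  filter_upwards [h2, h3.eventually hfg] with t ht ht'
  rw [ht, ht']

/-- Even the identity needs an argument, since `x` and `y` may be distant points of one plaque, in
different cores. The plaque is connected and covered by the interiors of the cores, so it suffices
to join nearby points and to concatenate. -/
theorem isChainGerm_id (hK : ∀ a, K a ⊆ 𝒰.U (idx a)) (hcov : ∀ x, ∃ a, x ∈ interior (K a))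
    (s : 𝒰.Transversal) : 𝒰.IsChainGerm idx K id s := by
  intro i x hx hxs j y hy hys
  have hij : i = j := by
    rw [← pr_fst hx, ← pr_fst hy, hxs, hys]
    rfl
  subst hij
  have hconn := (𝒰.chart i).isPreconnected_plaque ((𝒰.chart i).proj ⟨x, hx⟩)
  have hpl : ∀ z ∈ (𝒰.chart i).plaque ((𝒰.chart i).proj ⟨x, hx⟩),
      z ∈ 𝒰.U i ∧ 𝒰.pr i z = 𝒰.pr i x := by
    intro z hz
    rw [FoliatedChart.mem_plaque_iff] at hz
    exact ⟨hz.1, (pr_eq_iff hz.1 hx).2 hz.2⟩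
  refine hconn.induction₂' (fun x y => ∀ a, x ∈ K a → ∀ b, y ∈ K b →
    ∃ φ, 𝒰.CoreChain idx K a (𝒰.pr (idx a) x) b φ ∧ ∀ᶠ t in 𝓝 (𝒰.pr (idx a) x),
      φ t = 𝒰.hol i (idx b) (𝒰.hol (idx a) i t)) ?_ ?_ (x := x) (y := y) ?_ ?_
  -- Two points of the plaque in one core `K c` are joined by `a → c → b`. The first link is applied
  -- at the image of `z` and the second at that of `w`; these images coincide in the chart of `c`.
  · have step : ∀ (c : A) (z w : X), z ∈ K c → w ∈ K c → z ∈ 𝒰.U i → w ∈ 𝒰.U i →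
        𝒰.pr i z = 𝒰.pr i w → ∀ a, z ∈ K a → ∀ b, w ∈ K b →
        ∃ φ, 𝒰.CoreChain idx K a (𝒰.pr (idx a) z) b φ ∧ ∀ᶠ t in 𝓝 (𝒰.pr (idx a) z),
          φ t = 𝒰.hol i (idx b) (𝒰.hol (idx a) i t) := by
      intro c z w hzc hwc hz hw hzw a ha b hb
      have h1 : 𝒰.CoreChain idx K a (𝒰.pr (idx a) z) c (𝒰.hol (idx a) (idx c)) :=
        HolChain.single ⟨z, ⟨ha, hzc⟩, rfl⟩
      have h2 := HolChain.snoc (c := b) h1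
        ⟨w, ⟨hwc, hb⟩, by
          rw [hol_pr (hK a ha) (hK c hzc)]
          exact pr_eq_pr hw hz (hK c hwc) (hK c hzc) hzw.symm⟩
      refine ⟨_, h2, ?_⟩
      have e1 := hol_comp_hol (hK a ha) hz (hK c hzc)
      have e2 := hol_comp_hol hw (hK c hwc) (hK b hb)
      rw [← hzw] at e2
      filter_upwards [e1, (tendsto_hol (hK a ha) hz).eventually e2] with t ht1 ht2
      change 𝒰.hol (idx c) (idx b) (𝒰.hol (idx a) (idx c) t) = _
      rw [← ht1, ht2]
    intro z hz
    obtain ⟨c, hc⟩ := hcov z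
    obtain ⟨hz1, hz2⟩ := hpl z hz
    filter_upwards [mem_nhdsWithin_of_mem_nhds (isOpen_interior.mem_nhds hc),
      self_mem_nhdsWithin] with w hw hwP
    obtain ⟨hw1, hw2⟩ := hpl w hwP
    exact ⟨step c z w (interior_subset hc) (interior_subset hw) hz1 hw1 (hz2.trans hw2.symm),
      step c w z (interior_subset hw) (interior_subset hc) hw1 hz1 (hw2.trans hz2.symm)⟩
  · intro z w v hz hw hv hzw hwv a ha b hb
    obtain ⟨c, hc⟩ := hcov w
    have hc' := interior_subset hc
    obtain ⟨φ, h1, h2⟩ := hzw a ha c hc'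
    obtain ⟨ψ, h3, h4⟩ := hwv c hc' b hb
    obtain ⟨hz1, hz2⟩ := hpl z hz
    obtain ⟨hw1, hw2⟩ := hpl w hw
    have hφ : φ (𝒰.pr (idx a) z) = 𝒰.pr (idx c) w := by
      rw [h2.self_of_nhds, hol_pr (hK a ha) hz1, hz2, ← hw2, hol_pr hw1 (hK c hc')]
    have hφt := φ.continuousAt (h1.mem_source hK)
    rw [ContinuousAt, hφ] at hφt
    rw [← hφ] at h3
    refine ⟨_, h1.append h3, ?_⟩
    have e1 := tendsto_hol (hK a ha) hz1
    rw [hz2, ← hw2] at e1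
    have e2 := hol_comp_hol hw1 (hK c hc') hw1
    have e3 := hol_self hw1
    filter_upwards [h2, hφt.eventually h4, e1.eventually e2, e1.eventually e3] with t t1 t2 t3 t4
    change ψ (φ t) = _
    rw [t2, t1, t3, t4]
  · exact FoliatedChart.mem_plaque_iff.2 ⟨hx, rfl⟩
  · exact FoliatedChart.mem_plaque_iff.2 ⟨hy, (pr_eq_iff hy hx).1 (hys.trans hxs.symm)⟩

/-- `IsChainGerm` quantifies over all points above the ends of the germ and all cores containing
them, so the chains can be made to meet at any point `z` above `f s`. -/
theorem IsChainGerm.trans (hK : ∀ a, K a ⊆ 𝒰.U (idx a)) (hcov : ∀ x, ∃ a, x ∈ interior (K a))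
    {f g : 𝒰.Transversal → 𝒰.Transversal} {s : 𝒰.Transversal} (hfc : ContinuousAt f s)
    (hf : 𝒰.IsChainGerm idx K f s) (hg : 𝒰.IsChainGerm idx K g (f s)) :
    𝒰.IsChainGerm idx K (g ∘ f) s := by
  intro i x hx hxs j y hy hys a ha b hb
  obtain ⟨z, hz, hzs⟩ := exists_pr_eq (f s)
  obtain ⟨c, hc⟩ := hcov z
  have hc' := interior_subset hc
  obtain ⟨φ, h1, h2⟩ := hf i x hx hxs _ z hz hzs a ha c hc'
  obtain ⟨ψ, h3, h4⟩ := hg _ z hz hzs j y hy hys c hc' b hb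
  have hφ : φ (𝒰.pr (idx a) x) = 𝒰.pr (idx c) z := by
    rw [h2.self_of_nhds, hol_pr (hK a ha) hx, hxs, ← hzs, pr_fst hz, hol_pr hz (hK c hc')]
  have hφt := φ.continuousAt (h1.mem_source hK)
  rw [ContinuousAt, hφ] at hφt
  rw [← hφ] at h3
  refine ⟨_, h1.append h3, ?_⟩
  have e1 := tendsto_hol (hK a ha) hx
  rw [hxs] at e1
  have e4 := hfc.tendsto.comp e1
  have e2 := hol_comp_hol hz (hK c hc') hz
  have e3 := hol_self hz
  rw [hzs] at e2 e3
  filter_upwards [h2, hφt.eventually h4, e4.eventually e2, e4.eventually e3] with t t1 t2 t3 t4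
  simp only [Function.comp] at t3 t4
  change ψ (φ t) = _
  rw [t2, t1, t3, t4]
  rfl

theorem IsChainGerm.symm (hK : ∀ a, K a ⊆ 𝒰.U (idx a))
    {f : OpenPartialHomeomorph 𝒰.Transversal 𝒰.Transversal} {s : 𝒰.Transversal} (hs : s ∈ f.source)
    (hf : 𝒰.IsChainGerm idx K f s) : 𝒰.IsChainGerm idx K f.symm (f s) := by
  intro i x hx hxs j y hy hys a ha b hb
  rw [f.left_inv hs] at hys
  obtain ⟨φ, h1, h2⟩ := hf j y hy hys i x hx hxs b hb a ha
  have hφ : φ (𝒰.pr (idx b) y) = 𝒰.pr (idx a) x := by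
    rw [h2.self_of_nhds, hol_pr (hK b hb) hy, hys, ← hxs, hol_pr hx (hK a ha)]
  have h3 := HolChain.symm (core_subset_source hK) (fun _ _ => rfl) (mapsTo_core hK) h1
  rw [hφ] at h3
  refine ⟨_, h3, ?_⟩
  have hsrc := h1.mem_source hK
  have e1 := tendsto_hol (hK b hb) hy
  rw [hys] at e1
  have e2 := (f.continuousAt hs).tendsto.comp e1
  have e3 := hol_comp_hol hx (hK a ha) hx
  have e4 := hol_self hx
  rw [hxs] at e3 e4
  have e5 := hol_comp_hol (hK b hb) hy (hK b hb)
  have e6 := hol_self (hK b hb)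
  -- The required formula for `φ.symm` is proved first after substituting `φ r`, then pulled back
  -- along `φ.symm`.
  have key : ∀ᶠ r in 𝓝 (𝒰.pr (idx b) y),
      r = 𝒰.hol j (idx b) (f.symm (𝒰.hol (idx a) i (φ r))) := by
    filter_upwards [h2, e2.eventually e3, e2.eventually e4, e5, e6,
      e1.eventually (f.open_source.mem_nhds hs)] with r r1 r2 r3 r4 r5 r6
    simp only [Function.comp] at r2 r3
    rw [r1, r2, r3, f.left_inv r6, r4, r5]
  have e7 := φ.symm.continuousAt (φ.map_source hsrc)
  rw [ContinuousAt, φ.left_inv hsrc] at e7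
  rw [hφ] at e7
  filter_upwards [e7.eventually key, φ.open_target.mem_nhds (hφ ▸ φ.map_source hsrc)] with t t1 t2
  rw [φ.right_inv t2] at t1
  exact t1

/-- With `z ∈ U_i ∩ U_j` above `s`, join `x` to `z` along a plaque of `U_i`, then `z` to `y` along a
plaque of `U_j`. -/
theorem isChainGerm_hol (hK : ∀ a, K a ⊆ 𝒰.U (idx a)) (hcov : ∀ x, ∃ a, x ∈ interior (K a))
    (i j : ι) {s : 𝒰.Transversal} (hs : s ∈ (𝒰.hol i j).source) :
    𝒰.IsChainGerm idx K (𝒰.hol i j) s := by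
  intro i' x hx hxs j' y hy hys a ha b hb
  obtain ⟨z, hzi, hzj, rfl⟩ := hs
  rw [← pr_of_mem hzi] at hxs hys
  rw [hol_pr hzi hzj] at hys
  obtain rfl : i' = i := by rw [← pr_fst hx, hxs, pr_fst hzi]
  obtain rfl : j' = j := by rw [← pr_fst hy, hys, pr_fst hzj]
  obtain ⟨c, hc⟩ := hcov z
  have hc' := interior_subset hc
  obtain ⟨φ, h1, h2⟩ := isChainGerm_id hK hcov _ i' x hx rfl i' z hzi hxs.symm a ha c hc'
  obtain ⟨ψ, h3, h4⟩ := isChainGerm_id hK hcov _ j' z hzj rfl j' y hy hys c hc' b hb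
  have hφ : φ (𝒰.pr (idx a) x) = 𝒰.pr (idx c) z := by
    rw [h2.self_of_nhds, hol_pr (hK a ha) hx, hxs, id, hol_pr hzi (hK c hc')]
  have hφt := φ.continuousAt (h1.mem_source hK)
  rw [ContinuousAt, hφ] at hφt
  rw [← hφ] at h3
  refine ⟨_, h1.append h3, ?_⟩
  have e1 := tendsto_hol (hK a ha) hx
  rw [hxs] at e1
  have e2 := hol_comp_hol hzi (hK c hc') hzj
  filter_upwards [h2, hφt.eventually h4, e1.eventually e2] with t t1 t2 t3
  change ψ (φ t) = _
  rw [t2, t1, id, id, t3]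

/-- The germs of the holonomy pseudogroup are chains. -/
theorem isChainGerm_of_mem (hK : ∀ a, K a ⊆ 𝒰.U (idx a)) (hcov : ∀ x, ∃ a, x ∈ interior (K a))
    {f : OpenPartialHomeomorph 𝒰.Transversal 𝒰.Transversal} (hf : f ∈ 𝒰.holonomyPseudogroup)
    {s : 𝒰.Transversal} (hs : s ∈ f.source) : 𝒰.IsChainGerm idx K f s := by
  -- The generated pseudogroup is the smallest one containing the maps `h_{ij}`, so it is enough
  -- that this set be a pseudogroup containing them.
  refine hf {f | ∀ s ∈ f.source, 𝒰.IsChainGerm idx K f s} ⟨?_, ?_⟩ s hs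
  · refine ⟨?_, ?_, ?_, ?_, ?_, ?_⟩
    · exact fun s _ => isChainGerm_id hK hcov s
    · intro e he f hf s hs
      exact IsChainGerm.trans (f := e) (g := f) hK hcov (e.continuousAt hs.1) (he s hs.1) (hf _ hs.2)
    · intro e he s hs
      have := (he _ (e.map_target hs)).symm hK (e.map_target hs)
      rwa [e.right_inv hs] at this
    · intro e he O _ s hs
      exact he s hs.1
    · intro e he s hs
      obtain ⟨O, hO, hsO, h⟩ := he s hs
      refine h s ?_
      rw [e.restr_source' _ hO]
      exact ⟨hs, hsO⟩
    · intro e he f hfe s hs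
      have hs' : s ∈ e.source := hfe.source_eq ▸ hs
      exact (he s hs').congr hK
        (eventually_of_mem (f.open_source.mem_nhds hs) fun t ht => (hfe.eqOn ht).symm)
  · rintro _ ⟨i, j, rfl⟩ s hs
    exact isChainGerm_hol hK hcov i j hs

end Chains

end RegularAtlas

/-- Quasi-analyticity is applied in this germ form, with no connectedness of the domain. -/
theorem IsQuasiAnalyticFamily.eq_of_eventually {T : Type*} [TopologicalSpace T]
    {S : Set (OpenPartialHomeomorph T T)} (hS : IsQuasiAnalyticFamily S)
    {h : OpenPartialHomeomorph T T} (hh : h ∈ S) {t : T} (ht : t ∈ h.source)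
    (hid : ∀ᶠ r in 𝓝 t, h r = r) {x : T} (hx : x ∈ h.source) : h x = x := by
  obtain ⟨O, hO, hOo, htO⟩ := mem_nhds_iff.1 (hid.and (h.open_source.mem_nhds ht))
  exact hS h hh ⟨O, hOo, ⟨t, htO⟩, fun y hy => (hO hy).2, fun y hy => (hO hy).1⟩ x hx

/-! ### Conjugation between closures, with locally uniform domains -/

section Transports

variable {T T' : Type*} [TopologicalSpace T] [TopologicalSpace T']

/-- The maps `f ↦ l f k`, suitably restricted, locally map `S̄` to `S̄'`. -/
def Transports (S : Set (OpenPartialHomeomorph T T)) (S' : Set (OpenPartialHomeomorph T' T'))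
    (k : OpenPartialHomeomorph T' T) (l : OpenPartialHomeomorph T T') : Prop :=
  ∀ g ∈ starClosure S, ∀ s ∈ k.source, k s ∈ g.source → g (k s) ∈ l.source →
    ∃ V, IsOpen V ∧ s ∈ V ∧ ∃ N ∈ 𝓝 g, ∀ f ∈ starClosure S, f ∈ N →
      V ⊆ ((k.trans f).trans l).source ∧ ((k.trans f).trans l).restr V ∈ starClosure S'

variable {S : Set (OpenPartialHomeomorph T T)} {S' : Set (OpenPartialHomeomorph T' T')}
  {k : OpenPartialHomeomorph T' T} {l : OpenPartialHomeomorph T T'}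

theorem restr_restr_of_subset {e : OpenPartialHomeomorph T T'} {V W : Set T} (hV : IsOpen V)
    (hW : IsOpen W) (hWV : W ⊆ V) : (e.restr V).restr W = e.restr W := by
  ext x
  · rfl
  · rfl
  · rw [OpenPartialHomeomorph.restr_source' _ _ hW, OpenPartialHomeomorph.restr_source' _ _ hV,
      OpenPartialHomeomorph.restr_source' _ _ hW]
    exact ⟨fun h => ⟨h.1.1, h.2⟩, fun h => ⟨⟨h.1, hWV h.2⟩, h.2⟩⟩

/-- Local composition with `a` takes place in `S̄'`, after the transport. Its neighbourhood of maps
is pulled back along the continuous map `f ↦ l f k`. This lets `l` be corrected so as to hit the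
prescribed base point. -/
theorem Transports.trans_right [LocallyCompactSpace T'] (hS' : IsLocalPseudoStarGroup S')
    (h : Transports S S' k l) {a : OpenPartialHomeomorph T' T'} (ha : a ∈ starClosure S') :
    Transports S S' k (l.trans a) := by
  intro g hg s hs hks hgs
  obtain ⟨V, hV, hsV, N, hN, H⟩ := h g hg s hs hks hgs.1
  obtain ⟨h1, h2⟩ := H g hg (mem_of_mem_nhds hN)
  obtain ⟨V', hV', hsV', N', hN', H'⟩ := exists_trans_restr_mem_starClosure hS'
    (f := ((k.trans g).trans l).restr V) ha (x := s)
    (by rw [OpenPartialHomeomorph.restr_source' _ _ hV]; exact ⟨h1 hsV, hsV⟩) hgs.2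
  have hc : Continuous fun f => ((k.trans f).trans l).restr V :=
    (continuous_restr V).comp (continuous_trans_trans k l)
  refine ⟨V ∩ V', hV.inter hV', ⟨hsV, hsV'⟩, _, inter_mem hN (hc.continuousAt.preimage_mem_nhds hN'),
    ?_⟩
  rintro f hf ⟨hfN, hfN'⟩
  obtain ⟨h3, h4⟩ := H f hf hfN
  obtain ⟨h5, h6⟩ := H' _ h4 hfN'
  refine ⟨fun x hx => ⟨(h3 hx.1).1, (h3 hx.1).2, (h5 hx.2).2⟩, ?_⟩
  have h7 := restr_mem_starClosure hS' h6 (hV.inter hV')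
  rw [restr_restr_of_subset hV' (hV.inter hV') inter_subset_right,
    OpenPartialHomeomorph.restr_trans,
    restr_restr_of_subset hV (hV.inter hV') inter_subset_left,
    OpenPartialHomeomorph.trans_assoc] at h7
  exact h7

/-- The counterpart of `Transports.trans_right` for the inverse direction: the composition with `a`
takes place in `S̄`, before the transport. -/
theorem Transports.trans_left [LocallyCompactSpace T] (hS : IsLocalPseudoStarGroup S)
    (h : Transports S S' k l) {a : OpenPartialHomeomorph T T} (ha : a ∈ starClosure S) :
    Transports S S' k (a.trans l) := by
  intro g hg s hs hks hgs
  obtain ⟨V, hV, hsV, N, hN, H⟩ := exists_trans_restr_mem_starClosure hS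
    (f := g) ha (x := k s) hks hgs.1
  obtain ⟨h1, h2⟩ := H g hg (mem_of_mem_nhds hN)
  obtain ⟨V', hV', hsV', N', hN', H'⟩ := h _ h2 s hs
    (by rw [OpenPartialHomeomorph.restr_source' _ _ hV]; exact ⟨h1 hsV, hsV⟩) hgs.2
  have hc : Continuous fun f : OpenPartialHomeomorph T T => (f.trans a).restr V :=
    (continuous_restr V).comp (continuous_trans_pair.comp (continuous_id.prodMk continuous_const))
  refine ⟨V', hV', hsV', _, inter_mem hN (hc.continuousAt.preimage_mem_nhds hN'), ?_⟩
  rintro f hf ⟨hfN, hfN'⟩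
  obtain ⟨h3, h4⟩ := H f hf hfN
  obtain ⟨h5, h6⟩ := H' _ h4 hfN'
  have hVs : ∀ x ∈ V', k x ∈ V := fun x hx => by
    have := (h5 hx).1.2
    change k x ∈ ((f.trans a).restr V).source at this
    rw [OpenPartialHomeomorph.restr_source' _ _ hV] at this
    exact this.2
  refine ⟨fun x hx => ⟨⟨(h5 hx).1.1, (h3 (hVs x hx)).1⟩, (h3 (hVs x hx)).2, (h5 hx).2⟩, ?_⟩
  convert h6 using 1
  ext x
  · rfl
  · rfl
  · rw [OpenPartialHomeomorph.restr_source' _ _ hV', OpenPartialHomeomorph.restr_source' _ _ hV']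
    constructor
    · rintro ⟨-, hx⟩
      exact ⟨h5 hx, hx⟩
    · rintro ⟨-, hx⟩
      exact ⟨⟨⟨(h5 hx).1.1, (h3 (hVs x hx)).1⟩, (h3 (hVs x hx)).2, (h5 hx).2⟩, hx⟩

end Transports

/-! ### Core boxes and the comparison of `S` with `S'` -/

namespace RegularAtlas

variable {n : ℕ} {X : Type u} {Z : Type v} [TopologicalSpace X] [TopologicalSpace Z]
  {ℱ : FoliatedStructure n X Z} {ι : Type w}

instance (𝒰 : RegularAtlas ℱ ι) [LocallyCompactSpace Z] : LocallyCompactSpace 𝒰.Transversal := by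
  have : ∀ i, LocallyCompactSpace (𝒰.chart i).base :=
    fun i => (𝒰.chart i).isOpen_base.locallyCompactSpace
  refine ⟨?_⟩
  rintro ⟨i, b⟩ O hO
  have h1 : (Sigma.mk i) ⁻¹' O ∈ 𝓝 b := continuous_sigmaMk.continuousAt.preimage_mem_nhds hO
  obtain ⟨C, hC, hCO, hCc⟩ := local_compact_nhds h1
  exact ⟨Sigma.mk i '' C, isOpenMap_sigmaMk.image_mem_nhds hC, image_subset_iff.2 hCO,
    hCc.image continuous_sigmaMk⟩

theorem hol_mem (𝒰 : RegularAtlas ℱ ι) (i j : ι) : 𝒰.hol i j ∈ 𝒰.holonomyPseudogroup :=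
  fun _ hH => hH.2 ⟨i, j, rfl⟩

theorem trans_mem_holonomyPseudogroup {𝒰 : RegularAtlas ℱ ι}
    {f g : OpenPartialHomeomorph 𝒰.Transversal 𝒰.Transversal}
    (hf : f ∈ 𝒰.holonomyPseudogroup) (hg : g ∈ 𝒰.holonomyPseudogroup) :
    f.trans g ∈ 𝒰.holonomyPseudogroup :=
  fun H hH => hH.1.trans_mem f (hf H hH) g (hg H hH)

theorem symm_mem_holonomyPseudogroup {𝒰 : RegularAtlas ℱ ι}
    {f : OpenPartialHomeomorph 𝒰.Transversal 𝒰.Transversal} (hf : f ∈ 𝒰.holonomyPseudogroup) :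
    f.symm ∈ 𝒰.holonomyPseudogroup :=
  fun H hH => hH.1.symm_mem f (hf H hH)

variable {𝒰 : RegularAtlas ℱ ι} [Nonempty 𝒰.Transversal]
  {ι' : Type*} {𝒰' : RegularAtlas ℱ ι'} [Nonempty 𝒰'.Transversal]

variable (𝒰 𝒰') in
/-- A small open set with its holonomy transformation, and a compact subset. -/
structure CoreBox where
  left : ι
  right : ι'
  map : OpenPartialHomeomorph 𝒰.Transversal 𝒰'.Transversal
  carrier : Set X
  core : Set X
  isBox : IsBox 𝒰 𝒰' left right map carrier
  isCompact_core : IsCompact core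
  core_subset : core ⊆ carrier

/-- The local transformations in `S`, from the domain of a box to the domain of another one, which
correspond to elements of `S'`. -/
def boxMaps (S : Set (OpenPartialHomeomorph 𝒰.Transversal 𝒰.Transversal))
    (S' : Set (OpenPartialHomeomorph 𝒰'.Transversal 𝒰'.Transversal)) (a b : CoreBox 𝒰 𝒰') :
    Set (OpenPartialHomeomorph 𝒰.Transversal 𝒰.Transversal) :=
  {f | f ∈ S ∧ f.source ⊆ a.map.source ∧ f.target ⊆ b.map.source ∧
    (a.map.symm.trans f).trans b.map ∈ S'}

section

variable {S : Set (OpenPartialHomeomorph 𝒰.Transversal 𝒰.Transversal)}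
  {S' : Set (OpenPartialHomeomorph 𝒰'.Transversal 𝒰'.Transversal)} {a b c : CoreBox 𝒰 𝒰'}
  {f g : OpenPartialHomeomorph 𝒰.Transversal 𝒰.Transversal}

/-- As the target of `f` lies in the domain of `b.map`, the middle factor `b.map⁻¹ b.map` cancels
without shrinking domains, and conjugation respects composition. -/
theorem trans_mem_boxMaps (hS : IsLocalPseudoStarGroup S) (hS' : IsLocalPseudoStarGroup S')
    (hf : f ∈ boxMaps S S' a b) (hg : g ∈ boxMaps S S' b c) : f.trans g ∈ boxMaps S S' a c := by
  obtain ⟨f1, f2, f3, f4⟩ := hf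
  obtain ⟨g1, g2, g3, g4⟩ := hg
  refine ⟨hS.trans_mem _ f1 _ g1, fun x hx => f2 hx.1, fun x hx => g3 hx.1, ?_⟩
  refine hS'.mem_of_eqOnSource _ (hS'.trans_mem _ f4 _ g4) _ ⟨?_, ?_⟩
  · ext x
    constructor
    · rintro ⟨⟨h1, h2, h3⟩, h4⟩
      have h5 : f (a.map.symm x) ∈ b.map.source := f3 (f.map_source h2)
      have h6 : b.map.symm (b.map (f (a.map.symm x))) = f (a.map.symm x) := b.map.left_inv h5
      refine ⟨⟨⟨h1, h2⟩, h5⟩, ⟨b.map.map_source h5, ?_⟩, ?_⟩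
      · change b.map.symm (b.map (f (a.map.symm x))) ∈ g.source
        rw [h6]
        exact h3
      · change g (b.map.symm (b.map (f (a.map.symm x)))) ∈ c.map.source
        rw [h6]
        exact h4
    · rintro ⟨⟨⟨h1, h2⟩, h5⟩, ⟨-, h3⟩, h4⟩
      have h6 : b.map.symm (b.map (f (a.map.symm x))) = f (a.map.symm x) := b.map.left_inv h5
      change b.map.symm (b.map (f (a.map.symm x))) ∈ g.source at h3
      change g (b.map.symm (b.map (f (a.map.symm x)))) ∈ c.map.source at h4
      rw [h6] at h3 h4
      exact ⟨⟨h1, h2, h3⟩, h4⟩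
  · rintro x ⟨⟨h1, h2, h3⟩, h4⟩
    have h5 : f (a.map.symm x) ∈ b.map.source := f3 (f.map_source h2)
    change c.map (g (f (a.map.symm x))) = c.map (g (b.map.symm (b.map (f (a.map.symm x)))))
    rw [b.map.left_inv h5]

theorem mem_boxMaps_of_eqOnSource (hS : IsLocalPseudoStarGroup S)
    (hS' : IsLocalPseudoStarGroup S') (hf : f ∈ boxMaps S S' a b) (hgf : g ≈ f) :
    g ∈ boxMaps S S' a b := by
  obtain ⟨f1, f2, f3, f4⟩ := hf
  refine ⟨hS.mem_of_eqOnSource _ f1 _ hgf, hgf.source_eq ▸ f2, hgf.target_eq ▸ f3,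
    hS'.mem_of_eqOnSource _ f4 _ ?_⟩
  exact OpenPartialHomeomorph.EqOnSource.trans'
    (OpenPartialHomeomorph.EqOnSource.trans' (Setoid.refl _) hgf) (Setoid.refl _)

theorem restr_mem_boxMaps (hS : IsLocalPseudoStarGroup S) (hS' : IsLocalPseudoStarGroup S')
    (hf : f ∈ boxMaps S S' a b) {O : Set 𝒰.Transversal} (hO : IsOpen O) :
    f.restr O ∈ boxMaps S S' a b := by
  obtain ⟨f1, f2, f3, f4⟩ := hf
  refine ⟨hS.restr_mem _ f1 _ hO, fun x hx => f2 hx.1, fun x hx => f3 hx.1, ?_⟩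
  have hO' := a.map.symm.isOpen_inter_preimage hO
  refine hS'.mem_of_eqOnSource _ (hS'.restr_mem _ f4 _ hO') _ ⟨?_, fun x hx => rfl⟩
  rw [OpenPartialHomeomorph.restr_source' _ _ hO']
  ext x
  constructor
  · rintro ⟨⟨h1, h2⟩, h4⟩
    change a.map.symm x ∈ (f.restr O).source at h2
    rw [OpenPartialHomeomorph.restr_source' _ _ hO] at h2
    exact ⟨⟨⟨h1, h2.1⟩, h4⟩, h1, h2.2⟩
  · rintro ⟨⟨⟨h1, h2⟩, h4⟩, -, h3⟩
    refine ⟨⟨h1, ?_⟩, h4⟩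
    change a.map.symm x ∈ (f.restr O).source
    rw [OpenPartialHomeomorph.restr_source' _ _ hO]
    exact ⟨h2, h3⟩

/-- Box maps conjugate an elementary holonomy map of `𝒰` to the one of `𝒰'`, because both are read
off from the same points of `X`. It remains to shrink until the first is in `S` and the second in
`S'`. -/
theorem exists_hol_restr_mem_boxMaps (hS : IsAdmissible 𝒰.holonomyPseudogroup S)
    (hS' : IsAdmissible 𝒰'.holonomyPseudogroup S') (a b : CoreBox 𝒰 𝒰') {y : X}
    (ha : y ∈ a.carrier) (hb : y ∈ b.carrier) :
    ∃ O, IsOpen O ∧ 𝒰.pr a.left y ∈ O ∧ O ⊆ (𝒰.hol a.left b.left).source ∧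
      (𝒰.hol a.left b.left).restr O ∈ boxMaps S S' a b := by
  obtain ⟨O₁, hO₁, hy₁, h₁⟩ := hS.generates _ (𝒰.hol_mem a.left b.left) (𝒰.pr a.left y)
    (pr_mem_hol_source (a.isBox.left ha) (b.isBox.left hb))
  obtain ⟨O₂, hO₂, hy₂, h₂⟩ := hS'.generates _ (𝒰'.hol_mem a.right b.right) (𝒰'.pr a.right y)
    (pr_mem_hol_source (a.isBox.right ha) (b.isBox.right hb))
  have hB : IsOpen (a.carrier ∩ b.carrier ∩ (𝒰'.U a.right ∩ 𝒰'.pr a.right ⁻¹' O₂)) :=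
    (a.isBox.isOpen.inter b.isBox.isOpen).inter
      ((continuousOn_pr a.right).isOpen_inter_preimage (isOpen_U a.right) hO₂)
  have hO : IsOpen (O₁ ∩ 𝒰.pr a.left ''
      (a.carrier ∩ b.carrier ∩ (𝒰'.U a.right ∩ 𝒰'.pr a.right ⁻¹' O₂))) :=
    hO₁.inter (isOpen_image_pr hB fun x hx => a.isBox.left hx.1.1)
  set O := O₁ ∩ 𝒰.pr a.left ''
      (a.carrier ∩ b.carrier ∩ (𝒰'.U a.right ∩ 𝒰'.pr a.right ⁻¹' O₂)) with hOdef
  have hOs : O ⊆ (𝒰.hol a.left b.left).source := by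
    rintro _ ⟨-, x, ⟨⟨hxa, hxb⟩, -⟩, rfl⟩
    exact pr_mem_hol_source (a.isBox.left hxa) (b.isBox.left hxb)
  refine ⟨O, hO, ⟨hy₁, y, ⟨⟨ha, hb⟩, a.isBox.right ha, hy₂⟩, rfl⟩, hOs, ?_, ?_, ?_, ?_⟩
  · have := hS.isLocal.restr_mem _ h₁ _ hO
    rwa [restr_restr_of_subset hO₁ hO inter_subset_left] at this
  · rw [OpenPartialHomeomorph.restr_source' _ _ hO]
    rintro _ ⟨-, -, x, ⟨⟨hxa, hxb⟩, -⟩, rfl⟩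
    exact a.isBox.pr_mem_source hxa
  · intro t ht
    have h3 := ((𝒰.hol a.left b.left).restr O).map_target ht
    have h4 := ((𝒰.hol a.left b.left).restr O).right_inv ht
    rw [OpenPartialHomeomorph.restr_source' _ _ hO] at h3
    obtain ⟨-, -, x, ⟨⟨hxa, hxb⟩, -⟩, hx⟩ := h3
    rw [← hx] at h4
    change 𝒰.hol a.left b.left (𝒰.pr a.left x) = t at h4
    rw [hol_pr (a.isBox.left hxa) (b.isBox.left hxb)] at h4
    rw [← h4]
    exact b.isBox.pr_mem_source hxb
  · have hO' := a.map.symm.isOpen_inter_preimage hO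
    have key : ∀ x' ∈ a.map.target, a.map.symm x' ∈ O → ∃ x, x ∈ a.carrier ∧ x ∈ b.carrier ∧
        𝒰'.pr a.right x ∈ O₂ ∧ a.map.symm x' = 𝒰.pr a.left x ∧ x' = 𝒰'.pr a.right x := by
      rintro x' hx' ⟨-, x, ⟨⟨hxa, hxb⟩, -, hx2⟩, hx⟩
      refine ⟨x, hxa, hxb, hx2, hx.symm, ?_⟩
      rw [← a.isBox.map_pr x hxa, hx, a.map.right_inv hx']
    refine hS'.isLocal.mem_of_eqOnSource _ (hS'.isLocal.restr_mem _ h₂ _ hO') _ ⟨?_, ?_⟩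
    · rw [OpenPartialHomeomorph.restr_source' _ _ hO', OpenPartialHomeomorph.restr_source' _ _ hO₂]
      ext x'
      constructor
      · rintro ⟨⟨h1, h2⟩, h4⟩
        change a.map.symm x' ∈ ((𝒰.hol a.left b.left).restr O).source at h2
        rw [OpenPartialHomeomorph.restr_source' _ _ hO] at h2
        obtain ⟨x, hxa, hxb, hx2, -, hx'⟩ := key x' h1 h2.2
        refine ⟨⟨?_, hx' ▸ hx2⟩, h1, h2.2⟩
        rw [hx']
        exact pr_mem_hol_source (a.isBox.right hxa) (b.isBox.right hxb)
      · rintro ⟨-, h1, h2⟩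
        obtain ⟨x, hxa, hxb, hx2, hx, hx'⟩ := key x' h1 h2
        refine ⟨⟨h1, ?_⟩, ?_⟩
        · change a.map.symm x' ∈ ((𝒰.hol a.left b.left).restr O).source
          rw [OpenPartialHomeomorph.restr_source' _ _ hO]
          exact ⟨hOs h2, h2⟩
        · change 𝒰.hol a.left b.left (a.map.symm x') ∈ b.map.source
          rw [hx, hol_pr (a.isBox.left hxa) (b.isBox.left hxb)]
          exact b.isBox.pr_mem_source hxb
    · rintro x' ⟨⟨h1, h2⟩, h4⟩
      change a.map.symm x' ∈ ((𝒰.hol a.left b.left).restr O).source at h2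
      rw [OpenPartialHomeomorph.restr_source' _ _ hO] at h2
      obtain ⟨x, hxa, hxb, hx2, hx, hx'⟩ := key x' h1 h2.2
      change b.map (𝒰.hol a.left b.left (a.map.symm x')) = 𝒰'.hol a.right b.right x'
      rw [hx, hol_pr (a.isBox.left hxa) (b.isBox.left hxb), b.isBox.map_pr x hxb, hx',
        hol_pr (a.isBox.right hxa) (b.isBox.right hxb)]

theorem exists_coreBox [CompactSpace X] [T2Space X] {i : ι} {j : ι'}
    {c : OpenPartialHomeomorph 𝒰.Transversal 𝒰'.Transversal}
    {B : Set X} (h : IsBox 𝒰 𝒰' i j c B) {x : X} (hx : x ∈ B) :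
    ∃ a : CoreBox 𝒰 𝒰', a.left = i ∧ a.right = j ∧ a.map = c ∧ a.carrier = B ∧
      x ∈ interior a.core := by
  obtain ⟨K, hK, hxK, hKB⟩ := exists_compact_subset h.isOpen hx
  exact ⟨⟨i, j, c, B, K, h, hK, hKB⟩, rfl, rfl, rfl, rfl, hxK⟩

variable (𝒰 𝒰') in
theorem exists_finite_coreBox_cover [CompactSpace X] [T2Space X] :
    ∃ A : Set (CoreBox 𝒰 𝒰'), A.Finite ∧ ∀ x, ∃ a ∈ A, x ∈ interior a.core := by
  have h : ∀ x : X, ∃ a : CoreBox 𝒰 𝒰', x ∈ interior a.core := by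
    intro x
    obtain ⟨i, hi⟩ := 𝒰.cover x
    obtain ⟨j, hj⟩ := 𝒰'.cover x
    obtain ⟨c, B, hB, hxB, -⟩ := exists_isBox 𝒰 𝒰' hi hj univ_mem
    obtain ⟨a, -, -, -, -, ha⟩ := exists_coreBox hB hxB
    exact ⟨a, ha⟩
  choose a ha using h
  obtain ⟨τ, hτ⟩ := CompactSpace.elim_nhds_subcover (fun x => interior (a x).core)
    fun x => isOpen_interior.mem_nhds (ha x)
  refine ⟨a '' τ, τ.finite_toSet.image a, fun x => ?_⟩
  have hx : x ∈ ⋃ y ∈ τ, interior (a y).core := hτ ▸ mem_univ x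
  obtain ⟨y, hy, hxy⟩ := mem_iUnion₂.1 hx
  exact ⟨a y, ⟨y, hy, rfl⟩, hxy⟩

/-- Uniform extension of holonomy germs between two boxes. -/
theorem exists_holonomy_extension [CompactSpace X] [T2Space X] [T2Space Z] [LocallyCompactSpace Z]
    (hS : IsAdmissible 𝒰.holonomyPseudogroup S) (hS' : IsAdmissible 𝒰'.holonomyPseudogroup S')
    (a b : CoreBox 𝒰 𝒰') {y : X} (hy : y ∈ a.core) :
    ∃ V, IsOpen V ∧ 𝒰.pr a.left y ∈ V ∧ V ⊆ a.map.source ∧ ∀ f ∈ 𝒰.holonomyPseudogroup,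
      ∀ s ∈ V, s ∈ f.source → s ∈ 𝒰.pr a.left '' a.core → f s ∈ 𝒰.pr b.left '' b.core →
        ∃ g ∈ boxMaps S S' a b, V ⊆ g.source ∧ g =ᶠ[𝓝 s] f := by
  obtain ⟨A₀, hA₀, hcov₀⟩ := exists_finite_coreBox_cover 𝒰 𝒰'
  -- The two given boxes join a finite cover by cores, so that chains may start at `a` and end at
  -- `b`.
  set A := insert a (insert b A₀) with hA
  have hfin : A.Finite := (hA₀.insert b).insert a
  have : Finite A := hfin
  have hcov : ∀ x, ∃ c : A, x ∈ interior c.1.core := fun x => by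
    obtain ⟨c, hc, hxc⟩ := hcov₀ x
    exact ⟨⟨c, mem_insert_of_mem _ (mem_insert_of_mem _ hc)⟩, hxc⟩
  have hK : ∀ c : A, c.1.core ⊆ 𝒰.U c.1.left := fun c => c.1.core_subset.trans c.1.isBox.left
  obtain ⟨Q, hQ⟩ := hS.equicontinuous
  let a' : A := ⟨a, mem_insert _ _⟩
  let b' : A := ⟨b, mem_insert_of_mem _ (mem_insert _ _)⟩
  obtain ⟨O, hO, hyO, hOs, hOG⟩ := exists_hol_restr_mem_boxMaps hS hS' a a
    (a.core_subset hy) (a.core_subset hy)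
  have hhol : ∀ x ∈ (𝒰.hol a.left a.left).source, 𝒰.hol a.left a.left x = x := by
    rintro _ ⟨z, hz, -, rfl⟩
    rw [← pr_of_mem hz, hol_pr hz hz]
  -- The family `S` is not assumed to contain identities; they come from restrictions of `h_{ii}`.
  have hrefl : (OpenPartialHomeomorph.refl _).restr O ∈ boxMaps S S' a a := by
    refine mem_boxMaps_of_eqOnSource hS.isLocal hS'.isLocal hOG ⟨?_, ?_⟩
    · rw [OpenPartialHomeomorph.restr_source' _ _ hO, OpenPartialHomeomorph.restr_source' _ _ hO]
      ext x
      exact ⟨fun h => ⟨hOs h.2, h.2⟩, fun h => ⟨mem_univ _, h.2⟩⟩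
    · intro x hx
      rw [OpenPartialHomeomorph.restr_source' _ _ hO] at hx
      exact (hhol x (hOs hx.2)).symm
  obtain ⟨V, hV, hyV, hVO, H⟩ := exists_uniform_extension hQ (A := A)
    (h := fun a b => 𝒰.hol a.1.left b.1.left)
    (M := fun a b => 𝒰.pr a.1.left '' (a.1.core ∩ b.1.core))
    (fun c d => (c.1.isCompact_core.inter d.1.isCompact_core).image_of_continuousOn
      ((continuousOn_pr _).mono (inter_subset_left.trans (hK c))))
    (core_subset_source hK) (G := fun a b => boxMaps S S' a.1 b.1) (fun c d f hf => hf.1)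
    (fun c d e f hf g hg => trans_mem_boxMaps hS.isLocal hS'.isLocal hf hg)
    (fun c d f hf O hO => restr_mem_boxMaps hS.isLocal hS'.isLocal hf hO)
    (by
      rintro c d _ ⟨x, ⟨hxc, hxd⟩, rfl⟩
      obtain ⟨O, h1, h2, -, h3⟩ := exists_hol_restr_mem_boxMaps hS hS' c.1 d.1
        (c.1.core_subset hxc) (d.1.core_subset hxd)
      exact ⟨O, h1, h2, h3⟩) a' hO hyO hrefl
  have hVa : V ⊆ a.map.source := by
    intro x hx
    refine hrefl.2.1 ?_
    rw [OpenPartialHomeomorph.restr_source' _ _ hO]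
    exact ⟨mem_univ _, hVO hx⟩
  refine ⟨V, hV, hyV, hVa, ?_⟩
  rintro f hf _ hsV hsf ⟨x, hx, rfl⟩ ⟨z, hz, hzf⟩
  obtain ⟨φ, h1, h2⟩ := isChainGerm_of_mem (idx := fun c : A => c.1.left)
    (K := fun c : A => c.1.core) hK hcov hf hsf a.left x (hK a' hx) rfl b.left z (hK b' hz) hzf
    a' hx b' hz
  obtain ⟨g, hg, hVg, hgφ⟩ := H _ hsV b' φ h1
  refine ⟨g, hg, hVg, ?_⟩
  have e1 := hol_self (hK a' hx)
  have e2 := hol_self (hK b' hz)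
  rw [hzf] at e2
  filter_upwards [hgφ, h2, e1, (f.continuousAt hsf).eventually e2] with t t1 t2 t3 t4
  rw [t1, t2, t3, t4]

/-- The holonomy transformations between the transversals of two atlases transport `S̄` to `S̄'`. -/
theorem transports_of_isBox [CompactSpace X] [T2Space X] [T2Space Z] [LocallyCompactSpace Z]
    (hS : IsAdmissible 𝒰.holonomyPseudogroup S) (hS' : IsAdmissible 𝒰'.holonomyPseudogroup S')
    {i₁ i₂ : ι} {j₁ j₂ : ι'} {c d : OpenPartialHomeomorph 𝒰.Transversal 𝒰'.Transversal}
    {B C : Set X} (hc : IsBox 𝒰 𝒰' i₁ j₁ c B) (hd : IsBox 𝒰 𝒰' i₂ j₂ d C) :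
    Transports S S' c.symm d := by
  intro g hg s hs hks hgs
  have hs' : s ∈ 𝒰'.pr j₁ '' B := hc.target_eq ▸ hs
  obtain ⟨y, hy, rfl⟩ := hs'
  have hcy := hc.symm.map_pr y hy
  rw [hcy] at hks hgs
  have hgs' := hgs
  rw [hd.source_eq] at hgs'
  obtain ⟨z, hz, hzg⟩ := hgs'
  obtain ⟨a, rfl, rfl, rfl, rfl, hya⟩ := exists_coreBox hc hy
  obtain ⟨b, rfl, rfl, rfl, rfl, hzb⟩ := exists_coreBox hd hz
  -- The uniform neighbourhood is taken on the target side, around `g(p(y)) = p(z)`, in order to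
  -- extend inverses of maps close to `g`. Maps in `N` send `K` into `W`.
  obtain ⟨W, hW, hzW, hWs, H⟩ := exists_holonomy_extension hS hS' b a (interior_subset hzb)
  have hW' : IsOpen (W ∩ 𝒰.pr b.left '' interior b.core) :=
    hW.inter (isOpen_image_pr isOpen_interior
      (interior_subset.trans (b.core_subset.trans b.isBox.left)))
  set W' := W ∩ 𝒰.pr b.left '' interior b.core
  obtain ⟨K, hK, hyK, hKg⟩ := exists_compact_subset (g.isOpen_inter_preimage hW')
    (x := 𝒰.pr a.left y) ⟨hks, by
      rw [mem_preimage, ← hzg]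
      exact ⟨hzW, z, hzb, rfl⟩⟩
  have hN := isOpen_setOf_mapsTo hK hW'
  set N := {h : OpenPartialHomeomorph 𝒰.Transversal 𝒰.Transversal | K ⊆ h.source ∧ MapsTo h K W'}
  have hV : IsOpen (a.map.target ∩ a.map.symm ⁻¹' interior K) :=
    a.map.symm.isOpen_inter_preimage isOpen_interior
  set V := a.map.target ∩ a.map.symm ⁻¹' interior K
  have hVN : ∀ f ∈ N, V ⊆ ((a.map.symm.trans f).trans b.map).source := by
    rintro f ⟨h1, h2⟩ x ⟨hx, hxK⟩
    exact ⟨⟨hx, h1 (interior_subset hxK)⟩, hWs (h2 (interior_subset hxK)).1⟩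
  have hVsrc : ∀ f ∈ N, (((a.map.symm.trans f).trans b.map).restr V).source = V := by
    intro f hf
    rw [OpenPartialHomeomorph.restr_source' _ _ hV]
    exact inter_eq_right.2 (hVN f hf)
  refine ⟨V, hV, ⟨hs, by rw [mem_preimage, hcy]; exact hyK⟩, N,
    hN.mem_nhds ⟨fun x hx => (hKg hx).1, fun x hx => (hKg hx).2⟩, ?_⟩
  intro f hf hfN
  refine ⟨hVN f hfN, map_mem_starClosure (Φ := fun f => ((a.map.symm.trans f).trans b.map).restr V)
    ((continuous_restr V).comp (continuous_trans_trans _ _)) hN hf hfN ?_⟩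
  intro φ hφ _ hφN
  refine ⟨?_, (hVsrc φ hφN).trans (hVsrc f hfN).symm⟩
  have hyφ : 𝒰.pr a.left y ∈ φ.source := hφN.1 (interior_subset hyK)
  obtain ⟨hφW, z', hz', hz'φ⟩ := hφN.2 (interior_subset hyK)
  -- `F` extends the germ of `φ⁻¹` to all of `W`, and its conjugate is in `S'`.
  obtain ⟨F, ⟨F1, F2, F3, F4⟩, hWF, hFφ⟩ := H φ.symm
    (symm_mem_holonomyPseudogroup (hS.subset hφ)) _ hφW (φ.map_source hyφ)
    ⟨z', interior_subset hz', hz'φ⟩ ⟨y, interior_subset hya, (φ.left_inv hyφ).symm⟩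
  -- `F φ` is in `S` and is the identity near one point, hence on its whole domain, which contains
  -- `K`. So `φ = F⁻¹` on the interior of `K`, and the conjugate of `φ` is in `S'`.
  have hid : ∀ x ∈ (φ.trans F).source, (φ.trans F) x = x := by
    intro x hx
    refine hS.quasiAnalytic.eq_of_eventually (hS.isLocal.trans_mem _ hφ _ F1)
      (t := 𝒰.pr a.left y) ⟨hyφ, hWF hφW⟩ ?_ hx
    filter_upwards [(φ.continuousAt hyφ).eventually hFφ, φ.open_source.mem_nhds hyφ] with r r1 r2
    change F (φ r) = r
    rw [r1, φ.left_inv r2]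
  have hinv : ∀ x ∈ interior K, x ∈ F.target ∧ F.symm x = φ x := by
    intro x hx
    have h1 := hφN.1 (interior_subset hx)
    have h2 := hWF (hφN.2 (interior_subset hx)).1
    have h3 : F (φ x) = x := hid x ⟨h1, h2⟩
    refine ⟨h3 ▸ F.map_source h2, ?_⟩
    rw [← F.left_inv h2, h3]
  have hmem := hS'.isLocal.restr_mem _ (hS'.isLocal.symm_mem _ F4) V hV
  refine hS'.isLocal.mem_of_eqOnSource _ hmem _ ⟨?_, ?_⟩
  · rw [hVsrc φ hφN, OpenPartialHomeomorph.restr_source' _ _ hV]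
    refine (inter_eq_right.2 ?_).symm
    intro x hx
    refine ⟨hx.1, (hinv _ hx.2).1, ?_⟩
    change F.symm (a.map.symm x) ∈ b.map.source
    rw [(hinv _ hx.2).2]
    exact hWs (hφN.2 (interior_subset hx.2)).1
  · intro x hx
    rw [hVsrc φ hφN] at hx
    change b.map (φ (a.map.symm x)) = b.map (F.symm (a.map.symm x))
    rw [(hinv _ hx.2).2]

end

end RegularAtlas

/-! ### Ultrafilter limits of equicontinuous families -/

section Limits

variable {T : Type u} [TopologicalSpace T] {Ω : Type*}

/-- `f ω` converges to `ℓ` locally uniformly on `V`. -/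
def LocallyTendsto (𝒱 : Filter Ω) (f : Ω → OpenPartialHomeomorph T T) (V : Set T) (ℓ : T → T) :
    Prop :=
  ∀ y ∈ V, ∀ O ∈ 𝓝 (ℓ y), ∃ N ∈ 𝓝 y, ∀ᶠ ω in 𝒱, ∀ z ∈ N ∩ V, f ω z ∈ O

/-- Arzelà–Ascoli along an ultrafilter: compactness of `C` gives the pointwise limits, and
equicontinuity makes the convergence locally uniform. -/
theorem exists_locallyTendsto {S : Set (OpenPartialHomeomorph T T)} {Q : QuasiLocalMetric T}
    (hQ : Q.IsEquicontinuousFamily S) (𝒱 : Ultrafilter Ω) {f : Ω → OpenPartialHomeomorph T T}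
    (hf : ∀ ω, f ω ∈ S) {V C : Set T} (hV : ∀ ω, V ⊆ (f ω).source) (hC : IsCompact C)
    (hVC : ∀ ω, MapsTo (f ω) V C) {i j : Q.ι} (hVi : V ⊆ Q.dom i) (hCj : C ⊆ Q.dom j) :
    ∃ ℓ : T → T, LocallyTendsto 𝒱 f V ℓ := by
  have hlim : ∀ y : T, ∃ z, y ∈ V → z ∈ C ∧ Tendsto (fun ω => f ω y) 𝒱 (𝓝 z) := by
    intro y
    by_cases hy : y ∈ V
    · obtain ⟨z, hz, h⟩ := hC.ultrafilter_le_nhds (𝒱.map fun ω => f ω y)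
        (by
          rw [le_principal_iff]
          exact mem_map.2 (univ_mem' fun ω => hVC ω hy))
      exact ⟨z, fun _ => ⟨hz, h⟩⟩
    · exact ⟨y, fun h => absurd h hy⟩
  choose ℓ hℓ using hlim
  refine ⟨ℓ, fun y hy O hO => ?_⟩
  obtain ⟨hyC, hyt⟩ := hℓ y hy
  obtain ⟨ε, hε, h1⟩ := Q.exists_dist_lt_mem j (K := {ℓ y}) isCompact_singleton
    (isOpen_interior (s := O)) (singleton_subset_iff.2 (hCj hyC))
    (singleton_subset_iff.2 (mem_interior_iff_mem_nhds.2 hO))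
  obtain ⟨δ, hδ, h2⟩ := hQ (ε / 2) (half_pos hε)
  obtain ⟨N, hN, hyN, hNi, hNδ⟩ := Q.exists_nhds_dist_lt i (hVi hy) hδ
  obtain ⟨M, hM, hyM, hMj, hMε⟩ := Q.exists_nhds_dist_lt j (hCj hyC) (half_pos hε)
  refine ⟨N, hN.mem_nhds hyN, ?_⟩
  filter_upwards [hyt.eventually (hM.mem_nhds hyM)] with ω hω z hz
  have hzj := hCj (hVC ω hz.2)
  refine interior_subset (h1 (ℓ y) rfl (f ω z) hzj ?_)
  have h3 := h2 (f ω) (hf ω) i j y z (hVi hy) (hVi hz.2) (hCj (hVC ω hy)) hzj (hV ω hy) (hV ω hz.2)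
    (hNδ y hyN z hz.1)
  have h4 := hMε (ℓ y) hyM (f ω y) hω
  have h5 := (Q.metric j).dist_triangle ⟨ℓ y, hCj hyC⟩ ⟨f ω y, hCj (hVC ω hy)⟩ ⟨f ω z, hzj⟩
  linarith

variable {𝒱 : Filter Ω} {f : Ω → OpenPartialHomeomorph T T} {V : Set T} {ℓ : T → T}

theorem LocallyTendsto.tendsto (h : LocallyTendsto 𝒱 f V ℓ) {y : T} (hy : y ∈ V) :
    Tendsto (fun ω => f ω y) 𝒱 (𝓝 (ℓ y)) := by
  intro O hO
  obtain ⟨N, hN, hω⟩ := h y hy O hO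
  rw [mem_map]
  filter_upwards [hω] with ω hω
  exact hω y ⟨mem_of_mem_nhds hN, hy⟩

theorem LocallyTendsto.continuousOn [RegularSpace T] [𝒱.NeBot] (h : LocallyTendsto 𝒱 f V ℓ) :
    ContinuousOn ℓ V := by
  intro y hy O hO
  obtain ⟨C, hC, hCc, hCO⟩ := exists_mem_nhds_isClosed_subset hO
  obtain ⟨N, hN, hω⟩ := h y hy C hC
  rw [mem_map]
  filter_upwards [mem_nhdsWithin_of_mem_nhds hN, self_mem_nhdsWithin] with z hzN hzV
  exact hCO (hCc.mem_of_tendsto (h.tendsto hzV) (hω.mono fun ω hω => hω z ⟨hzN, hzV⟩))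

/-- Restricting every `f ω` to the domain of `a` gives the common domain that `starClosure` demands.
Finite covers of compact sets turn locally uniform convergence into compact-open convergence. -/
theorem LocallyTendsto.mem_starClosure [𝒱.NeBot] {S : Set (OpenPartialHomeomorph T T)}
    (hS : IsLocalPseudoStarGroup S) (h : LocallyTendsto 𝒱 f V ℓ) (hf : ∀ ω, f ω ∈ S)
    (hV : ∀ ω, V ⊆ (f ω).source) {a : OpenPartialHomeomorph T T} (haV : a.source ⊆ V)
    (ha : ∀ y ∈ a.source, a y = ℓ y) : a ∈ starClosure S := by
  have hsrc : ∀ ω, ((f ω).restr a.source).source = a.source := fun ω => by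
    rw [OpenPartialHomeomorph.restr_source' _ _ a.open_source]
    exact inter_eq_right.2 (haV.trans (hV ω))
  refine mem_closure_of_tendsto (f := fun ω => (f ω).restr a.source) (b := 𝒱) ?_
    (Eventually.of_forall fun ω => ⟨hS.restr_mem _ (hf ω) _ a.open_source, hsrc ω⟩)
  refine TopologicalSpace.tendsto_nhds_generateFrom_iff.2 ?_
  rintro _ ⟨K, O, hK, hO, rfl⟩ ⟨hKa, hKO⟩
  have h1 : ∀ᶠ ω in 𝒱, ∀ y ∈ K, f ω y ∈ O := by
    refine hK.induction_on (p := fun K => ∀ᶠ ω in 𝒱, ∀ y ∈ K, f ω y ∈ O) (by simp)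
      (fun s t hst ht => ht.mono fun ω hω y hy => hω y (hst hy)) (fun s t hs ht => ?_) ?_
    · filter_upwards [hs, ht] with ω h1 h2 y hy
      exact hy.elim (h1 y) (h2 y)
    · intro y hy
      obtain ⟨N, hN, hω⟩ := h y (haV (hKa hy)) O (hO.mem_nhds (ha y (hKa hy) ▸ hKO hy))
      exact ⟨N ∩ K, inter_mem (mem_nhdsWithin_of_mem_nhds hN) self_mem_nhdsWithin,
        hω.mono fun ω hω z hz => hω z ⟨hz.1, haV (hKa hz.2)⟩⟩
  filter_upwards [h1] with ω hω
  exact ⟨hKa.trans (hsrc ω).symm.subset, hω⟩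

/-- Local uniformity allows `g ω` to be evaluated at the moving point `f ω y`, which tends to `ℓ y`.
-/
theorem LocallyTendsto.leftInverse [T2Space T] [𝒱.NeBot] {g : Ω → OpenPartialHomeomorph T T}
    {W : Set T} {m : T → T} (hW : IsOpen W) (h : LocallyTendsto 𝒱 f V ℓ)
    (h' : LocallyTendsto 𝒱 g W m) (hfg : ∀ ω, ∀ y ∈ V, f ω y ∈ W → g ω (f ω y) = y) {y : T}
    (hy : y ∈ V) (hyW : ℓ y ∈ W) : m (ℓ y) = y := by
  have h1 : Tendsto (fun _ : Ω => y) 𝒱 (𝓝 (m (ℓ y))) := by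
    intro O hO
    obtain ⟨N, hN, hω⟩ := h' (ℓ y) hyW O hO
    rw [mem_map]
    filter_upwards [hω, (h.tendsto hy).eventually (inter_mem hN (hW.mem_nhds hyW))] with ω h1 h2
    have := h1 _ h2
    rwa [hfg ω y hy h2.2] at this
  exact tendsto_nhds_unique h1 tendsto_const_nhds

/-- Locally uniform limits of local transformations and of their inverses. -/
theorem exists_limit_mem_starClosure [T2Space T] [RegularSpace T] [𝒱.NeBot]
    {S : Set (OpenPartialHomeomorph T T)} (hS : IsLocalPseudoStarGroup S)
    {g : Ω → OpenPartialHomeomorph T T} {W : Set T} {m : T → T}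
    (hf : ∀ ω, f ω ∈ S) (hg : ∀ ω, g ω ∈ S) (hV : IsOpen V) (hW : IsOpen W)
    (hfV : ∀ ω, V ⊆ (f ω).source) (hgW : ∀ ω, W ⊆ (g ω).source)
    (h : LocallyTendsto 𝒱 f V ℓ) (h' : LocallyTendsto 𝒱 g W m)
    (hfg : ∀ ω, ∀ y ∈ V, f ω y ∈ W → g ω (f ω y) = y)
    (hgf : ∀ ω, ∀ y ∈ W, g ω y ∈ V → f ω (g ω y) = y) :
    ∃ a : OpenPartialHomeomorph T T, a ∈ starClosure S ∧ a.symm ∈ starClosure S ∧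
      a.source = V ∩ ℓ ⁻¹' W ∧ ∀ y, a y = ℓ y := by
  have e1 : ∀ y ∈ V, ℓ y ∈ W → m (ℓ y) = y := fun y => h.leftInverse hW h' hfg
  have e2 : ∀ y ∈ W, m y ∈ V → ℓ (m y) = y := fun y => h'.leftInverse hV h hgf
  let a : OpenPartialHomeomorph T T :=
    { toFun := ℓ
      invFun := m
      source := V ∩ ℓ ⁻¹' W
      target := W ∩ m ⁻¹' V
      map_source' := fun y hy => ⟨hy.2, by rw [mem_preimage, e1 y hy.1 hy.2]; exact hy.1⟩
      map_target' := fun y hy => ⟨hy.2, by rw [mem_preimage, e2 y hy.1 hy.2]; exact hy.1⟩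
      left_inv' := fun y hy => e1 y hy.1 hy.2
      right_inv' := fun y hy => e2 y hy.1 hy.2
      open_source := h.continuousOn.isOpen_inter_preimage hV hW
      open_target := h'.continuousOn.isOpen_inter_preimage hW hV
      continuousOn_toFun := h.continuousOn.mono inter_subset_left
      continuousOn_invFun := h'.continuousOn.mono inter_subset_left }
  exact ⟨a, h.mem_starClosure hS hf hfV (a := a) inter_subset_left fun _ _ => rfl,
    h'.mem_starClosure hS hg hgW (a := a.symm) inter_subset_left fun _ _ => rfl, rfl, fun _ => rfl⟩

end Limits

/-! ### Minimality and transitivity of the closure -/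

namespace RegularAtlas

variable {n : ℕ} {X : Type u} {Z : Type v} [TopologicalSpace X] [TopologicalSpace Z]
  {ℱ : FoliatedStructure n X Z} {ι : Type w} {𝒰 : RegularAtlas ℱ ι} [Nonempty 𝒰.Transversal]

/-- Being related by holonomy is an equivalence relation that contains a plaque around every point.
Plaques are open for the leaf topology and the leaf is connected for it. -/
theorem exists_holonomy_of_mem_leaf {x y : X} (hxy : y ∈ leaf ℱ.plaques x) {i j : ι}
    (hi : x ∈ 𝒰.U i) (hj : y ∈ 𝒰.U j) : ∃ f ∈ 𝒰.holonomyPseudogroup,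
      𝒰.pr i x ∈ f.source ∧ f (𝒰.pr i x) = 𝒰.pr j y := by
  let R : X → X → Prop := fun x y => ∀ i j, x ∈ 𝒰.U i → y ∈ 𝒰.U j →
    ∃ f ∈ 𝒰.holonomyPseudogroup, 𝒰.pr i x ∈ f.source ∧ f (𝒰.pr i x) = 𝒰.pr j y
  suffices hR : R x y from hR i j hi hj
  refine @IsPreconnected.induction₂ X (leafTopology ℱ.plaques) (leaf ℱ.plaques x)
    (@isPreconnected_connectedComponent X (leafTopology ℱ.plaques) x) R ?_ ?_ ?_ x y
    (@mem_connectedComponent X (leafTopology ℱ.plaques) x) hxy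
  · intro z _
    obtain ⟨k, hk⟩ := 𝒰.cover z
    have hP : IsOpen[leafTopology ℱ.plaques] ((𝒰.chart k).plaque ((𝒰.chart k).proj ⟨z, hk⟩)) :=
      TopologicalSpace.isOpen_generateFrom_of_mem
        ⟨_, ⟨_, 𝒰.chart_mem k, _, rfl⟩, univ, isOpen_univ, (inter_univ _).symm⟩
    have hz : z ∈ (𝒰.chart k).plaque ((𝒰.chart k).proj ⟨z, hk⟩) :=
      FoliatedChart.mem_plaque_iff.2 ⟨hk, rfl⟩
    refine @mem_nhdsWithin_of_mem_nhds X (leafTopology ℱ.plaques) _ _ _ ?_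
    refine mem_of_superset (@IsOpen.mem_nhds X (leafTopology ℱ.plaques) _ _ hP hz) ?_
    intro w hw i j hi hj
    obtain ⟨hwk, hw2⟩ := FoliatedChart.mem_plaque_iff.1 hw
    have hzw : 𝒰.pr k z = 𝒰.pr k w := (pr_eq_iff hk hwk).2 hw2.symm
    refine ⟨_, trans_mem_holonomyPseudogroup (𝒰.hol_mem i k) (𝒰.hol_mem k j),
      ⟨pr_mem_hol_source hi hk, ?_⟩, ?_⟩
    · change 𝒰.hol i k (𝒰.pr i z) ∈ (𝒰.hol k j).source
      rw [hol_pr hi hk, hzw]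
      exact pr_mem_hol_source hwk hj
    · change 𝒰.hol k j (𝒰.hol i k _) = _
      rw [hol_pr hi hk, hzw, hol_pr hwk hj]
  · intro x y z _ _ _ hxy hyz i j hi hj
    obtain ⟨k, hk⟩ := 𝒰.cover y
    obtain ⟨f, hf, h1, h2⟩ := hxy i k hi hk
    obtain ⟨g, hg, h3, h4⟩ := hyz k j hk hj
    refine ⟨_, trans_mem_holonomyPseudogroup hf hg, ⟨h1, ?_⟩, ?_⟩
    · change f (𝒰.pr i x) ∈ g.source
      rw [h2]
      exact h3
    · change g (f _) = _
      rw [h2, h4]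
  · intro x y _ _ hxy i j hi hj
    obtain ⟨f, hf, h1, h2⟩ := hxy j i hj hi
    refine ⟨_, symm_mem_holonomyPseudogroup hf, ?_, ?_⟩
    · rw [← h2]
      exact f.map_source h1
    · rw [← h2, f.left_inv h1]

theorem exists_holonomy_mem_nhds (hmin : ℱ.IsMinimal) (t t' : 𝒰.Transversal)
    {O : Set 𝒰.Transversal} (hO : O ∈ 𝓝 t') :
    ∃ f ∈ 𝒰.holonomyPseudogroup, t ∈ f.source ∧ f t ∈ O := by
  obtain ⟨x, hx, hxt⟩ := exists_pr_eq t
  obtain ⟨y, hy, hyt⟩ := exists_pr_eq t'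
  have h1 : 𝒰.pr t'.1 ⁻¹' O ∩ 𝒰.U t'.1 ∈ 𝓝 y :=
    inter_mem ((continuousAt_pr hy).preimage_mem_nhds (by rwa [hyt])) ((isOpen_U _).mem_nhds hy)
  obtain ⟨z, hz1, hz2, hz3⟩ := (hmin x).inter_nhds_nonempty h1
  obtain ⟨f, hf, h2, h3⟩ := exists_holonomy_of_mem_leaf hz1 hx hz3
  rw [hxt] at h2 h3
  exact ⟨f, hf, h2, h3 ▸ hz2⟩

/-- For minimal foliated spaces, the closure of the holonomy pseudogroup is transitive. -/
theorem exists_mem_starClosure_apply_eq [CompactSpace X] [T2Space X] [T2Space Z]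
    [LocallyCompactSpace Z] (hmin : ℱ.IsMinimal)
    {S : Set (OpenPartialHomeomorph 𝒰.Transversal 𝒰.Transversal)}
    (hS : IsAdmissible 𝒰.holonomyPseudogroup S) (t t' : 𝒰.Transversal) :
    ∃ a ∈ starClosure S, a.symm ∈ starClosure S ∧ t ∈ a.source ∧ a t = t' := by
  obtain ⟨Q, hQ⟩ := hS.equicontinuous
  -- Boxes whose transversal lies in a compact subset of one metric domain: maps between them have
  -- the compact range needed for limits.
  have hbox : ∀ t : 𝒰.Transversal, ∃ (i : Q.ι) (C : Set 𝒰.Transversal) (a : CoreBox 𝒰 𝒰) (x : X),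
      IsCompact C ∧ C ⊆ Q.dom i ∧ a.map.source ⊆ C ∧ x ∈ interior a.core ∧
      𝒰.pr a.left x = t := by
    intro t
    obtain ⟨i, hi⟩ := Q.cover t
    obtain ⟨C, hC, htC, hCi⟩ := exists_compact_subset (Q.isOpen_dom i) hi
    obtain ⟨x, hx, hxt⟩ := exists_pr_eq t
    obtain ⟨c, B, hB, hxB, hBO⟩ := exists_isBox 𝒰 𝒰 hx hx (O := 𝒰.pr t.1 ⁻¹' interior C)
      ((continuousAt_pr hx).preimage_mem_nhds (by
        rw [hxt]
        exact isOpen_interior.mem_nhds htC))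
    obtain ⟨a, ha, -, rfl, rfl, hxa⟩ := exists_coreBox hB hxB
    refine ⟨i, C, a, x, hC, hCi, ?_, hxa, ha ▸ hxt⟩
    rw [hB.source_eq]
    rintro _ ⟨z, hz, rfl⟩
    exact interior_subset (hBO hz)
  obtain ⟨i, C, a, x, hC, hCi, haC, hx, hxt⟩ := hbox t
  obtain ⟨j, D, b, y, hD, hDj, hbD, hy, hyt⟩ := hbox t'
  obtain ⟨V, hV, htV, hVa, HV⟩ := exists_holonomy_extension hS hS a b (interior_subset hx)
  obtain ⟨W, hW, htW, hWb, HW⟩ := exists_holonomy_extension hS hS b a (interior_subset hy)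
  rw [hxt] at htV
  rw [hyt] at htW
  -- The index set consists of pairs of maps in `S`, on fixed domains `V` and `W`, inverse to each
  -- other wherever they compose. Passing to the limit in both components keeps the limit
  -- invertible.
  let Ω := {ω : OpenPartialHomeomorph 𝒰.Transversal 𝒰.Transversal ×
      OpenPartialHomeomorph 𝒰.Transversal 𝒰.Transversal // (ω.1 ∈ S ∧ ω.2 ∈ S) ∧
    (V ⊆ ω.1.source ∧ W ⊆ ω.2.source) ∧ (MapsTo ω.1 V D ∧ MapsTo ω.2 W C) ∧
    (∀ y ∈ V, ω.1 y ∈ W → ω.2 (ω.1 y) = y) ∧ (∀ y ∈ W, ω.2 y ∈ V → ω.1 (ω.2 y) = y)}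
  -- Density of leaves gives a holonomy map `f` with `f t` near `t'`. The pair consists of the
  -- uniform extensions of the germs of `f` at `t` and of `f⁻¹` at `f t`; quasi-analyticity makes
  -- them mutually inverse.
  have hne : (comap (fun ω : Ω => ω.1.1 t) (𝓝 t')).NeBot := by
    refine comap_neBot_iff.2 fun O hO => ?_
    have hb : 𝒰.pr b.left '' interior b.core ∈ 𝓝 t' := by
      rw [← hyt]
      exact pr_mem_nhds (b.isBox.left (b.core_subset (interior_subset hy)))
        (isOpen_interior.mem_nhds hy)
    obtain ⟨f, hf, htf, ⟨hfO, hfW⟩, z, hz, hzf⟩ := exists_holonomy_mem_nhds hmin t t'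
      (inter_mem (inter_mem hO (hW.mem_nhds htW)) hb)
    obtain ⟨g, ⟨g1, -, g3, -⟩, hVg, hgf⟩ := HV f hf t htV htf ⟨x, interior_subset hx, hxt⟩
      ⟨z, interior_subset hz, hzf⟩
    obtain ⟨k, ⟨k1, -, k3, -⟩, hWk, hkf⟩ := HW f.symm (symm_mem_holonomyPseudogroup hf) (f t) hfW
      (f.map_source htf) ⟨z, interior_subset hz, hzf⟩
      ⟨x, interior_subset hx, hxt.trans (f.left_inv htf).symm⟩
    have hgt : g t = f t := hgf.self_of_nhds
    have hkt : k (f t) = t := hkf.self_of_nhds.trans (f.left_inv htf)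
    refine ⟨⟨(g, k), ⟨g1, k1⟩, ⟨hVg, hWk⟩,
      ⟨fun u hu => hbD (g3 (g.map_source (hVg hu))), fun u hu => haC (k3 (k.map_source (hWk hu)))⟩,
      ?_, ?_⟩, hgt ▸ hfO⟩
    · intro u hu hgu
      refine hS.quasiAnalytic.eq_of_eventually (hS.isLocal.trans_mem _ g1 _ k1) (t := t)
        ⟨hVg htV, ?_⟩ ?_ (x := u) ⟨hVg hu, hWk hgu⟩
      · change g t ∈ k.source
        rw [hgt]
        exact hWk hfW
      · filter_upwards [hgf, (f.continuousAt htf).eventually hkf, f.open_source.mem_nhds htf]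
          with r r1 r2 r3
        change k (g r) = r
        rw [r1, r2, f.left_inv r3]
    · intro u hu hku
      refine hS.quasiAnalytic.eq_of_eventually (hS.isLocal.trans_mem _ k1 _ g1) (t := f t)
        ⟨hWk hfW, ?_⟩ ?_ (x := u) ⟨hWk hu, hVg hku⟩
      · change k (f t) ∈ g.source
        rw [hkt]
        exact hVg htV
      · have e := f.symm.continuousAt (f.map_source htf)
        rw [ContinuousAt, f.left_inv htf] at e
        filter_upwards [hkf, e.eventually hgf, f.open_target.mem_nhds (f.map_source htf)]
          with r r1 r2 r3
        change g (k r) = r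
        rw [r1, r2, f.right_inv r3]
  let 𝒱 : Ultrafilter Ω := Ultrafilter.of (comap (fun ω : Ω => ω.1.1 t) (𝓝 t'))
  have h𝒱 : Tendsto (fun ω : Ω => ω.1.1 t) 𝒱 (𝓝 t') :=
    tendsto_comap.mono_left (Ultrafilter.of_le _)
  obtain ⟨ℓ, hℓ⟩ := exists_locallyTendsto hQ 𝒱 (f := fun ω => ω.1.1) (fun ω => ω.2.1.1)
    (fun ω => ω.2.2.1.1) hD (fun ω => ω.2.2.2.1.1) (hVa.trans (haC.trans hCi)) hDj
  obtain ⟨m, hm⟩ := exists_locallyTendsto hQ 𝒱 (f := fun ω => ω.1.2) (fun ω => ω.2.1.2)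
    (fun ω => ω.2.2.1.2) hC (fun ω => ω.2.2.2.1.2) (hWb.trans (hbD.trans hDj)) hCi
  obtain ⟨e, he, he', hes, hel⟩ := exists_limit_mem_starClosure hS.isLocal
    (fun ω : Ω => ω.2.1.1) (fun ω => ω.2.1.2) hV hW (fun ω => ω.2.2.1.1) (fun ω => ω.2.2.1.2)
    hℓ hm (fun ω => ω.2.2.2.2.1) (fun ω => ω.2.2.2.2.2)
  have hℓt : ℓ t = t' := tendsto_nhds_unique (hℓ.tendsto htV) h𝒱
  refine ⟨e, he, he', ?_, (hel t).trans hℓt⟩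
  rw [hes]
  refine ⟨htV, ?_⟩
  rw [mem_preimage, hℓt]
  exact htW

end RegularAtlas

/-! ### Continuous maps of germs induced by conjugation -/

section GermConj

theorem sigma_germ_eq_iff {T T' : Type*} [TopologicalSpace T] {x y : T} {f g : T → T'} :
    (⟨x, (f : Germ (𝓝 x) T')⟩ : Σ x : T, Germ (𝓝 x) T') = ⟨y, (g : Germ (𝓝 y) T')⟩ ↔
      x = y ∧ f =ᶠ[𝓝 x] g := by
  constructor
  · intro h
    obtain ⟨rfl, h⟩ := Sigma.mk.inj_iff.1 h
    exact ⟨rfl, Germ.coe_eq.1 (eq_of_heq h)⟩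
  · rintro ⟨rfl, h⟩
    exact congrArg (Sigma.mk x) (Germ.coe_eq.2 h)

variable {T T' : Type*} [TopologicalSpace T] [TopologicalSpace T']

/-- `γ'` is the germ `l γ k`. -/
def GermConj (k : OpenPartialHomeomorph T' T) (l : OpenPartialHomeomorph T T')
    (γ : Σ x : T, Germ (𝓝 x) T) (γ' : Σ x : T', Germ (𝓝 x) T') : Prop :=
  ∃ (g : T → T) (s : T'), s ∈ k.source ∧ γ = ⟨k s, (g : Germ (𝓝 (k s)) T)⟩ ∧
    γ' = ⟨s, ((l ∘ g ∘ k : T' → T') : Germ (𝓝 s) T')⟩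

variable {k : OpenPartialHomeomorph T' T} {l : OpenPartialHomeomorph T T'}

theorem GermConj.unique {γ : Σ x : T, Germ (𝓝 x) T} {γ₁ γ₂ : Σ x : T', Germ (𝓝 x) T'}
    (h₁ : GermConj k l γ γ₁) (h₂ : GermConj k l γ γ₂) : γ₁ = γ₂ := by
  obtain ⟨g₁, s₁, hs₁, rfl, rfl⟩ := h₁
  obtain ⟨g₂, s₂, hs₂, h, rfl⟩ := h₂
  obtain ⟨h1, h2⟩ := sigma_germ_eq_iff.1 h
  obtain rfl := k.injOn hs₁ hs₂ h1
  refine sigma_germ_eq_iff.2 ⟨rfl, ?_⟩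
  filter_upwards [(k.continuousAt hs₁).eventually h2] with t ht
  simp only [Function.comp, ht]

theorem That.exists_mem_starClosure {S : Set (OpenPartialHomeomorph T T)} (γ : That S) :
    ∃ g ∈ starClosure S, ∃ x ∈ g.source, γ.1 = germ g x := by
  obtain ⟨γ, g, hg, x, hx, rfl⟩ := γ
  obtain ⟨O, hO, hxO, -, h⟩ := hg x hx
  refine ⟨_, h, x, ?_, rfl⟩
  rw [OpenPartialHomeomorph.restr_source' _ _ hO]
  exact ⟨hx, hxO⟩

variable {S : Set (OpenPartialHomeomorph T T)} {S' : Set (OpenPartialHomeomorph T' T')}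

theorem germConj_germ {f : OpenPartialHomeomorph T T} {y : T} (hy : y ∈ k.target) (V : Set T') :
    GermConj k l (germ f y) (germ (((k.trans f).trans l).restr V) (k.symm y)) := by
  refine ⟨f, k.symm y, k.map_target hy, sigma_germ_eq_iff.2
    ⟨(k.right_inv hy).symm, EventuallyEq.rfl⟩, rfl⟩

/-- If `f ↦ l f k` transports `S̄` to `S̄'`, then it induces a continuous map of germs. -/
theorem Transports.exists_continuous_germConj (h : Transports S S' k l) :
    ∃ Φ : {γ : That S // γ.1.1 ∈ k.target ∧ γ.1.2.value ∈ l.source} → That S',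
      Continuous Φ ∧ ∀ γ, GermConj k l γ.1.1 (Φ γ).1 := by
  have hex : ∀ γ : {γ : That S // γ.1.1 ∈ k.target ∧ γ.1.2.value ∈ l.source},
      ∃ γ' : That S', GermConj k l γ.1.1 γ'.1 := by
    rintro ⟨γ, hγ⟩
    obtain ⟨g, hg, x, hx, e⟩ := γ.exists_mem_starClosure
    rw [e] at hγ
    change x ∈ k.target ∧ g x ∈ l.source at hγ
    have hkx := k.right_inv hγ.1
    obtain ⟨V, hV, hxV, N, hN, H⟩ := h g hg (k.symm x) (k.map_target hγ.1)
      (by rw [hkx]; exact hx) (by rw [hkx]; exact hγ.2)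
    obtain ⟨h1, h2⟩ := H g hg (mem_of_mem_nhds hN)
    have h3 : k.symm x ∈ (((k.trans g).trans l).restr V).source := by
      rw [OpenPartialHomeomorph.restr_source' _ _ hV]
      exact ⟨h1 hxV, hxV⟩
    refine ⟨germMap S' ⟨(_, k.symm x), h2, h3⟩, ?_⟩
    change GermConj k l γ.1 _
    rw [e]
    exact germConj_germ hγ.1 V
  choose Φ hΦ using hex
  refine ⟨Φ, continuous_def.2 fun A hA => ?_, hΦ⟩
  suffices hU : IsOpen {γ : That S | ∃ hγ : γ.1.1 ∈ k.target ∧ γ.1.2.value ∈ l.source,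
      Φ ⟨γ, hγ⟩ ∈ A} by
    convert hU.preimage continuous_subtype_val using 1
    ext γ
    exact ⟨fun h => ⟨γ.2, h⟩, fun ⟨_, h⟩ => h⟩
  refine isOpen_coinduced.2 (isOpen_iff_mem_nhds.2 ?_)
  rintro ⟨⟨f, y⟩, hf, hy⟩ ⟨hΩ, hA'⟩
  change y ∈ k.target ∧ f y ∈ l.source at hΩ
  change y ∈ f.source at hy
  have hky := k.right_inv hΩ.1
  obtain ⟨V, hV, hyV, N, hN, H⟩ := h f hf (k.symm y) (k.map_target hΩ.1)
    (by rw [hky]; exact hy) (by rw [hky]; exact hΩ.2)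
  -- The topology of `That` is coinduced, so openness is tested on pairs. Since one `V` serves all
  -- the maps in `N`, the formula `(f, y) ↦ (l f k|_V, k⁻¹ y)` is a continuous lift of `Φ` on the
  -- open set `W`.
  let W : Set (StarPairs S) := {q | q.1.1 ∈ interior N ∧ q.1.2 ∈ k.target ∩ k.symm ⁻¹' V}
  have hW : IsOpen W :=
    (isOpen_interior.preimage (continuous_fst.comp continuous_subtype_val)).inter
      ((k.symm.isOpen_inter_preimage hV).preimage (continuous_snd.comp continuous_subtype_val))
  have hsrc : ∀ q : W, k.symm q.1.1.2 ∈ (((k.trans q.1.1.1).trans l).restr V).source := by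
    intro q
    rw [OpenPartialHomeomorph.restr_source' _ _ hV]
    exact ⟨(H q.1.1.1 q.1.2.1 (interior_subset q.2.1)).1 q.2.2.2, q.2.2.2⟩
  let Θ : W → StarPairs S' := fun q =>
    ⟨(((k.trans q.1.1.1).trans l).restr V, k.symm q.1.1.2),
      (H q.1.1.1 q.1.2.1 (interior_subset q.2.1)).2, hsrc q⟩
  have hΘ : Continuous Θ := by
    refine Continuous.subtype_mk (Continuous.prodMk ?_ ?_) _
    · exact ((continuous_restr V).comp (continuous_trans_trans k l)).comp
        (continuous_fst.comp (continuous_subtype_val.comp continuous_subtype_val))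
    · exact k.symm.continuousOn.comp_continuous
        (continuous_snd.comp (continuous_subtype_val.comp continuous_subtype_val))
        fun q => q.2.2.1
  have hgΘ : Continuous fun q => germMap S' (Θ q) := by
    have hg : Continuous (germMap S') := continuous_coinduced_rng
    exact hg.comp hΘ
  have hval : ∀ q : W, ∃ hq : (germMap S q.1).1.1 ∈ k.target ∧ (germMap S q.1).1.2.value ∈ l.source,
      Φ ⟨germMap S q.1, hq⟩ = germMap S' (Θ q) := by
    intro q
    have hq : (germMap S q.1).1.1 ∈ k.target ∧ (germMap S q.1).1.2.value ∈ l.source := by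
      refine ⟨q.2.2.1, ?_⟩
      have := ((H q.1.1.1 q.1.2.1 (interior_subset q.2.1)).1 q.2.2.2).2
      change q.1.1.1 (k (k.symm q.1.1.2)) ∈ l.source at this
      rw [k.right_inv q.2.2.1] at this
      exact this
    exact ⟨hq, Subtype.ext ((hΦ ⟨_, hq⟩).unique (germConj_germ q.2.2.1 V))⟩
  have hqW : (⟨(f, y), hf, hy⟩ : StarPairs S) ∈ W :=
    ⟨mem_interior_iff_mem_nhds.2 hN, hΩ.1, hyV⟩
  refine mem_of_superset ((hW.isOpenMap_subtype_val _ (hA.preimage hgΘ)).mem_nhds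
    ⟨⟨_, hqW⟩, ?_, rfl⟩) ?_
  · obtain ⟨hq, e⟩ := hval ⟨_, hqW⟩
    rw [mem_preimage, ← e]
    exact hA'
  · rintro _ ⟨q, hq, rfl⟩
    obtain ⟨hq', e⟩ := hval q
    refine ⟨hq', ?_⟩
    rw [e]
    exact hq

end GermConj

/-! ### Coherence of plaques and leaves -/

section LeafTopology

variable {X Y : Type*} [TopologicalSpace X] [TopologicalSpace Y]

theorem IsOpenIn.image {A P : Set X} (h : IsOpenIn A P) (F : X ≃ₜ Y) :
    IsOpenIn (F '' A) (F '' P) := by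
  obtain ⟨O, hO, rfl⟩ := h
  exact ⟨F '' O, F.isOpenMap O hO, image_inter F.injective⟩

theorem isOpenIn_of_forall {A P : Set X} (hAP : A ⊆ P)
    (h : ∀ x ∈ A, ∃ O, IsOpen O ∧ x ∈ O ∧ P ∩ O ⊆ A) : IsOpenIn A P := by
  choose! O hO hxO hOA using h
  refine ⟨⋃ x ∈ A, O x, isOpen_biUnion hO, Subset.antisymm
    (fun x hx => ⟨hAP hx, mem_biUnion hx (hxO x hx)⟩) ?_⟩
  rintro y ⟨hyP, hy⟩
  obtain ⟨x, hx, hyx⟩ := mem_iUnion₂.1 hy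
  exact hOA x hx ⟨hyP, hyx⟩

/-- By coherence, the preimage of a relatively open subset of `Q` meets each plaque `P` in a
relatively open subset of `P`, which is a generator of the leaf topology. -/
theorem continuous_leafTopology {Ps : Set (Set X)} {Qs : Set (Set Y)} (F : X ≃ₜ Y)
    (hcov : ∀ x, ∃ P ∈ Ps, x ∈ P) (hcoh : ∀ P ∈ Ps, ∀ Q ∈ Qs, IsOpenIn (F '' P ∩ Q) (F '' P)) :
    @Continuous X Y (leafTopology Ps) (leafTopology Qs) F := by
  refine (@continuous_generateFrom_iff X Y F (leafTopology Ps) _).2 ?_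
  rintro _ ⟨Q, hQ, O, hO, rfl⟩
  refine (@isOpen_iff_forall_mem_open X (leafTopology Ps) _).2 ?_
  rintro x ⟨hxQ, hxO⟩
  obtain ⟨P, hP, hxP⟩ := hcov x
  obtain ⟨O', hO', e⟩ := hcoh P hP Q hQ
  refine ⟨P ∩ F ⁻¹' (O' ∩ O), ?_, TopologicalSpace.isOpen_generateFrom_of_mem
    ⟨P, hP, _, (hO'.inter hO).preimage F.continuous, rfl⟩, hxP, ?_, hxO⟩
  · rintro y ⟨hyP, hyO', hyO⟩
    have : F y ∈ F '' P ∩ Q := by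
      rw [e]
      exact ⟨⟨y, hyP, rfl⟩, hyO'⟩
    exact ⟨this.2, hyO⟩
  · have : F x ∈ F '' P ∩ Q := ⟨⟨x, hxP, rfl⟩, hxQ⟩
    rw [e] at this
    exact this.2

/-- A homeomorphism that maps plaques to sets coherent with plaques is foliated. -/
theorem isFoliatedHomeomorph_of_coherent {Ps : Set (Set X)} {Qs : Set (Set Y)} {F : X ≃ₜ Y}
    (hP : ∀ x, ∃ P ∈ Ps, x ∈ P) (hQ : ∀ y, ∃ Q ∈ Qs, y ∈ Q)
    (hcoh : ∀ P ∈ Ps, ∀ Q ∈ Qs, IsOpenIn (F '' P ∩ Q) (F '' P) ∧ IsOpenIn (F '' P ∩ Q) Q) :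
    IsFoliatedHomeomorph Ps Qs F := by
  refine ⟨fun x => ?_, hcoh⟩
  have h1 := continuous_leafTopology F hP fun P hP Q hQ => (hcoh P hP Q hQ).1
  have h2 := continuous_leafTopology F.symm hQ (Qs := Ps) fun Q hQ P hP => by
    have h3 := (hcoh P hP Q hQ).2.image F.symm
    rwa [image_inter F.symm.injective, ← image_comp, F.symm_comp_self, image_id, inter_comm] at h3
  refine Subset.antisymm
    (@Continuous.image_connectedComponent_subset X Y (leafTopology Ps) (leafTopology Qs) F h1 x) ?_
  intro y hy
  have h3 : F.symm y ∈ @connectedComponent X (leafTopology Ps) (F.symm (F x)) :=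
    @Continuous.image_connectedComponent_subset Y X (leafTopology Qs) (leafTopology Ps)
      F.symm h2 (F x) _ (mem_image_of_mem _ hy)
  rw [F.symm_apply_apply] at h3
  exact ⟨F.symm y, h3, F.apply_symm_apply y⟩

end LeafTopology

/-! ### The Molino space as a space of germs on `X` -/

namespace RegularAtlas

section

variable {n : ℕ} {X : Type u} {Z : Type v} [TopologicalSpace X] [TopologicalSpace Z]
  {ℱ : FoliatedStructure n X Z} {ι : Type w} {𝒰 : RegularAtlas ℱ ι}
  {S : Set (OpenPartialHomeomorph 𝒰.Transversal 𝒰.Transversal)} {t₀ : 𝒰.Transversal}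

theorem XTilde.continuous_point : Continuous fun q : 𝒰.XTilde S t₀ => (q.1.2.1 : X) := by
  have h : Continuous fun q : Σ i, 𝒰.U i × That₀ S t₀ => (q.2.1 : X) :=
    continuous_sigma fun i => continuous_subtype_val.comp continuous_fst
  exact h.comp continuous_subtype_val

theorem XTilde.continuous_germ : Continuous fun q : 𝒰.XTilde S t₀ => q.1.2.2.1 := by
  have h : Continuous fun q : Σ i, 𝒰.U i × That₀ S t₀ => q.2.2.1 :=
    continuous_sigma fun i => continuous_subtype_val.comp continuous_snd
  exact h.comp continuous_subtype_val

theorem continuous_piHat : Continuous (𝒰.piHat S t₀) :=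
  continuous_quot_lift _ XTilde.continuous_point

theorem exists_mem_hatPlaques (z : 𝒰.XHat S t₀) : ∃ P ∈ 𝒰.hatPlaques S t₀, z ∈ P := by
  induction z using Quot.ind with
  | mk q =>
    refine ⟨_, ⟨q.1.1, q.1.2.2, ?_, rfl⟩, q, rfl, rfl, rfl⟩
    rw [← q.2]
    rfl

end

variable {n : ℕ} {X : Type u} {Z : Type v} [TopologicalSpace X] [TopologicalSpace Z]
  {ℱ : FoliatedStructure n X Z} {ι : Type w} {𝒰 : RegularAtlas ℱ ι} [Nonempty 𝒰.Transversal]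
  {S : Set (OpenPartialHomeomorph 𝒰.Transversal 𝒰.Transversal)} {t₀ : 𝒰.Transversal}

theorem XTilde.pr_eq (q : 𝒰.XTilde S t₀) : 𝒰.pr q.1.1 q.1.2.1 = q.1.2.2.1.1.1 :=
  (pr_coe _ _).trans q.2

theorem XTilde.tendsto_pr (q : 𝒰.XTilde S t₀) :
    Tendsto (𝒰.pr q.1.1) (𝓝 (q.1.2.1 : X)) (𝓝 q.1.2.2.1.1.1) := by
  have := continuousAt_pr q.1.2.1.2
  rwa [ContinuousAt, q.pr_eq] at this

/-- The germ at `x` of `g ∘ p_i`, for `(x, γ, i)` in `X̃₀` and `γ` the germ of `g`. -/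
noncomputable def XTilde.toGerm (q : 𝒰.XTilde S t₀) : Σ x : X, Germ (𝓝 x) 𝒰.Transversal :=
  ⟨q.1.2.1, q.1.2.2.1.1.2.compTendsto (𝒰.pr q.1.1) q.tendsto_pr⟩

theorem XTilde.toGerm_eq (q : 𝒰.XTilde S t₀) {g : 𝒰.Transversal → 𝒰.Transversal}
    {t : 𝒰.Transversal} (h : q.1.2.2.1.1 = ⟨t, (g : Germ (𝓝 t) 𝒰.Transversal)⟩) :
    q.toGerm = ⟨q.1.2.1, ((g ∘ 𝒰.pr q.1.1 : X → 𝒰.Transversal) : Germ _ _)⟩ := by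
  have key : ∀ (γ : Σ x : 𝒰.Transversal, Germ (𝓝 x) 𝒰.Transversal)
      (ht : Tendsto (𝒰.pr q.1.1) (𝓝 (q.1.2.1 : X)) (𝓝 γ.1)),
      γ = ⟨t, (g : Germ (𝓝 t) 𝒰.Transversal)⟩ →
      γ.2.compTendsto (𝒰.pr q.1.1) ht = ((g ∘ 𝒰.pr q.1.1 : X → 𝒰.Transversal) : Germ _ _) := by
    rintro γ ht rfl
    rfl
  exact congrArg (Sigma.mk _) (key _ _ h)

theorem XTilde.exists_rep (q : 𝒰.XTilde S t₀) : ∃ g ∈ closurePseudogroup S,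
    q.1.2.2.1.1 = germ g (𝒰.pr q.1.1 q.1.2.1) ∧ 𝒰.pr q.1.1 q.1.2.1 ∈ g.source ∧
      g (𝒰.pr q.1.1 q.1.2.1) = t₀ := by
  obtain ⟨g, hg, x, hx, e⟩ := q.1.2.2.1.2
  have hx' : 𝒰.pr q.1.1 q.1.2.1 = x := by rw [q.pr_eq, e]; rfl
  rw [hx']
  refine ⟨g, hg, e, hx, ?_⟩
  have h := q.1.2.2.2
  rw [e] at h
  exact h

/-- Replacing `(g, p_i)` by `(g h_{ji}, p_j)` does not change `g ∘ p_i` near `x`. Conversely `g ∘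
p_i` determines the germ of `g` because `p_i` is open. In particular `glue` is already an
equivalence relation. -/
theorem glue_iff {q r : 𝒰.XTilde S t₀} : 𝒰.glue S t₀ q r ↔ q.toGerm = r.toGerm := by
  constructor
  · rintro ⟨h1, g, hg, t, htg, hth, hr, hq⟩
    have ht : t = 𝒰.pr r.1.1 r.1.2.1 := by rw [r.pr_eq, hr]; rfl
    rw [q.toGerm_eq hq, r.toGerm_eq hr]
    refine sigma_germ_eq_iff.2 ⟨h1, ?_⟩
    filter_upwards [(isOpen_U _).mem_nhds q.1.2.1.2,
      (isOpen_U r.1.1).mem_nhds (h1 ▸ r.1.2.1.2)] with x hxq hxr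
    change g (𝒰.hol q.1.1 r.1.1 (𝒰.pr q.1.1 x)) = g (𝒰.pr r.1.1 x)
    rw [hol_pr hxq hxr]
  · intro h
    obtain ⟨g, hg, hr, hrs, -⟩ := r.exists_rep
    obtain ⟨g', hg', hq, hqs, -⟩ := q.exists_rep
    rw [q.toGerm_eq hq, r.toGerm_eq hr] at h
    obtain ⟨h1, h2⟩ := sigma_germ_eq_iff.1 h
    have hxr : (q.1.2.1 : X) ∈ 𝒰.U r.1.1 := h1 ▸ r.1.2.1.2
    have hxq := q.1.2.1.2
    rw [← h1] at hr hrs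
    refine ⟨h1, g, hg, _, hrs, pr_mem_hol_source hxr hxq, hr, ?_⟩
    rw [hq, hol_pr hxr hxq]
    refine sigma_germ_eq_iff.2 ⟨rfl, ?_⟩
    change ∀ᶠ t in 𝓝 (𝒰.pr q.1.1 q.1.2.1), g' t = g (𝒰.hol q.1.1 r.1.1 t)
    rw [eventually_nhds_pr hxq]
    filter_upwards [h2, (isOpen_U _).mem_nhds hxq, (isOpen_U _).mem_nhds hxr] with x e1 e2 e3
    rw [hol_pr e2 e3]
    exact e1

/-- The points of `X̂₀` as germs of maps from `X` to the transversal. -/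
noncomputable def XHat.toGerm : 𝒰.XHat S t₀ → Σ x : X, Germ (𝓝 x) 𝒰.Transversal :=
  Quot.lift XTilde.toGerm fun _ _ h => glue_iff.1 h

theorem XHat.toGerm_injective : Function.Injective (XHat.toGerm : 𝒰.XHat S t₀ → _) := by
  rintro ⟨q⟩ ⟨r⟩ h
  exact Quot.sound (glue_iff.2 h)

theorem XHat.toGerm_fst (z : 𝒰.XHat S t₀) : z.toGerm.1 = 𝒰.piHat S t₀ z := by
  induction z using Quot.ind
  rfl

/-- A point of `X̂₀` is the germ of a map that is continuous at its base point, with value `t₀`. -/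
theorem XHat.exists_toGerm_eq (z : 𝒰.XHat S t₀) : ∃ ψ : X → 𝒰.Transversal,
    z.toGerm = ⟨𝒰.piHat S t₀ z, (ψ : Germ _ _)⟩ ∧
      Tendsto ψ (𝓝 (𝒰.piHat S t₀ z)) (𝓝 t₀) := by
  induction z using Quot.ind with
  | mk q =>
    obtain ⟨g, -, hq, hs, h0⟩ := q.exists_rep
    refine ⟨_, q.toGerm_eq hq, ?_⟩
    have h1 := g.continuousAt hs
    rw [ContinuousAt, h0] at h1
    exact h1.comp (continuousAt_pr q.1.2.1.2)

/-- Composition of germs with a map. -/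
def mapGerm {T T' : Type*} (l : T → T') (γ : Σ x : X, Germ (𝓝 x) T) : Σ x : X, Germ (𝓝 x) T' :=
  ⟨γ.1, γ.2.map l⟩

theorem mapGerm_symm_mapGerm {T' : Type*} [TopologicalSpace T']
    {l : OpenPartialHomeomorph 𝒰.Transversal T'}
    (hl : t₀ ∈ l.source) (z : 𝒰.XHat S t₀) : mapGerm l.symm (mapGerm l z.toGerm) = z.toGerm := by
  obtain ⟨ψ, h1, h2⟩ := z.exists_toGerm_eq
  rw [h1]
  refine sigma_germ_eq_iff.2 ⟨rfl, ?_⟩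
  filter_upwards [h2.eventually (l.open_source.mem_nhds hl)] with x hx
  exact l.left_inv hx

variable {ι' : Type*} {𝒰' : RegularAtlas ℱ ι'} [Nonempty 𝒰'.Transversal]
  {S' : Set (OpenPartialHomeomorph 𝒰'.Transversal 𝒰'.Transversal)} {t₁ : 𝒰'.Transversal}

/-- Near `q₀` the index is constant and the point stays in a box, so the explicit formula `(x, γ, i)
↦ (x, l γ c⁻¹, j)` is available and continuous. -/
theorem exists_local_lift {l : OpenPartialHomeomorph 𝒰.Transversal 𝒰'.Transversal}
    (hl : t₀ ∈ l.source) (hlt : l t₀ = t₁)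
    (hT : ∀ i j c B, IsBox 𝒰 𝒰' i j c B → Transports S S' c.symm l) (q₀ : 𝒰.XTilde S t₀) :
    ∃ O : Set (𝒰.XTilde S t₀), IsOpen O ∧ q₀ ∈ O ∧ ∃ Θ : O → 𝒰'.XTilde S' t₁, Continuous Θ ∧
      ∀ q, (Θ q).toGerm = mapGerm l q.1.toGerm := by
  obtain ⟨j, hj⟩ := 𝒰'.cover (q₀.1.2.1 : X)
  obtain ⟨c, B, hB, hxB, -⟩ := exists_isBox 𝒰 𝒰' q₀.1.2.1.2 hj univ_mem
  obtain ⟨Φ, hΦc, hΦ⟩ := (hT _ _ c B hB).exists_continuous_germConj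
  let O : Set (𝒰.XTilde S t₀) := {q | q.1.1 = q₀.1.1 ∧ (q.1.2.1 : X) ∈ B}
  have hO : IsOpen O := by
    refine IsOpen.inter ?_ (hB.isOpen.preimage XTilde.continuous_point)
    exact (isOpen_sigma_fst_preimage {q₀.1.1}).preimage continuous_subtype_val
  have hpr : ∀ q : O, 𝒰.pr q₀.1.1 (q.1.1.2.1 : X) = q.1.1.2.2.1.1.1 := fun q =>
    (congrArg (fun i => 𝒰.pr i (q.1.1.2.1 : X)) q.2.1).symm.trans q.1.pr_eq
  have hΩ : ∀ q : O, q.1.1.2.2.1.1.1 ∈ c.symm.target ∧ q.1.1.2.2.1.1.2.value ∈ l.source := by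
    intro q
    refine ⟨?_, ?_⟩
    · rw [← hpr q]
      exact hB.pr_mem_source q.2.2
    · rw [q.1.1.2.2.2]
      exact hl
  -- These are the two conditions for the new triple to lie in the other `XTilde`: the germ has
  -- target `t₁` and its source is `p'_j(x)`.
  have hkey : ∀ q : O, (Φ ⟨_, hΩ q⟩).1.2.value = t₁ ∧
      𝒰'.pr j (q.1.1.2.1 : X) = (Φ ⟨_, hΩ q⟩).1.1 := by
    intro q
    obtain ⟨g, s, hs, h1, h2⟩ := hΦ ⟨_, hΩ q⟩
    have h3 := q.1.1.2.2.2
    have h4 := hpr q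
    change q.1.1.2.2.1.1 = _ at h1
    rw [h1] at h3 h4
    change g (c.symm s) = t₀ at h3
    change _ = c.symm s at h4
    rw [h2]
    refine ⟨?_, ?_⟩
    · change l (g (c.symm s)) = t₁
      rw [h3, hlt]
    · change _ = s
      rw [← hB.map_pr _ q.2.2, h4, c.right_inv hs]
  let Θ : O → 𝒰'.XTilde S' t₁ := fun q =>
    ⟨⟨j, ⟨q.1.1.2.1, hB.right q.2.2⟩, ⟨Φ ⟨_, hΩ q⟩, (hkey q).1⟩⟩,
      (pr_of_mem (hB.right q.2.2)).symm.trans (hkey q).2⟩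
  refine ⟨O, hO, ⟨rfl, hxB⟩, Θ, ?_, ?_⟩
  · refine Continuous.subtype_mk (continuous_sigmaMk.comp (Continuous.prodMk ?_ ?_)) _
    · exact (XTilde.continuous_point.comp continuous_subtype_val).subtype_mk _
    · exact (hΦc.comp ((XTilde.continuous_germ.comp continuous_subtype_val).subtype_mk _)).subtype_mk _
  · intro q
    obtain ⟨g, s, hs, h1, h2⟩ := hΦ ⟨_, hΩ q⟩
    rw [(Θ q).toGerm_eq h2, q.1.toGerm_eq h1]
    refine sigma_germ_eq_iff.2 ⟨rfl, ?_⟩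
    filter_upwards [hB.isOpen.mem_nhds q.2.2] with x hx
    change l (g (c.symm (𝒰'.pr j x))) = l (g (𝒰.pr q.1.1.1 x))
    rw [hB.symm.map_pr x hx, q.2.1]

/-- The local lifts depend on boxes, but their classes are determined by the germ `l ∘ ψ`;
injectivity of `toGerm` glues them and makes them descend to the quotient. -/
theorem exists_continuous_toGerm_eq {l : OpenPartialHomeomorph 𝒰.Transversal 𝒰'.Transversal}
    (hl : t₀ ∈ l.source) (hlt : l t₀ = t₁)
    (hT : ∀ i j c B, IsBox 𝒰 𝒰' i j c B → Transports S S' c.symm l) :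
    ∃ F : 𝒰.XHat S t₀ → 𝒰'.XHat S' t₁, Continuous F ∧
      ∀ z, (F z).toGerm = mapGerm l z.toGerm := by
  have hloc := exists_local_lift (S := S) (S' := S') hl hlt hT
  have hex : ∀ q : 𝒰.XTilde S t₀, ∃ z : 𝒰'.XHat S' t₁, z.toGerm = mapGerm l q.toGerm := by
    intro q
    obtain ⟨O, -, hq, Θ, -, hΘ⟩ := hloc q
    exact ⟨Quot.mk _ (Θ ⟨q, hq⟩), hΘ ⟨q, hq⟩⟩
  choose G hG using hex
  have hGc : Continuous G := by
    rw [continuous_iff_continuousAt]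
    intro q
    obtain ⟨O, hO, hq, Θ, hΘc, hΘ⟩ := hloc q
    refine ContinuousOn.continuousAt ?_ (hO.mem_nhds hq)
    rw [continuousOn_iff_continuous_domRestrict]
    have e : O.domRestrict G = fun r => Quot.mk _ (Θ r) := by
      funext r
      exact XHat.toGerm_injective ((hG r).trans (hΘ r).symm)
    rw [e]
    exact continuous_quot_mk.comp hΘc
  refine ⟨Quot.lift G fun q r h => XHat.toGerm_injective ?_, continuous_quot_lift _ hGc, ?_⟩
  · rw [hG, hG, glue_iff.1 h]
  · intro z
    induction z using Quot.ind
    exact hG _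

theorem exists_homeomorph_toGerm_eq {l : OpenPartialHomeomorph 𝒰.Transversal 𝒰'.Transversal}
    (hl : t₀ ∈ l.source) (hlt : l t₀ = t₁)
    (hT : ∀ i j c B, IsBox 𝒰 𝒰' i j c B → Transports S S' c.symm l)
    (hT' : ∀ i j c B, IsBox 𝒰' 𝒰 i j c B → Transports S' S c.symm l.symm) :
    ∃ F : 𝒰.XHat S t₀ ≃ₜ 𝒰'.XHat S' t₁, ∀ z, (F z).toGerm = mapGerm l z.toGerm := by
  have hl' : t₁ ∈ l.symm.source := hlt ▸ l.map_source hl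
  have hlt' : l.symm t₁ = t₀ := by rw [← hlt, l.left_inv hl]
  obtain ⟨F, hFc, hF⟩ := exists_continuous_toGerm_eq (S := S) (S' := S') hl hlt hT
  obtain ⟨G, hGc, hG⟩ := exists_continuous_toGerm_eq (S := S') (S' := S) hl' hlt' hT'
  refine ⟨⟨⟨F, G, fun z => XHat.toGerm_injective ?_, fun z => XHat.toGerm_injective ?_⟩, hFc, hGc⟩,
    hF⟩
  · rw [hG, hF, mapGerm_symm_mapGerm hl]
  · rw [hF, hG]
    exact mapGerm_symm_mapGerm hl' z

theorem piHat_eq_of_toGerm_eq {l : 𝒰.Transversal → 𝒰'.Transversal} {z : 𝒰.XHat S t₀}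
    {w : 𝒰'.XHat S' t₁} (h : w.toGerm = mapGerm l z.toGerm) :
    𝒰'.piHat S' t₁ w = 𝒰.piHat S t₀ z := by
  rw [← XHat.toGerm_fst, ← XHat.toGerm_fst, h]
  rfl

/-- At a common point of `F(P)` and `Q`, the two sets coincide over a whole box `B` around its base
point: over `B`, `p_i` and `p'_j` have the same fibres, and `F[x, γ, i] = [x, γ', j]` there. -/
theorem coherent_hatPlaques {l : OpenPartialHomeomorph 𝒰.Transversal 𝒰'.Transversal}
    {F : 𝒰.XHat S t₀ ≃ₜ 𝒰'.XHat S' t₁} (hF : ∀ z, (F z).toGerm = mapGerm l z.toGerm)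
    {P : Set (𝒰.XHat S t₀)} (hP : P ∈ 𝒰.hatPlaques S t₀) {Q : Set (𝒰'.XHat S' t₁)}
    (hQ : Q ∈ 𝒰'.hatPlaques S' t₁) :
    IsOpenIn (F '' P ∩ Q) (F '' P) ∧ IsOpenIn (F '' P ∩ Q) Q := by
  obtain ⟨i, γ, -, rfl⟩ := hP
  obtain ⟨j, γ', -, rfl⟩ := hQ
  suffices hloc : ∀ z ∈ F '' {z | ∃ q : 𝒰.XTilde S t₀, q.1.1 = i ∧ q.1.2.2 = γ ∧ z = Quot.mk _ q} ∩
      {z | ∃ q : 𝒰'.XTilde S' t₁, q.1.1 = j ∧ q.1.2.2 = γ' ∧ z = Quot.mk _ q},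
      ∃ O : Set (𝒰'.XHat S' t₁), IsOpen O ∧ z ∈ O ∧ ∀ w ∈ O,
        (w ∈ F '' {z | ∃ q : 𝒰.XTilde S t₀, q.1.1 = i ∧ q.1.2.2 = γ ∧ z = Quot.mk _ q} ↔
          w ∈ {z | ∃ q : 𝒰'.XTilde S' t₁, q.1.1 = j ∧ q.1.2.2 = γ' ∧ z = Quot.mk _ q}) by
    refine ⟨isOpenIn_of_forall inter_subset_left fun z hz => ?_,
      isOpenIn_of_forall inter_subset_right fun z hz => ?_⟩
    · obtain ⟨O, hO, hzO, H⟩ := hloc z hz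
      exact ⟨O, hO, hzO, fun w hw => ⟨hw.1, (H w hw.2).1 hw.1⟩⟩
    · obtain ⟨O, hO, hzO, H⟩ := hloc z hz
      exact ⟨O, hO, hzO, fun w hw => ⟨(H w hw.2).2 hw.1, hw.1⟩⟩
  rintro _ ⟨⟨_, ⟨⟨⟨i, ⟨x, hxi⟩, γ⟩, hq⟩, rfl, rfl, rfl⟩, rfl⟩,
    ⟨⟨⟨j, ⟨y, hyj⟩, γ'⟩, hr⟩, rfl, rfl, hqr⟩⟩
  obtain ⟨g, -, hg, -, -⟩ := XTilde.exists_rep ⟨⟨i, ⟨x, hxi⟩, γ⟩, hq⟩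
  obtain ⟨g', -, hg', -, -⟩ := XTilde.exists_rep ⟨⟨j, ⟨y, hyj⟩, γ'⟩, hr⟩
  have h1 := hF (Quot.mk _ ⟨⟨i, ⟨x, hxi⟩, γ⟩, hq⟩)
  rw [hqr] at h1
  change XTilde.toGerm _ = mapGerm l (XTilde.toGerm _) at h1
  rw [XTilde.toGerm_eq _ hg, XTilde.toGerm_eq _ hg'] at h1
  obtain ⟨hyx, h2⟩ := sigma_germ_eq_iff.1 h1
  change y = x at hyx
  subst hyx
  obtain ⟨c, B, hB, hyB, -⟩ := exists_isBox 𝒰 𝒰' hxi hyj univ_mem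
  -- The relation `γ' c = l γ`, once moved to the transversal, no longer refers to `y`; it applies
  -- at every `x ∈ B` with the same image under `p_i`.
  have hcg : ∀ᶠ t in 𝓝 (𝒰.pr i y), g' (c t) = l (g t) := by
    rw [eventually_nhds_pr hxi]
    filter_upwards [h2, hB.isOpen.mem_nhds hyB] with x e1 e2
    rw [hB.map_pr x e2]
    exact e1
  have hqy : 𝒰.pr i y = γ.source := (pr_of_mem hxi).trans hq
  have hry : 𝒰'.pr j y = γ'.source := (pr_of_mem hyj).trans hr
  have step : ∀ x (hx : x ∈ B) (e : 𝒰.p i ⟨x, hB.left hx⟩ = γ.source)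
      (e' : 𝒰'.p j ⟨x, hB.right hx⟩ = γ'.source),
      F (Quot.mk _ ⟨⟨i, ⟨x, hB.left hx⟩, γ⟩, e⟩) = Quot.mk _ ⟨⟨j, ⟨x, hB.right hx⟩, γ'⟩, e'⟩ := by
    intro x hx e e'
    refine XHat.toGerm_injective ((hF _).trans ?_)
    change mapGerm l (XTilde.toGerm _) = XTilde.toGerm _
    rw [XTilde.toGerm_eq (⟨⟨i, ⟨x, hB.left hx⟩, γ⟩, e⟩ : 𝒰.XTilde S t₀) hg,
      XTilde.toGerm_eq (⟨⟨j, ⟨x, hB.right hx⟩, γ'⟩, e'⟩ : 𝒰'.XTilde S' t₁) hg']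
    refine sigma_germ_eq_iff.2 ⟨rfl, ?_⟩
    rw [hqy, ← e, ← pr_of_mem (hB.left hx), eventually_nhds_pr (hB.left hx)] at hcg
    filter_upwards [hcg, hB.isOpen.mem_nhds hx] with x e1 e2
    rw [hB.map_pr x e2] at e1
    exact e1.symm
  refine ⟨𝒰'.piHat S' t₁ ⁻¹' B, hB.isOpen.preimage continuous_piHat, ?_, fun w hw => ⟨?_, ?_⟩⟩
  · rw [hqr]
    exact hyB
  · rintro ⟨_, ⟨⟨⟨_, ⟨x, hx⟩, _⟩, e⟩, rfl, rfl, rfl⟩, rfl⟩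
    have hpi := piHat_eq_of_toGerm_eq (hF (Quot.mk _ ⟨⟨_, ⟨x, hx⟩, _⟩, e⟩))
    replace hw : x ∈ B := mem_of_eq_of_mem hpi.symm hw
    have e' : 𝒰'.p j ⟨x, hB.right hw⟩ = γ'.source := by
      rw [← pr_of_mem, ← hB.map_pr x hw, ← hry, ← hB.map_pr y hyB, hqy, pr_of_mem hx]
      exact congrArg c e
    exact ⟨⟨⟨j, ⟨x, hB.right hw⟩, γ'⟩, e'⟩, rfl, rfl, step x hw e e'⟩
  · rintro ⟨⟨⟨_, ⟨x, hx⟩, _⟩, e⟩, rfl, rfl, rfl⟩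
    change x ∈ B at hw
    have e' : 𝒰.p i ⟨x, hB.left hw⟩ = γ.source := by
      rw [← pr_of_mem, ← hB.symm.map_pr x hw, ← hqy, ← hB.symm.map_pr y hyB, hry, pr_of_mem hx]
      exact congrArg c.symm e
    exact ⟨Quot.mk _ ⟨⟨i, ⟨x, hB.left hw⟩, γ⟩, e'⟩,
      ⟨⟨⟨i, ⟨x, hB.left hw⟩, γ⟩, e'⟩, rfl, rfl, rfl⟩, step x hw e' e⟩

end RegularAtlas

end Molino

/-! ### Independence of the base point and of the atlas -/

theorem mainTheorem7 {n : ℕ} {X Z : Type*}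
    [TopologicalSpace X] [PolishSpace X] [CompactSpace X]
    [TopologicalSpace Z] [PolishSpace Z] [LocallyCompactSpace Z]
    (ℱ : Molino.FoliatedStructure n X Z) (hmin : ℱ.IsMinimal)
    {ι ι' : Type*}
    (𝒰 : Molino.RegularAtlas ℱ ι)
    (S : Set (OpenPartialHomeomorph 𝒰.Transversal 𝒰.Transversal))
    (hS : Molino.IsAdmissible 𝒰.holonomyPseudogroup S)
    (i₀ : ι) (x₀ : 𝒰.U i₀)
    (𝒰' : Molino.RegularAtlas ℱ ι')
    (S' : Set (OpenPartialHomeomorph 𝒰'.Transversal 𝒰'.Transversal))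
    (hS' : Molino.IsAdmissible 𝒰'.holonomyPseudogroup S')
    (i₁ : ι') (x₁ : 𝒰'.U i₁) :
    ∃ F : 𝒰.XHat S (𝒰.p i₀ x₀) ≃ₜ 𝒰'.XHat S' (𝒰'.p i₁ x₁),
      Molino.IsFoliatedHomeomorph
        (𝒰.hatPlaques S (𝒰.p i₀ x₀)) (𝒰'.hatPlaques S' (𝒰'.p i₁ x₁)) F ∧
      ∀ z, 𝒰'.piHat S' (𝒰'.p i₁ x₁) (F z) = 𝒰.piHat S (𝒰.p i₀ x₀) z := by
  have : Nonempty 𝒰.Transversal := ⟨𝒰.p i₀ x₀⟩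
  have : Nonempty 𝒰'.Transversal := ⟨𝒰'.p i₁ x₁⟩
  obtain ⟨j, hj⟩ := 𝒰'.cover (x₀ : X)
  obtain ⟨c, B, hB, hxB, -⟩ := Molino.RegularAtlas.exists_isBox 𝒰 𝒰' x₀.2 hj univ_mem
  -- `c` changes the atlas and `a` changes the base point; together they form `l`, with both `a` and
  -- `a⁻¹` in `S̄'` so that both directions are transported.
  obtain ⟨a, ha, ha', has, hat⟩ := Molino.RegularAtlas.exists_mem_starClosure_apply_eq hmin hS'
    (c (𝒰.p i₀ x₀)) (𝒰'.p i₁ x₁)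
  have hc : 𝒰.p i₀ x₀ ∈ c.source := by
    rw [← Molino.RegularAtlas.pr_coe]
    exact hB.pr_mem_source hxB
  obtain ⟨F, hF⟩ := Molino.RegularAtlas.exists_homeomorph_toGerm_eq (S := S) (S' := S')
    (l := c.trans a) (t₀ := 𝒰.p i₀ x₀) (t₁ := 𝒰'.p i₁ x₁) ⟨hc, has⟩ hat
    (fun _ _ _ _ h =>
      (Molino.RegularAtlas.transports_of_isBox hS hS' h hB).trans_right hS'.isLocal ha)
    (fun _ _ _ _ h =>
      (Molino.RegularAtlas.transports_of_isBox hS' hS h hB.symm).trans_left hS'.isLocal ha')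
  exact ⟨F, Molino.isFoliatedHomeomorph_of_coherent Molino.RegularAtlas.exists_mem_hatPlaques
    Molino.RegularAtlas.exists_mem_hatPlaques
    fun P hP Q hQ => Molino.RegularAtlas.coherent_hatPlaques hF hP hQ,
    fun z => Molino.RegularAtlas.piHat_eq_of_toGerm_eq (hF z)⟩
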